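/- Let $\mathbb{k}$ be an algebraically closed field of characteristic $p>0$, let $\zeta\in\mathbb{k}$ be a primitive fourth root of unity (so $p\neq 2$), and fix a square root $\zeta^{1/2}$ of $\zeta$. Let $\mathbf{TL}^{\zeta^{1/2}}$ be the Temperley–Lieb category over $\mathbb{k}$: its objects are the non-negative integers, its morphisms are $\mathbb{k}$-linear combinations of planar tangle diagrams up to isotopy, a closed loop is replaced by $-(\zeta+\zeta^{-1})=0$, composition is stacking, the tensor product is juxtaposition, and the braiding is given by Kauffman's rule: the crossing of two strands is $\zeta^{1/2}\cdot\mathrm{id}_2+\zeta^{-1/2}\cdot(\mathrm{cup}\circ\mathrm{cap})$. For $1\le v<2p$ write $v=[a_1,a_0]=2a_1+a_0$ with $0\le a_1\le p-1$ and $a_0\in\{0,1\}$. Let $\mathrm{E}_{v-1}\in\mathrm{End}(v-1)$ be the associated idempotent, with image the indecomposable tilting object $\mathbb{T}_\zeta(v-1)$. Explicitly, let $\mathrm{JW}_n$ be the generic Jones–Wenzl projector on $n$ strands over $\mathbb{k}(X)$, with loop value $-(X+X^{-1})$, and let $[n]$ be the quantum integer in $X$. If $a_0=0$ or $a_1=0$,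 then $\mathrm{E}_{v-1}$ is the specialization at $X=\zeta$ of $\mathrm{JW}_{v-1}$. If $a_0=1$ and $a_1\geq 1$, it is the specialization at $X=\zeta$ of $$\mathrm{JW}_{v-1}-\tfrac{[v-2]}{[v-1]}\,(\mathrm{JW}_{v-2}\otimes \mathrm{id}_1)(\mathrm{id}_{v-3}\otimes\mathrm{cup})\,\mathrm{JW}_{v-3}\,(\mathrm{id}_{v-3}\otimes\mathrm{cap})(\mathrm{JW}_{v-2}\otimes \mathrm{id}_1).$$ For $v=[a_1,1]$ with $a_1\ge 1$ put $\mathrm{L}^0_{v-1}=\mathrm{E}_{v-1}\circ(\mathrm{id}_{v-3}\otimes(\mathrm{cup}\circ\mathrm{cap}))\circ\mathrm{E}_{v-1}$. Let $v=[a_1,0]$ and $w=[b_1,b_0]$ with $1\le a_1,b_1\le p-1$ and $b_0\in\{0,1\}$. Let $\beta^2_{w-1,v-1}$ be the double braiding on $\mathbb{T}_\zeta(w-1)\otimes\mathbb{T}_\zeta(v-1)$, that is, the double braiding of $w-1$ strands with $v-1$ strands, composed on both sides with $\mathrm{E}_{w-1}\otimes\mathrm{E}_{v-1}$. Let $\mathsf{pTr}^R_{v-1}$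 be the right partial trace over the last $v-1$ strands, so that $\mathsf{pTr}^R_{v-1}(\beta^2_{w-1,v-1})$ is the identity of $\mathbb{T}_\zeta(w-1)$ encircled by a circle labeled by $\mathbb{T}_\zeta(v-1)$. Then: 1. If $b_0=0$, then $\mathsf{pTr}^R_{v-1}(\beta^2_{w-1,v-1})=v(-1)^{b_1-1}\cdot\mathrm{E}_{w-1}$. 2. If $b_0=1$, then $\mathsf{pTr}^R_{v-1}(\beta^2_{w-1,v-1})=2v(-1)^{(a_1-1)+(b_1-1)}\cdot\mathrm{L}^0_{w-1}$. Both equalities hold in $\mathbf{TL}^{\zeta^{1/2}}$, and hence in every quotient by a tensor ideal. -/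

import Mathlib

namespace TemperleyLieb

noncomputable section

/-! ### Planar diagrams

A diagram with `m` boundary points at the bottom and `n` at the top is recorded by its connectivity:
the equivalence relation "lies on the same strand" on the boundary points. -/

/-- The connectivity of all points after `t` has been stacked on top of `s`. -/
def glue {m n l : ℕ} (s : Setoid (Fin m ⊕ Fin n)) (t : Setoid (Fin n ⊕ Fin l)) :
    Setoid (Fin m ⊕ (Fin n ⊕ Fin l)) :=
  s.map (Sum.map id Sum.inl) ⊔ t.map Sum.inr

/-- The boundary points of a stacked diagram among all its points. -/
def outer {m n l : ℕ} : Fin m ⊕ Fin l → Fin m ⊕ (Fin n ⊕ Fin l) :=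
  Sum.map id Sum.inr

/-- Vertical stacking (`s` below `t`), closed loops being discarded. -/
def stackRel {m n l : ℕ} (s : Setoid (Fin m ⊕ Fin n)) (t : Setoid (Fin n ⊕ Fin l)) :
    Setoid (Fin m ⊕ Fin l) :=
  (glue s t).comap outer

/-- The number of closed loops created by stacking: the components of the stacked diagram that
contain no boundary point. -/
def loops {m n l : ℕ} (s : Setoid (Fin m ⊕ Fin n)) (t : Setoid (Fin n ⊕ Fin l)) : ℕ :=
  Nat.card {c : Quotient (glue s t) // ∀ x : Fin m ⊕ Fin l, Quotient.mk (glue s t) (outer x) ≠ c}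

/-- Horizontal juxtaposition (`s` to the left of `t`). -/
def juxtRel {m n m' n' : ℕ} (s : Setoid (Fin m ⊕ Fin n)) (t : Setoid (Fin m' ⊕ Fin n')) :
    Setoid (Fin (m + m') ⊕ Fin (n + n')) :=
  s.map (Sum.map (Fin.castAdd m') (Fin.castAdd n')) ⊔ t.map (Sum.map (Fin.natAdd m) (Fin.natAdd n))

/-- `n` vertical strands. -/
def idRel (n : ℕ) : Setoid (Fin n ⊕ Fin n) := Setoid.ker (Sum.elim id id)

/-- The connectivities of planar diagrams: those of the diagrams built from vertical strands,
cups and caps by stacking and juxtaposition. -/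
inductive IsPlanar : {m n : ℕ} → Setoid (Fin m ⊕ Fin n) → Prop
  | strands (n : ℕ) : IsPlanar (idRel n)
  | cup : IsPlanar (⊤ : Setoid (Fin 0 ⊕ Fin 2))
  | cap : IsPlanar (⊤ : Setoid (Fin 2 ⊕ Fin 0))
  | stack {m n l : ℕ} {s : Setoid (Fin m ⊕ Fin n)} {t : Setoid (Fin n ⊕ Fin l)} :
      IsPlanar s → IsPlanar t → IsPlanar (stackRel s t)
  | juxt {m n m' n' : ℕ} {s : Setoid (Fin m ⊕ Fin n)} {t : Setoid (Fin m' ⊕ Fin n')} :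
      IsPlanar s → IsPlanar t → IsPlanar (juxtRel s t)

/-- Planar diagrams without closed loops, up to isotopy, from `m` points to `n` points. -/
def Diagram (m n : ℕ) : Type := {s : Setoid (Fin m ⊕ Fin n) // IsPlanar s}

/-! ### The Temperley-Lieb category -/

/-- Morphisms `m → n` of the Temperley-Lieb category over `R`: formal linear combinations of planar
diagrams. -/
abbrev Hom (R : Type*) [CommRing R] (m n : ℕ) : Type _ := Diagram m n →₀ R

section Category

variable {R : Type*} [CommRing R]

/-- The identity of the object `n`. -/
def idHom (n : ℕ) : Hom R n n := Finsupp.single ⟨idRel n, IsPlanar.strands n⟩ 1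

/-- The identity, regarded as a morphism between equal objects. -/
def eqHom {m n : ℕ} (h : m = n) : Hom R m n := h ▸ idHom m

/-- The cup `0 → 2`. -/
def cup : Hom R 0 2 := Finsupp.single ⟨⊤, IsPlanar.cup⟩ 1

/-- The cap `2 → 0`. -/
def cap : Hom R 2 0 := Finsupp.single ⟨⊤, IsPlanar.cap⟩ 1

/-- Composition, first `f` and then `g`: bilinear extension of stacking, each closed loop being
replaced by the scalar `δ`. -/
def comp (δ : R) {m n l : ℕ} (f : Hom R m n) (g : Hom R n l) : Hom R m l :=
  f.sum fun D a => g.sum fun D' b =>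
    Finsupp.single ⟨stackRel D.1 D'.1, IsPlanar.stack D.2 D'.2⟩ (a * b * δ ^ loops D.1 D'.1)

/-- Tensor product: bilinear extension of juxtaposition. -/
def tensor {m n m' n' : ℕ} (f : Hom R m n) (g : Hom R m' n') : Hom R (m + m') (n + n') :=
  f.sum fun D a => g.sum fun D' b =>
    Finsupp.single ⟨juxtRel D.1 D'.1, IsPlanar.juxt D.2 D'.2⟩ (a * b)

/-- The cap followed by the cup, as an endomorphism of `2`. -/
def capCup (δ : R) : Hom R 2 2 := comp δ cap cup

/-- Right partial trace over one strand. -/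
def pTrOne (δ : R) {m : ℕ} (f : Hom R (m + 1) (m + 1)) : Hom R m m :=
  comp δ (comp δ (tensor (idHom m) cup : Hom R m (m + 2)) (tensor f (idHom 1) :))
    (tensor (idHom m) cap : Hom R (m + 2) m)

/-- Right partial trace over the last `n` strands. -/
def pTr (δ : R) {m : ℕ} : (n : ℕ) → Hom R (m + n) (m + n) → Hom R m m
  | 0, f => f
  | n + 1, f => pTr δ n (pTrOne δ (m := m + n) f)

end Category

section Braiding

variable {k : Type*} [Field k]

/-- The value of a closed loop for the parameter `q`. -/
def loopValue (q : k) : k := -(q + q⁻¹)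

/-- The crossing of two strands given by Kauffman's bracket rule; `s` is the chosen square root of
the parameter. -/
def crossing (s : k) : Hom k 2 2 := s • idHom 2 + s⁻¹ • capCup (loopValue (s ^ 2))

/-- The braiding of `m` strands with one strand: the single strand crosses the `m` strands one
after the other, starting with the rightmost. -/
def braidOne (s : k) : (m : ℕ) → Hom k (m + 1) (1 + m)
  | 0 => eqHom (by omega)
  | m + 1 => comp (loopValue (s ^ 2)) (tensor (idHom m) (crossing s) : Hom k (m + 2) (m + 2))
      (tensor (braidOne s m) (idHom 1) :)

/-- The braiding of `m` strands with `n` strands. -/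
def braid (s : k) (m : ℕ) : (n : ℕ) → Hom k (m + n) (n + m)
  | 0 => eqHom (by omega)
  | n + 1 => comp (loopValue (s ^ 2)) (tensor (braid s m n) (idHom 1) :)
      (comp (loopValue (s ^ 2)) (tensor (idHom n) (braidOne s m) :)
        (eqHom (by omega)))

end Braiding

/-! ### Generic Jones-Wenzl projectors and their specializations -/

section Idempotents

variable {k : Type*} [Field k]

/-- The generic quantum integer `[n]` in `k(X)`. -/
def qInt (k : Type*) [Field k] (n : ℕ) : RatFunc k :=
  (RatFunc.X ^ n - RatFunc.X⁻¹ ^ n) / (RatFunc.X - RatFunc.X⁻¹)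

/-- The generic Jones-Wenzl projector on `n` strands over `k(X)`, by Wenzl's recursion. -/
def jonesWenzl (k : Type*) [Field k] : (n : ℕ) → Hom (RatFunc k) n n
  | 0 => idHom 0
  | 1 => idHom 1
  | n + 2 =>
      let δ : RatFunc k := loopValue RatFunc.X
      let P : Hom (RatFunc k) (n + 2) (n + 2) := (tensor (jonesWenzl k (n + 1)) (idHom 1) :)
      P + (qInt k (n + 1) / qInt k (n + 2)) •
        comp δ (comp δ P (tensor (idHom n) (capCup δ))) P

/-- Specialization `X ↦ ζ` of the coefficients of a generic morphism. -/
def specialize (ζ : k) {m n : ℕ} (f : Hom (RatFunc k) m n) : Hom k m n :=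
  f.mapRange (fun c => c.eval (RingHom.id k) ζ) (RatFunc.eval_zero _ _)

/-- The generic form of the idempotent on `n` strands, for `ℓ = 2`, where
`v = n + 1 = [a₁, a₀]` has at most two digits. It is the sum over the support `{2 a₁ ± a₀}` of `v`:
if `a₀ = 0` or `a₁ = 0` this is the Jones-Wenzl projector alone; if `v = [a₁, 1]` with `a₁ ≥ 1`,
there is a second summand, which factors through the Jones-Wenzl projector on `n - 2` strands. -/
def genericE (k : Type*) [Field k] : (n : ℕ) → Hom (RatFunc k) n n
  | 0 => jonesWenzl k 0
  | 1 => jonesWenzl k 1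
  | n + 2 =>
      if Even (n + 2) then
        let δ : RatFunc k := loopValue RatFunc.X
        let P : Hom (RatFunc k) (n + 2) (n + 2) := (tensor (jonesWenzl k (n + 1)) (idHom 1) :)
        let D : Hom (RatFunc k) (n + 2) n := comp δ P (tensor (idHom n) cap)
        let U : Hom (RatFunc k) n (n + 2) := comp δ (tensor (idHom n) cup) P
        jonesWenzl k (n + 2) -
          (qInt k (n + 1) / qInt k (n + 2)) • comp δ (comp δ D (jonesWenzl k n)) U
      else jonesWenzl k (n + 2)

/-- The idempotent `E_n` on `n` strands at a primitive fourth root of unity `ζ` in characteristic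
`p`, for `n + 1 < 2 p`. -/
def E (ζ : k) (n : ℕ) : Hom k n n := specialize ζ (genericE k n)

/-- The nilpotent endomorphism `L⁰_n = E_n ∘ (id ⊗ cup ∘ cap) ∘ E_n`, for `n ≥ 2`. -/
def L (ζ : k) : (n : ℕ) → Hom k n n
  | n + 2 => comp (loopValue ζ)
      (comp (loopValue ζ) (E ζ (n + 2)) (tensor (idHom n) (capCup (loopValue ζ)))) (E ζ (n + 2))
  | _ => 0

/-- The double braiding of the objects defined by the idempotents `E_m` and `E_n`, as an
endomorphism of their tensor product. The parameter is `ζ = s ^ 2`. -/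
def doubleBraid (s : k) (m n : ℕ) : Hom k (m + n) (m + n) :=
  let δ : k := loopValue (s ^ 2)
  let EE : Hom k (m + n) (m + n) := tensor (E (s ^ 2) m) (E (s ^ 2) n)
  comp δ (comp δ EE (comp δ (braid s m n) (braid s n m))) EE

/-- The identity of the object defined by `E_m`, encircled by a circle labeled by the object
defined by `E_n`. -/
def encircle (s : k) (m n : ℕ) : Hom k m m :=
  pTr (loopValue (s ^ 2)) n (doubleBraid s m n)

end Idempotents

end

end TemperleyLieb

/-! Write q = ζ, r = ζ⁻¹, and let x be the plain one-strand circle around m strands. Three facts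
about x carry the proof. First, x is central among the elements on the enclosed strands, and over
`k(X)` a circle labeled by the n-th Jones-Wenzl projector equals U_n(x), with U_0 = 1, U_1 = x,
U_{n+2} = x U_{n+1} - U_n (`trace_dbl_jw`). This follows from Wenzl's recursion: closing the
correction term removes two strands of the circle with total coefficient -1. Second, x acts on
anything killed by all caps on the m strands as -(q^{m+1} + r^{m+1}) (`circ_mul`). Third, if J is
the projector on m - 1 strands, then JxJ is an explicit combination of J and JuJ, where u is the
last generator on the m strands (`mul_circ_mul`).

Set v = 2(a+1) and b₁ = b + 1, so the circle carries 2a+1 strands. For w even, E_{w-1} is the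
Jones-Wenzl projector on 2b+1 strands, on which x acts as 2ε with ε = (-1)^b; then U_{2a+1}(2ε) =
(2a+2)ε = vε. For w odd, the second summand of E_{w-1} cancels Wenzl's correction, so E_{w-1} = J ⊗
id with J the projector on 2b+1 strands (`toRel_genericE_even`). Here the coefficient of J in JxJ
vanishes at ζ, leaving xJ = 4(-1)^b JuJ, and x kills JuJ because JuJuJ is a multiple of [2b+2],
which is zero at ζ. Only the linear coefficient (-1)^a (a+1) of U_{2a+1} contributes, giving
4(a+1)(-1)^{a+b} = 2v(-1)^{a+b}.

These arguments are generic and must be specialized at X = ζ, although the projectors on an even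
number of strands may have poles there. A two-step form of Wenzl's recursion (`jw_add_four`) avoids
them. Its denominators are odd quantum integers, which are ±1 at ζ, and quotients [2j]/[2j+2], which
become -j/(j+1); the latter are harmless since j + 1 < p. Identities between regular elements are
checked over `k(X)` and then evaluated.

To compute without tracking objects, the category is mapped faithfully to one algebra. A diagram
becomes the linear relation between `ZMod 2`-labelings of a half-infinite row below and above it. A
composition is weighted by δ to the power log₂ of the number of intermediate labelings that vanish
on the boundary, and this power is the number of closed loops. Tensor products become products at
shifted positions, and identities become 1. -/

namespace TemperleyLieb

noncomputable section

/-! ### Linear relations on labelings and their twisted algebra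

Diagrams are compared through the labelings of the points of a half-infinite row by elements of
`ZMod 2` that are constant along the strands. -/

/-- Labelings of a half-infinite row of points. -/
abbrev Lab : Type := ℕ → ZMod 2

/-- Linear relations between labelings. -/
abbrev LRel : Type := AddSubgroup (Lab × Lab)

namespace LRel

/-- Composition of relations. -/
def comp (r t : LRel) : LRel where
  carrier := {p | ∃ y, (p.1, y) ∈ r ∧ (y, p.2) ∈ t}
  zero_mem' := ⟨0, r.zero_mem, t.zero_mem⟩
  add_mem' := by
    rintro ⟨a, b⟩ ⟨c, d⟩ ⟨y, h1, h2⟩ ⟨z, h3, h4⟩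
    exact ⟨y + z, r.add_mem h1 h3, t.add_mem h2 h4⟩
  neg_mem' := by
    rintro ⟨a, b⟩ ⟨y, h1, h2⟩
    exact ⟨-y, r.neg_mem h1, t.neg_mem h2⟩

theorem mem_comp {r t : LRel} {x z : Lab} :
    (x, z) ∈ comp r t ↔ ∃ y, (x, y) ∈ r ∧ (y, z) ∈ t := Iff.rfl

/-- The identity relation. -/
def diag : LRel where
  carrier := {p | p.1 = p.2}
  zero_mem' := rfl
  add_mem' := by
    rintro ⟨a, b⟩ ⟨c, d⟩ h1 h2
    exact congrArg₂ (· + ·) h1 h2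
  neg_mem' := by
    rintro ⟨a, b⟩ h
    exact congrArg (- ·) h

theorem mem_diag {x y : Lab} : (x, y) ∈ diag ↔ x = y := Iff.rfl

theorem comp_assoc (r t u : LRel) : comp (comp r t) u = comp r (comp t u) := by
  ext ⟨x, w⟩
  constructor
  · rintro ⟨z, ⟨y, h1, h2⟩, h3⟩
    exact ⟨y, h1, z, h2, h3⟩
  · rintro ⟨y, h1, z, h2, h3⟩
    exact ⟨z, ⟨y, h1, h2⟩, h3⟩

theorem diag_comp (r : LRel) : comp diag r = r := by
  ext ⟨x, z⟩
  simp [mem_comp, mem_diag]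

theorem comp_diag (r : LRel) : comp r diag = r := by
  ext ⟨x, z⟩
  simp [mem_comp, mem_diag]

/-- The intermediate labelings in a composition that vanish on the boundary. -/
def mid (r t : LRel) : Set Lab := {y | (0, y) ∈ r ∧ (y, 0) ∈ t}

theorem card_mid_eq_one {r t : LRel} (h : ∀ y, (0, y) ∈ r → (y, 0) ∈ t → y = 0) :
    Nat.card (mid r t) = 1 := by
  have : mid r t = {0} := by
    ext y
    constructor
    · rintro ⟨h1, h2⟩
      exact h y h1 h2
    · rintro rfl
      exact ⟨r.zero_mem, t.zero_mem⟩
  rw [this]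
  simp

/-- The pairs (y, z) on the right are fibred over z. Subtracting a chosen intermediate labeling `c
z` identifies each fibre with `mid r t`. Fibring over y instead gives `card_mid_mul_right`; equating
the two counts yields the cocycle identity, hence associativity. -/
theorem card_mid_mul_left (r t u : LRel) :
    Nat.card (mid r t) * Nat.card (mid (comp r t) u) =
      Nat.card {p : Lab × Lab | (0, p.1) ∈ r ∧ p ∈ t ∧ (p.2, 0) ∈ u} := by
  rw [← Nat.card_prod]
  choose c hc using fun z : mid (comp r t) u => z.2.1
  refine Nat.card_congr ⟨fun q => ⟨(q.1.1 + c q.2, q.2.1), ?_, ?_, q.2.2.2⟩,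
    fun p => (⟨p.1.1 - c ⟨p.1.2, ⟨p.1.1, p.2.1, p.2.2.1⟩, p.2.2.2⟩, ?_, ?_⟩,
      ⟨p.1.2, ⟨p.1.1, p.2.1, p.2.2.1⟩, p.2.2.2⟩), ?_, ?_⟩
  · simpa using r.add_mem q.1.2.1 (hc q.2).1
  · simpa using t.add_mem q.1.2.2 (hc q.2).2
  · simpa using r.sub_mem p.2.1 (hc ⟨p.1.2, ⟨p.1.1, p.2.1, p.2.2.1⟩, p.2.2.2⟩).1
  · have := t.sub_mem p.2.2.1 (hc ⟨p.1.2, ⟨p.1.1, p.2.1, p.2.2.1⟩, p.2.2.2⟩).2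
    rwa [Prod.sub_def, sub_self] at this
  · rintro ⟨⟨y, hy⟩, ⟨z, hz⟩⟩
    simp
  · rintro ⟨⟨y, z⟩, h⟩
    simp

theorem card_mid_mul_right (r t u : LRel) :
    Nat.card (mid t u) * Nat.card (mid r (comp t u)) =
      Nat.card {p : Lab × Lab | (0, p.1) ∈ r ∧ p ∈ t ∧ (p.2, 0) ∈ u} := by
  rw [← Nat.card_prod]
  choose c hc using fun z : mid r (comp t u) => z.2.2
  refine Nat.card_congr ⟨fun q => ⟨(q.2.1, q.1.1 + c q.2), q.2.2.1, ?_, ?_⟩,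
    fun p => (⟨p.1.2 - c ⟨p.1.1, p.2.1, ⟨p.1.2, p.2.2.1, p.2.2.2⟩⟩, ?_, ?_⟩,
      ⟨p.1.1, p.2.1, ⟨p.1.2, p.2.2.1, p.2.2.2⟩⟩), ?_, ?_⟩
  · simpa using t.add_mem q.1.2.1 (hc q.2).1
  · simpa using u.add_mem q.1.2.2 (hc q.2).2
  · have := t.sub_mem p.2.2.1 (hc ⟨p.1.1, p.2.1, ⟨p.1.2, p.2.2.1, p.2.2.2⟩⟩).1
    rwa [Prod.sub_def, sub_self] at this
  · simpa using u.sub_mem p.2.2.2 (hc ⟨p.1.1, p.2.1, ⟨p.1.2, p.2.2.1, p.2.2.2⟩⟩).2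
  · rintro ⟨⟨y, hy⟩, ⟨z, hz⟩⟩
    simp
  · rintro ⟨⟨y, z⟩, h⟩
    simp

end LRel

/-! ### Loop weights and the cocycle identity -/

section Weight

variable {R : Type*} [CommRing R]

/-- The weight of `2 ^ l` middle labelings is `δ ^ l`. -/
def weight (δ : R) (n : ℕ) : R := if n = 0 then 0 else δ ^ padicValNat 2 n

/-- The valuation makes this hold for all natural numbers, and the value 0 at 0 covers infinite
sets, whose `Nat.card` is 0. So the cocycle identity needs neither finiteness nor cardinalities that
are powers of two. -/
theorem weight_mul (δ : R) (a b : ℕ) : weight δ (a * b) = weight δ a * weight δ b := by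
  unfold weight
  by_cases ha : a = 0
  · simp [ha]
  by_cases hb : b = 0
  · simp [hb]
  rw [if_neg ha, if_neg hb, if_neg (mul_ne_zero ha hb), padicValNat.mul ha hb, pow_add]

theorem weight_two_pow (δ : R) (l : ℕ) : weight δ (2 ^ l) = δ ^ l := by
  simp [weight]

theorem weight_one (δ : R) : weight δ 1 = 1 := by
  simp [weight]

theorem map_weight {S : Type*} [CommRing S] (φ : R →+* S) (δ : R) (n : ℕ) :
    φ (weight δ n) = weight (φ δ) n := by
  unfold weight
  split_ifs <;> simp

/-- The weight of a composition of relations. -/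
def cocycle (δ : R) (r t : LRel) : R := weight δ (Nat.card (LRel.mid r t))

theorem cocycle_assoc (δ : R) (r t u : LRel) :
    cocycle δ r t * cocycle δ (r.comp t) u = cocycle δ t u * cocycle δ r (t.comp u) := by
  unfold cocycle
  rw [← weight_mul, ← weight_mul, LRel.card_mid_mul_left, LRel.card_mid_mul_right]

theorem cocycle_eq_one (δ : R) {r t : LRel} (h : ∀ y, (0, y) ∈ r → (y, 0) ∈ t → y = 0) :
    cocycle δ r t = 1 := by
  rw [cocycle, LRel.card_mid_eq_one h, weight_one]

theorem cocycle_diag_left (δ : R) (r : LRel) : cocycle δ LRel.diag r = 1 :=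
  cocycle_eq_one δ fun _ h _ => (LRel.mem_diag.1 h).symm

theorem cocycle_diag_right (δ : R) (r : LRel) : cocycle δ r LRel.diag = 1 :=
  cocycle_eq_one δ fun _ _ h => LRel.mem_diag.1 h

end Weight

/-- The algebra of formal combinations of linear relations, a composition being weighted by
powers of `δ`. -/
def RelAlg (R : Type*) [CommRing R] (_δ : R) : Type _ := LRel →₀ R

namespace RelAlg

variable {R : Type*} [CommRing R] {δ : R}

instance : AddCommGroup (RelAlg R δ) := inferInstanceAs (AddCommGroup (LRel →₀ R))
instance : Module R (RelAlg R δ) := inferInstanceAs (Module R (LRel →₀ R))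

/-- A multiple of a relation. -/
def of (δ : R) (r : LRel) : R →ₗ[R] RelAlg R δ := Finsupp.lsingle r

theorem linearMap_ext {N : Type*} [AddCommGroup N] [Module R N] {f g : RelAlg R δ →ₗ[R] N}
    (h : ∀ r, f (of δ r 1) = g (of δ r 1)) : f = g :=
  Finsupp.lhom_ext' fun r => LinearMap.ext_ring (h r)

@[elab_as_elim]
theorem induction {P : RelAlg R δ → Prop} (x : RelAlg R δ) (zero : P 0)
    (add : ∀ x y, P x → P y → P (x + y)) (of : ∀ r a, P (of δ r a)) : P x :=
  Finsupp.induction_linear x zero add of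

/-- Linear extension of a map on relations. -/
def lift {N : Type*} [AddCommGroup N] [Module R N] (δ : R) (f : LRel → N) : RelAlg R δ →ₗ[R] N :=
  Finsupp.lift N R LRel f

theorem lift_of {N : Type*} [AddCommGroup N] [Module R N] (f : LRel → N) (r : LRel) (a : R) :
    lift δ f (of δ r a) = a • f r :=
  Finsupp.sum_single_index (by simp)

/-- The product as a bilinear map. -/
def mulHom (δ : R) : RelAlg R δ →ₗ[R] RelAlg R δ →ₗ[R] RelAlg R δ :=
  lift δ fun r => lift δ fun t => of δ (r.comp t) (cocycle δ r t)

theorem mulHom_of (r t : LRel) (a b : R) :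
    mulHom δ (of δ r a) (of δ t b) = of δ (r.comp t) (a * b * cocycle δ r t) := by
  rw [mulHom, lift_of, LinearMap.smul_apply, lift_of, ← _root_.map_smul, ← _root_.map_smul,
    smul_eq_mul, smul_eq_mul, mul_assoc]

instance : Mul (RelAlg R δ) := ⟨fun x y => mulHom δ x y⟩
instance : One (RelAlg R δ) := ⟨of δ LRel.diag 1⟩

theorem mul_def (x y : RelAlg R δ) : x * y = mulHom δ x y := rfl

theorem one_def : (1 : RelAlg R δ) = of δ LRel.diag 1 := rfl

theorem of_mul_of (r t : LRel) (a b : R) :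
    of δ r a * of δ t b = of δ (r.comp t) (a * b * cocycle δ r t) := mulHom_of r t a b

theorem mulHom_assoc (x y z : RelAlg R δ) :
    mulHom δ (mulHom δ x y) z = mulHom δ x (mulHom δ y z) := by
  induction x using RelAlg.induction with
  | zero => simp
  | add x₁ x₂ h₁ h₂ => simp only [map_add, LinearMap.add_apply, h₁, h₂]
  | of r a =>
    induction y using RelAlg.induction with
    | zero => simp
    | add x₁ x₂ h₁ h₂ => simp only [map_add, LinearMap.add_apply, h₁, h₂]
    | of t b =>
      induction z using RelAlg.induction with
      | zero => simp
      | add x₁ x₂ h₁ h₂ => simp only [map_add, h₁, h₂]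
      | of u c =>
        rw [mulHom_of, mulHom_of, mulHom_of, mulHom_of, LRel.comp_assoc]
        congr 1
        linear_combination (a * b * c) * cocycle_assoc δ r t u

instance : Ring (RelAlg R δ) :=
  { (inferInstance : AddCommGroup (RelAlg R δ)) with
    mul := (· * ·)
    one := 1
    left_distrib := fun x y z => map_add (mulHom δ x) y z
    right_distrib := fun x y z => by simp [mul_def]
    zero_mul := fun x => by simp [mul_def]
    mul_zero := fun x => by simp [mul_def]
    mul_assoc := mulHom_assoc
    one_mul := fun x => by
      have : mulHom δ (of δ LRel.diag 1) = LinearMap.id := linearMap_ext fun r => by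
        rw [mulHom_of, LRel.diag_comp, cocycle_diag_left]
        simp
      exact LinearMap.congr_fun this x
    mul_one := fun x => by
      have : (mulHom δ).flip (of δ LRel.diag 1) = LinearMap.id := linearMap_ext fun r => by
        rw [LinearMap.flip_apply, mulHom_of, LRel.comp_diag, cocycle_diag_right]
        simp
      exact LinearMap.congr_fun this x }

instance : Algebra R (RelAlg R δ) :=
  Algebra.ofModule (fun a x y => by simp [mul_def]) (fun a x y => by simp [mul_def])

/-- Change of coefficients, additively. -/
def mapAdd {S : Type*} [CommRing S] (φ : R →+* S) (δ : R) (δ' : S) : RelAlg R δ →+ RelAlg S δ' :=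
  Finsupp.mapRange.addMonoidHom (φ : R →+ S)

theorem mapAdd_of {S : Type*} [CommRing S] (φ : R →+* S) (δ' : S) (r : LRel) (a : R) :
    mapAdd φ δ δ' (of δ r a) = of δ' r (φ a) :=
  Finsupp.mapRange_single (f := φ) (hf := map_zero φ)

/-- Change of coefficients. -/
def map {S : Type*} [CommRing S] (φ : R →+* S) {δ' : S} (h : φ δ = δ') :
    RelAlg R δ →+* RelAlg S δ' :=
  { mapAdd φ δ δ' with
    map_one' := (mapAdd_of φ δ' _ _).trans (by rw [map_one]; rfl)
    map_mul' := fun x y => by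
      change mapAdd φ δ δ' (x * y) = mapAdd φ δ δ' x * mapAdd φ δ δ' y
      induction x using RelAlg.induction with
      | zero => simp
      | add x₁ x₂ h₁ h₂ => simp only [add_mul, map_add, h₁, h₂]
      | of r a =>
        induction y using RelAlg.induction with
        | zero => simp
        | add x₁ x₂ h₁ h₂ => simp only [mul_add, map_add, h₁, h₂]
        | of t b =>
          rw [mapAdd_of, mapAdd_of, of_mul_of, of_mul_of, mapAdd_of]
          congr 1
          simp [cocycle, map_weight, h] }

theorem map_of {S : Type*} [CommRing S] (φ : R →+* S) {δ' : S} (h : φ δ = δ') (r : LRel) (a : R) :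
    map φ h (of δ r a) = of δ' r (φ a) := mapAdd_of φ δ' r a

theorem map_smul {S : Type*} [CommRing S] (φ : R →+* S) {δ' : S} (h : φ δ = δ') (a : R)
    (x : RelAlg R δ) : map φ h (a • x) = φ a • map φ h x := by
  induction x using RelAlg.induction with
  | zero => simp
  | add x₁ x₂ h₁ h₂ => simp only [smul_add, map_add, h₁, h₂]
  | of r b =>
    rw [← _root_.map_smul, map_of, map_of, ← _root_.map_smul, smul_eq_mul, smul_eq_mul, map_mul]

theorem map_injective {S : Type*} [CommRing S] (φ : R →+* S) {δ' : S} (h : φ δ = δ')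
    (hφ : Function.Injective φ) : Function.Injective (map φ h) :=
  Finsupp.mapRange_injective φ (map_zero φ) hφ

end RelAlg

/-! ### Diagrams as linear relations -/

/-- The labeling that agrees with `x` on the first `o` points, with `v` on the next `n` points, and
with `z` afterwards. -/
def blockLab (o : ℕ) {n : ℕ} (x : Lab) (v : Fin n → ZMod 2) (z : Lab) : Lab := fun i =>
  if i < o then x i else if h : i - o < n then v ⟨i - o, h⟩ else z (i - o - n)

section BlockLab

variable {o n : ℕ} {x z : Lab} {v : Fin n → ZMod 2}

theorem blockLab_of_lt {i : ℕ} (h : i < o) : blockLab o x v z i = x i := if_pos h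

theorem blockLab_add (i : Fin n) : blockLab o x v z (o + i) = v i := by
  simp [blockLab]

theorem blockLab_add_add (i : ℕ) : blockLab o x v z (o + n + i) = z i := by
  have h₁ : ¬ o + n + i < o := by omega
  have h₂ : ¬ o + n + i - o < n := by omega
  rw [blockLab, if_neg h₁, dif_neg h₂]
  congr 1
  omega

theorem lab_ext (o n : ℕ) {x y : Lab} (h₁ : ∀ i < o, x i = y i)
    (h₂ : ∀ i : Fin n, x (o + i) = y (o + i)) (h₃ : ∀ i, x (o + n + i) = y (o + n + i)) :
    x = y := by
  funext i
  by_cases hi : i < o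
  · exact h₁ i hi
  by_cases hj : i - o < n
  · have := h₂ ⟨i - o, hj⟩
    rwa [show o + (⟨i - o, hj⟩ : Fin n).1 = i by simp; omega] at this
  · have := h₃ (i - o - n)
    rwa [show o + n + (i - o - n) = i by omega] at this

end BlockLab

theorem exists_lab (o : ℕ) {n : ℕ} (x : Lab) (v : Fin n → ZMod 2) (z : Lab) :
    ∃ y : Lab, (∀ i < o, y i = x i) ∧ (∀ i : Fin n, y (o + i) = v i) ∧
      ∀ i, y (o + n + i) = z i :=
  ⟨blockLab o x v z, fun _ h => blockLab_of_lt h, blockLab_add, blockLab_add_add⟩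

/-- The labels of the boundary points of a diagram placed at position `o`. -/
def ptLab (o : ℕ) {m n : ℕ} (x y : Lab) : Fin m ⊕ Fin n → ZMod 2 :=
  Sum.elim (fun i => x (o + i)) (fun j => y (o + j))

/-- The relation between the labelings at the bottom and at the top of a diagram placed at
position `o`, with vertical strands on both sides. -/
def hat (o : ℕ) {m n : ℕ} (s : Setoid (Fin m ⊕ Fin n)) : LRel where
  carrier := {p | (∀ i < o, p.1 i = p.2 i) ∧
    (∀ a b, s a b → ptLab o p.1 p.2 a = ptLab o p.1 p.2 b) ∧
    ∀ i, p.1 (o + m + i) = p.2 (o + n + i)}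
  zero_mem' := ⟨fun _ _ => rfl, fun a b _ => by rcases a with a | a <;> rcases b with b | b <;> rfl,
    fun _ => rfl⟩
  add_mem' := by
    rintro ⟨a, b⟩ ⟨c, d⟩ ⟨h₁, h₂, h₃⟩ ⟨h₄, h₅, h₆⟩
    refine ⟨fun i hi => congrArg₂ (· + ·) (h₁ i hi) (h₄ i hi), fun i j hij => ?_,
      fun i => congrArg₂ (· + ·) (h₃ i) (h₆ i)⟩
    have := congrArg₂ (· + ·) (h₂ i j hij) (h₅ i j hij)
    rcases i with i | i <;> rcases j with j | j <;> exact this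
  neg_mem' := by
    rintro ⟨a, b⟩ ⟨h₁, h₂, h₃⟩
    refine ⟨fun i hi => congrArg (- ·) (h₁ i hi), fun i j hij => ?_,
      fun i => congrArg (- ·) (h₃ i)⟩
    have := congrArg (- ·) (h₂ i j hij)
    rcases i with i | i <;> rcases j with j | j <;> exact this

theorem mem_hat {o m n : ℕ} {s : Setoid (Fin m ⊕ Fin n)} {x y : Lab} :
    (x, y) ∈ hat o s ↔ (∀ i < o, x i = y i) ∧
      (∀ a b, s a b → ptLab o x y a = ptLab o x y b) ∧ ∀ i, x (o + m + i) = y (o + n + i) :=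
  Iff.rfl

/-- `Setoid.map` is a generated equivalence relation, so its inclusion in a kernel can be tested on
generating pairs. -/
theorem map_le_ker_iff {α β γ : Type*} {s : Setoid α} {g : α → β} {f : β → γ} :
    s.map g ≤ Setoid.ker f ↔ ∀ a b, s a b → f (g a) = f (g b) := by
  constructor
  · intro h a b hab
    exact h (Relation.EqvGen.rel _ _ ⟨a, b, hab, rfl, rfl⟩)
  · intro h
    refine Setoid.eqvGen_le ?_
    rintro _ _ ⟨a, b, hab, rfl, rfl⟩
    exact h a b hab

/-- The indicator function of one class is an admissible labeling that separates this class from all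
others. Two labels therefore suffice to recover the connectivity. -/
theorem hat_injective (o : ℕ) {m n : ℕ} :
    Function.Injective (hat o : Setoid (Fin m ⊕ Fin n) → LRel) := by
  have key : ∀ s t : Setoid (Fin m ⊕ Fin n), hat o s ≤ hat o t → t ≤ s := by
    classical
    intro s t h a b hab
    let c : Fin m ⊕ Fin n → ZMod 2 := fun d => if s a d then 1 else 0
    obtain ⟨x, x₁, x₂, x₃⟩ := exists_lab o 0 (c ∘ Sum.inl) 0
    obtain ⟨y, y₁, y₂, y₃⟩ := exists_lab o 0 (c ∘ Sum.inr) 0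
    have hc : ptLab o x y = c := by
      funext d
      rcases d with d | d
      · exact x₂ d
      · exact y₂ d
    have hxy : (x, y) ∈ hat o s := by
      refine ⟨fun i hi => (x₁ i hi).trans (y₁ i hi).symm, ?_,
        fun i => (x₃ i).trans (y₃ i).symm⟩
      intro d e hde
      change ptLab o x y d = ptLab o x y e
      rw [hc]
      have : s a d ↔ s a e := ⟨fun h => s.trans h hde, fun h => s.trans h (s.symm hde)⟩
      simp only [c, this]
    have := (h hxy).2.1 a b hab
    change ptLab o x y a = ptLab o x y b at this
    rw [hc] at this
    by_contra hs
    simp only [c, s.refl a, if_true] at this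
    rw [if_neg hs] at this
    exact one_ne_zero this
  intro s t h
  exact le_antisymm (key t s h.ge) (key s t h.le)

section Stack

variable {m n l : ℕ} (s : Setoid (Fin m ⊕ Fin n)) (t : Setoid (Fin n ⊕ Fin l))

/-- Labels of all points of a stacked diagram. -/
def allLab (o : ℕ) {m n l : ℕ} (x y z : Lab) : Fin m ⊕ (Fin n ⊕ Fin l) → ZMod 2 :=
  Sum.elim (fun i => x (o + i)) (ptLab o y z)

variable {s t}

theorem allLab_outer (o : ℕ) (x y z : Lab) (a : Fin m ⊕ Fin l) :
    allLab (n := n) o x y z (outer a) = ptLab o x z a := by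
  rcases a with a | a <;> rfl

theorem glue_le_ker {o : ℕ} {x y z : Lab}
    (h₁ : ∀ a b, s a b → ptLab o x y a = ptLab o x y b)
    (h₂ : ∀ a b, t a b → ptLab o y z a = ptLab o y z b) :
    glue s t ≤ Setoid.ker (allLab o x y z) := by
  refine sup_le (map_le_ker_iff.2 fun a b hab => ?_) (map_le_ker_iff.2 h₂)
  have := h₁ a b hab
  rcases a with a | a <;> rcases b with b | b <;> exact this

theorem glue_inl {a b : Fin m ⊕ Fin n} (h : s a b) :
    glue s t (Sum.map id Sum.inl a) (Sum.map id Sum.inl b) :=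
  le_sup_left (a := s.map (Sum.map id Sum.inl)) (b := t.map Sum.inr)
    (Relation.EqvGen.rel _ _ ⟨a, b, h, rfl, rfl⟩)

theorem glue_inr {a b : Fin n ⊕ Fin l} (h : t a b) :
    glue s t (Sum.inr a) (Sum.inr b) :=
  le_sup_right (a := s.map (Sum.map id Sum.inl)) (b := t.map Sum.inr)
    (Relation.EqvGen.rel _ _ ⟨a, b, h, rfl, rfl⟩)

/-- The nontrivial inclusion extends a boundary labeling to the middle points: a component meeting
the boundary keeps its label, and a closed loop receives 0. -/
theorem hat_stackRel (o : ℕ) (s : Setoid (Fin m ⊕ Fin n)) (t : Setoid (Fin n ⊕ Fin l)) :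
    hat o (stackRel s t) = (hat o s).comp (hat o t) := by
  classical
  ext ⟨x, z⟩
  rw [LRel.mem_comp]
  constructor
  · rintro ⟨h₁, h₂, h₃⟩
    let g : Quotient (glue s t) → ZMod 2 := fun c =>
      if h : ∃ a : Fin m ⊕ Fin l, Quotient.mk (glue s t) (outer a) = c
      then ptLab o x z h.choose else 0
    have hg : ∀ a : Fin m ⊕ Fin l, g (Quotient.mk _ (outer a)) = ptLab o x z a := by
      intro a
      have h : ∃ b : Fin m ⊕ Fin l, Quotient.mk (glue s t) (outer b) =
        Quotient.mk (glue s t) (outer a) := ⟨a, rfl⟩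
      simp only [g]
      rw [dif_pos h]
      exact h₂ _ _ (Quotient.exact h.choose_spec : glue s t (outer h.choose) (outer a))
    let v : Fin n → ZMod 2 := fun i => g (Quotient.mk _ (Sum.inr (Sum.inl i)))
    obtain ⟨y, y₁, y₂, y₃⟩ := exists_lab o x v (fun i => x (o + m + i))
    have hs : ∀ a : Fin m ⊕ Fin n,
        ptLab o x y a = g (Quotient.mk _ (Sum.map id Sum.inl a)) := by
      rintro (a | a)
      · exact (hg (Sum.inl a)).symm
      · exact y₂ a
    have ht : ∀ a : Fin n ⊕ Fin l, ptLab o y z a = g (Quotient.mk _ (Sum.inr a)) := by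
      rintro (a | a)
      · exact y₂ a
      · exact (hg (Sum.inr a)).symm
    refine ⟨y, ⟨fun i hi => (y₁ i hi).symm, fun a b hab => ?_,
      fun i => (y₃ i).symm⟩, ⟨fun i hi => (y₁ i hi).trans (h₁ i hi),
        fun a b hab => ?_, fun i => (y₃ i).trans (h₃ i)⟩⟩
    · exact (hs a).trans ((congrArg g (Quotient.sound (glue_inl hab))).trans (hs b).symm)
    · exact (ht a).trans ((congrArg g (Quotient.sound (glue_inr hab))).trans (ht b).symm)
  · rintro ⟨y, ⟨h₁, h₂, h₃⟩, ⟨h₄, h₅, h₆⟩⟩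
    refine ⟨fun i hi => (h₁ i hi).trans (h₄ i hi), fun a b hab => ?_,
      fun i => (h₃ i).trans (h₆ i)⟩
    have := glue_le_ker h₂ h₅ hab
    rw [Setoid.ker_def, allLab_outer, allLab_outer] at this
    exact this

/-- A middle labeling compatible with zero on the boundary vanishes on every component that meets
the boundary and is an arbitrary element of `ZMod 2` on each closed loop. -/
theorem card_mid_hat (o : ℕ) (s : Setoid (Fin m ⊕ Fin n)) (t : Setoid (Fin n ⊕ Fin l)) :
    Nat.card (LRel.mid (hat o s) (hat o t)) = 2 ^ loops s t := by
  classical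
  have hfin : Finite (Quotient (glue s t)) := Quotient.finite _
  have hcard : 2 ^ loops s t = Nat.card ({c : Quotient (glue s t) //
      ∀ x : Fin m ⊕ Fin l, Quotient.mk (glue s t) (outer x) ≠ c} → ZMod 2) := by
    rw [Nat.card_fun, Nat.card_zmod, loops]
  rw [hcard]
  have hle : ∀ y ∈ LRel.mid (hat o s) (hat o t),
      glue s t ≤ Setoid.ker (allLab o 0 y 0) := fun y hy => glue_le_ker hy.1.2.1 hy.2.2.1
  let ext0 (φ : {c : Quotient (glue s t) //
      ∀ x : Fin m ⊕ Fin l, Quotient.mk (glue s t) (outer x) ≠ c} → ZMod 2) :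
      Quotient (glue s t) → ZMod 2 := fun c => if h : _ then φ ⟨c, h⟩ else 0
  have hout : ∀ φ (a : Fin m ⊕ Fin l), ext0 φ (Quotient.mk _ (outer a)) = 0 := fun φ a =>
    dif_neg fun h => h a rfl
  have h0 : ∀ a : Fin m ⊕ Fin l, ptLab o (0 : Lab) (0 : Lab) a = 0 := by
    rintro (a | a) <;> rfl
  choose back back₁ back₂ back₃ using fun φ => exists_lab o 0
    (fun i : Fin n => ext0 φ (Quotient.mk _ (Sum.inr (Sum.inl i)))) 0
  have hall : ∀ φ a, allLab o (0 : Lab) (back φ) (0 : Lab) a = ext0 φ (Quotient.mk _ a) := by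
    rintro φ (a | a | a)
    · exact (hout φ (Sum.inl a)).symm
    · exact back₂ φ a
    · exact (hout φ (Sum.inr a)).symm
  refine Nat.card_congr ⟨fun y c => Quotient.lift (allLab o 0 y.1 0)
    (fun a b hab => hle y.1 y.2 hab) c.1, fun φ => ⟨back φ, ⟨?_, ?_, ?_⟩, ⟨?_, ?_, ?_⟩⟩, ?_, ?_⟩
  · exact fun i hi => (back₁ φ i hi).symm
  · intro a b hab
    have h1 : ∀ a : Fin m ⊕ Fin n, ptLab o (0 : Lab) (back φ) a =
        allLab (l := l) o (0 : Lab) (back φ) (0 : Lab) (Sum.map id Sum.inl a) := by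
      rintro (a | a) <;> rfl
    exact (h1 a).trans ((hall φ _).trans ((congrArg (ext0 φ)
      (Quotient.sound (glue_inl hab))).trans ((hall φ _).symm.trans (h1 b).symm)))
  · exact fun i => (back₃ φ i).symm
  · exact fun i hi => back₁ φ i hi
  · intro a b hab
    exact (hall φ (Sum.inr a)).trans ((congrArg (ext0 φ)
      (Quotient.sound (glue_inr hab))).trans (hall φ (Sum.inr b)).symm)
  · exact fun i => back₃ φ i
  · rintro ⟨y, hy⟩
    apply Subtype.ext
    refine lab_ext o n (fun i hi => (back₁ _ i hi).trans (hy.1.1 i hi)) (fun i => ?_)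
      (fun i => (back₃ _ i).trans (hy.2.2.2 i).symm)
    refine (back₂ _ i).trans ?_
    simp only [ext0]
    split_ifs with h
    · rfl
    · push Not at h
      obtain ⟨a, ha⟩ := h
      have := hle y hy (Quotient.exact ha)
      rw [Setoid.ker_def, allLab_outer, h0] at this
      exact this
  · intro φ
    funext ⟨c, hc⟩
    induction c using Quotient.inductionOn with
    | h a =>
      refine (hall φ a).trans ?_
      simp only [ext0]
      rw [dif_pos hc]

end Stack

theorem hat_idRel (o n : ℕ) : hat o (idRel n) = LRel.diag := by
  ext ⟨x, y⟩
  rw [LRel.mem_diag]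
  constructor
  · rintro ⟨h₁, h₂, h₃⟩
    refine lab_ext o n h₁ (fun i => h₂ (Sum.inl i) (Sum.inr i) rfl) h₃
  · rintro rfl
    refine ⟨fun _ _ => rfl, fun a b hab => ?_, fun _ => rfl⟩
    rcases a with a | a <;> rcases b with b | b <;>
      exact congrArg (fun i : Fin n => x (o + i)) hab

section Juxt

variable {m n m' n' : ℕ} {s : Setoid (Fin m ⊕ Fin n)} {t : Setoid (Fin m' ⊕ Fin n')}

theorem mem_hat_juxtRel {o : ℕ} {x z : Lab} :
    (x, z) ∈ hat o (juxtRel s t) ↔ (∀ i < o, x i = z i) ∧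
      (∀ a b, s a b → ptLab o x z a = ptLab o x z b) ∧
      (∀ a b, t a b → Sum.elim (fun i : Fin m' => x (o + m + i)) (fun j : Fin n' => z (o + n + j)) a =
        Sum.elim (fun i : Fin m' => x (o + m + i)) (fun j : Fin n' => z (o + n + j)) b) ∧
      ∀ i, x (o + m + m' + i) = z (o + n + n' + i) := by
  have h1 : (∀ a b, juxtRel s t a b → ptLab o x z a = ptLab o x z b) ↔
      juxtRel s t ≤ Setoid.ker (ptLab o x z) := Iff.rfl
  have e1 : ∀ a : Fin m ⊕ Fin n,
      ptLab o x z (Sum.map (Fin.castAdd m') (Fin.castAdd n') a) = ptLab o x z a := by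
    rintro (a | a) <;> rfl
  have e2 : ∀ a : Fin m' ⊕ Fin n', ptLab o x z (Sum.map (Fin.natAdd m) (Fin.natAdd n) a) =
      Sum.elim (fun i : Fin m' => x (o + m + i)) (fun j : Fin n' => z (o + n + j)) a := by
    rintro (a | a) <;> simp [ptLab, add_assoc]
  rw [mem_hat, h1, juxtRel, sup_le_iff, map_le_ker_iff, map_le_ker_iff]
  simp only [e1, e2, and_assoc, ← add_assoc]

theorem hat_juxtRel (o : ℕ) (s : Setoid (Fin m ⊕ Fin n)) (t : Setoid (Fin m' ⊕ Fin n')) :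
    hat o (juxtRel s t) = (hat o s).comp (hat (o + n) t) := by
  ext ⟨x, z⟩
  rw [mem_hat_juxtRel, LRel.mem_comp]
  constructor
  · rintro ⟨h₁, h₂, h₃, h₄⟩
    obtain ⟨y, y₁, y₂, y₃⟩ := exists_lab o x (fun j : Fin n => z (o + j)) (fun i => x (o + m + i))
    have hy : ∀ i < o + n, y i = z i := by
      intro i hi
      by_cases h : i < o
      · exact (y₁ i h).trans (h₁ i h)
      · obtain ⟨j, rfl⟩ := Nat.exists_eq_add_of_le (not_lt.1 h)
        exact y₂ (⟨j, by omega⟩ : Fin n)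
    refine ⟨y, ⟨fun i hi => (y₁ i hi).symm, fun a b hab => ?_,
      fun i => (y₃ i).symm⟩, ⟨hy, fun a b hab => ?_, fun i => ?_⟩⟩
    · have e : ∀ a : Fin m ⊕ Fin n, ptLab o x y a = ptLab o x z a := by
        rintro (a | a)
        · rfl
        · exact y₂ a
      exact (e a).trans ((h₂ a b hab).trans (e b).symm)
    · have e : ∀ a : Fin m' ⊕ Fin n', ptLab (o + n) y z a =
          Sum.elim (fun i : Fin m' => x (o + m + i)) (fun j : Fin n' => z (o + n + j)) a := by
        rintro (a | a)
        · exact y₃ _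
        · rfl
      exact (e a).trans ((h₃ a b hab).trans (e b).symm)
    · change y (o + n + m' + i) = z (o + n + n' + i)
      rw [← h₄, add_assoc (o + n), add_assoc (o + m)]
      exact y₃ _
  · rintro ⟨y, ⟨h₁, h₂, h₃⟩, ⟨h₄, h₅, h₆⟩⟩
    refine ⟨fun i hi => (h₁ i hi).trans (h₄ i (by omega)), fun a b hab => ?_, fun a b hab => ?_,
      fun i => ?_⟩
    · have e : ∀ a : Fin m ⊕ Fin n, ptLab o x z a = ptLab o x y a := by
        rintro (a | a)
        · rfl
        · exact (h₄ _ (by omega)).symm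
      exact (e a).trans ((h₂ a b hab).trans (e b).symm)
    · have e : ∀ a : Fin m' ⊕ Fin n', Sum.elim (fun i : Fin m' => x (o + m + i)) (fun j : Fin n' => z (o + n + j)) a =
          ptLab (o + n) y z a := by
        rintro (a | a)
        · exact h₃ _
        · rfl
      exact (e a).trans ((h₅ a b hab).trans (e b).symm)
    · refine Eq.trans ?_ (h₆ i)
      rw [add_assoc (o + m)]
      refine (h₃ _).trans ?_
      rw [← add_assoc (o + n)]

/-- Here the right-hand diagram comes first, so it sits at `o + m`, beside the still untouched
bottom of the left one. Comparison with `hat_juxtRel` gives the interchange law. -/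
theorem hat_juxtRel' (o : ℕ) (s : Setoid (Fin m ⊕ Fin n)) (t : Setoid (Fin m' ⊕ Fin n')) :
    hat o (juxtRel s t) = (hat (o + m) t).comp (hat o s) := by
  ext ⟨x, z⟩
  rw [mem_hat_juxtRel, LRel.mem_comp]
  constructor
  · rintro ⟨h₁, h₂, h₃, h₄⟩
    obtain ⟨y, y₁, y₂, y₃⟩ := exists_lab o x (fun j : Fin m => x (o + j)) (fun i => z (o + n + i))
    have hy : ∀ i < o + m, x i = y i := by
      intro i hi
      by_cases h : i < o
      · exact (y₁ i h).symm
      · obtain ⟨j, rfl⟩ := Nat.exists_eq_add_of_le (not_lt.1 h)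
        exact (y₂ (⟨j, by omega⟩ : Fin m)).symm
    refine ⟨y, ⟨hy, fun a b hab => ?_, fun i => ?_⟩,
      ⟨fun i hi => (y₁ i hi).trans (h₁ i hi), fun a b hab => ?_,
      fun i => y₃ i⟩⟩
    · have e : ∀ a : Fin m' ⊕ Fin n', ptLab (o + m) x y a =
          Sum.elim (fun i : Fin m' => x (o + m + i)) (fun j : Fin n' => z (o + n + j)) a := by
        rintro (a | a)
        · rfl
        · exact y₃ _
      exact (e a).trans ((h₃ a b hab).trans (e b).symm)
    · change x (o + m + m' + i) = y (o + m + n' + i)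
      rw [h₄, add_assoc (o + m) n', add_assoc (o + n) n']
      exact (y₃ _).symm
    · have e : ∀ a : Fin m ⊕ Fin n, ptLab o y z a = ptLab o x z a := by
        rintro (a | a)
        · exact y₂ a
        · rfl
      exact (e a).trans ((h₂ a b hab).trans (e b).symm)
  · rintro ⟨y, ⟨h₄, h₅, h₆⟩, ⟨h₁, h₂, h₃⟩⟩
    refine ⟨fun i hi => (h₄ i (by omega)).trans (h₁ i hi), fun a b hab => ?_, fun a b hab => ?_,
      fun i => ?_⟩
    · have e : ∀ a : Fin m ⊕ Fin n, ptLab o x z a = ptLab o y z a := by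
        rintro (a | a)
        · exact h₄ _ (by omega)
        · rfl
      exact (e a).trans ((h₂ a b hab).trans (e b).symm)
    · have e : ∀ a : Fin m' ⊕ Fin n', Sum.elim (fun i : Fin m' => x (o + m + i)) (fun j : Fin n' => z (o + n + j)) a =
          ptLab (o + m) x y a := by
        rintro (a | a)
        · rfl
        · exact (h₃ _).symm
      exact (e a).trans ((h₅ a b hab).trans (e b).symm)
    · refine (h₆ i).trans ?_
      rw [add_assoc (o + m) n', add_assoc (o + n) n']
      exact h₃ _

variable {R : Type*} [CommRing R] (δ : R)

/-- No loop can form: left of position `o + n` the second factor forces the middle labeling to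
vanish, and from there on the first factor does. -/
theorem cocycle_juxt (o : ℕ) (s : Setoid (Fin m ⊕ Fin n)) (t : Setoid (Fin m' ⊕ Fin n')) :
    cocycle δ (hat o s) (hat (o + n) t) = 1 := by
  refine cocycle_eq_one δ fun y h₁ h₂ => funext fun i => ?_
  by_cases hi : i < o + n
  · exact h₂.1 i hi
  · obtain ⟨j, rfl⟩ := Nat.exists_eq_add_of_le (not_lt.1 hi)
    exact (h₁.2.2 j).symm

theorem cocycle_juxt' (o : ℕ) (s : Setoid (Fin m ⊕ Fin n)) (t : Setoid (Fin m' ⊕ Fin n')) :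
    cocycle δ (hat (o + m) t) (hat o s) = 1 := by
  refine cocycle_eq_one δ fun y h₁ h₂ => funext fun i => ?_
  by_cases hi : i < o + m
  · exact (h₁.1 i hi).symm
  · obtain ⟨j, rfl⟩ := Nat.exists_eq_add_of_le (not_lt.1 hi)
    exact h₂.2.2 j

end Juxt

/-! ### The functor from the Temperley-Lieb category to the algebra of relations -/

section Functor

variable {R : Type*} [CommRing R] {δ : R} {m' n' m n l : ℕ}

/-- The connectivity of a diagram. -/
def Diagram.rel {m n : ℕ} (D : Diagram m n) : Setoid (Fin m ⊕ Fin n) := D.1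

/-- The diagram with a given planar connectivity. -/
def Diagram.mk {m n : ℕ} (s : Setoid (Fin m ⊕ Fin n)) (h : IsPlanar s) : Diagram m n := ⟨s, h⟩

theorem Diagram.rel_mk {m n : ℕ} (s : Setoid (Fin m ⊕ Fin n)) (h : IsPlanar s) :
    (Diagram.mk s h).rel = s := rfl

theorem comp_def (f : Hom R m n) (g : Hom R n l) : comp δ f g = f.sum fun D a => g.sum fun D' b =>
    Finsupp.single (Diagram.mk (stackRel D.rel D'.rel) (IsPlanar.stack D.2 D'.2))
      (a * b * δ ^ loops D.rel D'.rel) := rfl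

theorem tensor_def (f : Hom R m n) (g : Hom R m' n') :
    tensor f g = f.sum fun D a => g.sum fun D' b =>
      Finsupp.single (Diagram.mk (juxtRel D.rel D'.rel) (IsPlanar.juxt D.2 D'.2)) (a * b) := rfl

theorem comp_add_left (f₁ f₂ : Hom R m n) (g : Hom R n l) :
    comp δ (f₁ + f₂) g = comp δ f₁ g + comp δ f₂ g := by
  simp only [comp_def]
  exact Finsupp.sum_add_index' (by simp) (by simp [add_mul, Finsupp.sum_add])

theorem comp_single_add (D : Diagram m n) (a : R) (g₁ g₂ : Hom R n l) :
    comp δ (Finsupp.single D a) (g₁ + g₂) =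
      comp δ (Finsupp.single D a) g₁ + comp δ (Finsupp.single D a) g₂ := by
  simp only [comp_def]
  rw [Finsupp.sum_single_index (by simp), Finsupp.sum_single_index (by simp),
    Finsupp.sum_single_index (by simp)]
  exact Finsupp.sum_add_index' (by simp) (by simp [add_mul, mul_add])

theorem comp_single (D : Diagram m n) (a : R) (D' : Diagram n l) (b : R) :
    comp δ (Finsupp.single D a) (Finsupp.single D' b) =
      Finsupp.single (Diagram.mk (stackRel D.rel D'.rel) (IsPlanar.stack D.2 D'.2))
        (a * b * δ ^ loops D.rel D'.rel) := by
  rw [comp_def, Finsupp.sum_single_index (by simp), Finsupp.sum_single_index (by simp)]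

theorem tensor_add_left (f₁ f₂ : Hom R m n) (g : Hom R m' n') :
    tensor (f₁ + f₂) g = tensor f₁ g + tensor f₂ g := by
  simp only [tensor_def]
  exact Finsupp.sum_add_index' (by simp) (by simp [add_mul, Finsupp.sum_add])

theorem tensor_single_add (D : Diagram m n) (a : R) (g₁ g₂ : Hom R m' n') :
    tensor (Finsupp.single D a) (g₁ + g₂) =
      tensor (Finsupp.single D a) g₁ + tensor (Finsupp.single D a) g₂ := by
  simp only [tensor_def]
  rw [Finsupp.sum_single_index (by simp), Finsupp.sum_single_index (by simp),
    Finsupp.sum_single_index (by simp)]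
  exact Finsupp.sum_add_index' (by simp) (by simp [mul_add])

theorem tensor_single (D : Diagram m n) (a : R) (D' : Diagram m' n') (b : R) :
    tensor (Finsupp.single D a) (Finsupp.single D' b) =
      Finsupp.single (Diagram.mk (juxtRel D.rel D'.rel) (IsPlanar.juxt D.2 D'.2)) (a * b) := by
  rw [tensor_def, Finsupp.sum_single_index (by simp), Finsupp.sum_single_index (by simp)]

/-- The element of the algebra of relations given by a morphism placed at position `o`. -/
def toRel (δ : R) (o : ℕ) {m n : ℕ} : Hom R m n →ₗ[R] RelAlg R δ :=
  Finsupp.lmapDomain R R fun D : Diagram m n => hat o D.rel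

theorem toRel_single (o : ℕ) (D : Diagram m n) (a : R) :
    toRel δ o (Finsupp.single D a) = RelAlg.of δ (hat o D.rel) a :=
  Finsupp.mapDomain_single

/-- Faithfulness: equalities of morphisms may be checked in the algebra of relations. -/
theorem toRel_injective (o m n : ℕ) :
    Function.Injective (toRel δ o : Hom R m n → RelAlg R δ) :=
  Finsupp.mapDomain_injective fun _ _ h => Subtype.ext (hat_injective o h)

theorem toRel_idHom (o n : ℕ) : toRel δ o (idHom n : Hom R n n) = 1 := by
  refine (toRel_single o (Diagram.mk (idRel n) (IsPlanar.strands n)) 1).trans ?_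
  rw [Diagram.rel_mk, hat_idRel]
  rfl

theorem toRel_eqHom (o : ℕ) {m n : ℕ} (h : m = n) : toRel δ o (eqHom h : Hom R m n) = 1 := by
  subst h
  exact toRel_idHom o m

theorem toRel_comp (o : ℕ) (f : Hom R m n) (g : Hom R n l) :
    toRel δ o (comp δ f g) = toRel δ o f * toRel δ o g := by
  induction f using Finsupp.induction_linear with
  | zero => simp [comp]
  | add f₁ f₂ h₁ h₂ => rw [comp_add_left, map_add, map_add, h₁, h₂, add_mul]
  | single D a =>
    induction g using Finsupp.induction_linear with
    | zero => simp [comp]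
    | add f₁ f₂ h₁ h₂ => rw [comp_single_add, map_add, map_add, h₁, h₂, mul_add]
    | single D' b =>
      rw [comp_single, toRel_single, toRel_single, toRel_single, RelAlg.of_mul_of, cocycle,
        card_mid_hat, weight_two_pow, Diagram.rel_mk, hat_stackRel]

theorem toRel_tensor (o : ℕ) {m n m' n' : ℕ} (f : Hom R m n) (g : Hom R m' n') :
    toRel δ o (tensor f g) = toRel δ o f * toRel δ (o + n) g := by
  induction f using Finsupp.induction_linear with
  | zero => simp [tensor]
  | add f₁ f₂ h₁ h₂ => rw [tensor_add_left, map_add, map_add, h₁, h₂, add_mul]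
  | single D a =>
    induction g using Finsupp.induction_linear with
    | zero => simp [tensor]
    | add f₁ f₂ h₁ h₂ => rw [tensor_single_add, map_add, map_add, h₁, h₂, mul_add]
    | single D' b =>
      rw [tensor_single, toRel_single, toRel_single, toRel_single, RelAlg.of_mul_of,
        cocycle_juxt, mul_one, Diagram.rel_mk, hat_juxtRel]

theorem toRel_tensor' (o : ℕ) {m n m' n' : ℕ} (f : Hom R m n) (g : Hom R m' n') :
    toRel δ o (tensor f g) = toRel δ (o + m) g * toRel δ o f := by
  induction f using Finsupp.induction_linear with
  | zero => simp [tensor]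
  | add f₁ f₂ h₁ h₂ => rw [tensor_add_left, map_add, map_add, h₁, h₂, mul_add]
  | single D a =>
    induction g using Finsupp.induction_linear with
    | zero => simp [tensor]
    | add f₁ f₂ h₁ h₂ => rw [tensor_single_add, map_add, map_add, h₁, h₂, add_mul]
    | single D' b =>
      rw [tensor_single, toRel_single, toRel_single, toRel_single, RelAlg.of_mul_of,
        cocycle_juxt', mul_one, mul_comm b a, Diagram.rel_mk, hat_juxtRel']

theorem toRel_idHom_tensor (o l : ℕ) {m n : ℕ} (g : Hom R m n) :
    toRel δ o (tensor (idHom l) g) = toRel δ (o + l) g := by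
  rw [toRel_tensor, toRel_idHom, one_mul]

theorem toRel_tensor_idHom (o l : ℕ) {m n : ℕ} (f : Hom R m n) :
    toRel δ o (tensor f (idHom l)) = toRel δ o f := by
  rw [toRel_tensor, toRel_idHom, mul_one]

/-- Morphisms at disjoint positions can be interchanged. -/
theorem toRel_interchange (o j : ℕ) {m n m' n' : ℕ} (f : Hom R m n) (g : Hom R m' n') :
    toRel δ o f * toRel δ (o + n + j) g = toRel δ (o + m + j) g * toRel δ o f := by
  rw [← toRel_idHom_tensor (o + n) j, ← toRel_idHom_tensor (o + m) j, ← toRel_tensor,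
    toRel_tensor']

end Functor

/-! ### Cups and caps in an algebra -/

/-- Cups and caps at all positions of a half-infinite row of strands, as elements of an algebra.
In a product the left factor is applied first. -/
structure TLSystem {R : Type*} [CommRing R] (δ : R) (A : Type*) [Ring A] [Algebra R A] where
  /-- The cup at position `i`. -/
  cup : ℕ → A
  /-- The cap at position `i`. -/
  cap : ℕ → A
  cup_cap_self : ∀ i, cup i * cap i = δ • (1 : A)
  cup_cap_succ : ∀ i, cup i * cap (i + 1) = 1
  cup_succ_cap : ∀ i, cup (i + 1) * cap i = 1
  cup_cap_far : ∀ i j, i ≤ j → cup i * cap (j + 2) = cap j * cup i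
  cup_far_cap : ∀ i j, i ≤ j → cup (j + 2) * cap i = cap i * cup j
  cup_cup : ∀ i j, i ≤ j → cup i * cup (j + 2) = cup j * cup i
  cap_cap : ∀ i j, i ≤ j → cap (j + 2) * cap i = cap i * cap j

section Instance

variable {R : Type*} [CommRing R] {δ : R}

theorem mem_hat_cup {o : ℕ} {x y : Lab} :
    (x, y) ∈ hat o (⊤ : Setoid (Fin 0 ⊕ Fin 2)) ↔
      (∀ i < o, x i = y i) ∧ y o = y (o + 1) ∧ ∀ i, x (o + i) = y (o + 2 + i) := by
  rw [mem_hat]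
  refine and_congr Iff.rfl (and_congr ⟨fun h => h (Sum.inr 0) (Sum.inr 1) trivial, ?_⟩ Iff.rfl)
  rintro h (a | a) (b | b) -
  · exact a.elim0
  · exact a.elim0
  · exact b.elim0
  · fin_cases a <;> fin_cases b
    exacts [rfl, h, h.symm, rfl]

theorem mem_hat_cap {o : ℕ} {x y : Lab} :
    (x, y) ∈ hat o (⊤ : Setoid (Fin 2 ⊕ Fin 0)) ↔
      (∀ i < o, x i = y i) ∧ x o = x (o + 1) ∧ ∀ i, x (o + 2 + i) = y (o + i) := by
  rw [mem_hat]
  refine and_congr Iff.rfl (and_congr ⟨fun h => h (Sum.inl 0) (Sum.inl 1) trivial, ?_⟩ Iff.rfl)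
  rintro h (a | a) (b | b) -
  · fin_cases a <;> fin_cases b
    exacts [rfl, h, h.symm, rfl]
  · exact b.elim0
  · exact a.elim0
  · exact a.elim0

theorem exists_double (i : ℕ) (x : Lab) :
    ∃ y : Lab, (∀ j < i + 1, y j = x j) ∧ y (i + 1) = x i ∧ ∀ j, y (i + 2 + j) = x (i + j) := by
  obtain ⟨y, y₁, y₂, y₃⟩ := exists_lab i x (fun _ : Fin 2 => x i) (fun j => x (i + j))
  refine ⟨y, fun j hj => ?_, y₂ 1, y₃⟩
  rcases Nat.lt_succ_iff_lt_or_eq.1 hj with h | rfl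
  · exact y₁ j h
  · exact y₂ 0

theorem hat_cup_comp_hat_cap_succ (i : ℕ) :
    (hat i (⊤ : Setoid (Fin 0 ⊕ Fin 2))).comp (hat (i + 1) (⊤ : Setoid (Fin 2 ⊕ Fin 0))) =
      LRel.diag := by
  ext ⟨x, z⟩
  simp only [LRel.mem_comp, LRel.mem_diag, mem_hat_cup, mem_hat_cap]
  constructor
  · rintro ⟨y, ⟨h₁, h₂, h₃⟩, h₄, h₅, h₆⟩
    refine lab_ext i 1 (fun j hj => (h₁ j hj).trans (h₄ j (by omega))) (fun j => ?_) fun j => ?_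
    · rw [Fin.val_eq_zero j, h₃ 0, ← h₄ (i + 0) (by omega)]
      exact (h₂.trans h₅).symm
    · rw [← h₆, add_assoc i 1 j, h₃]
      congr 1
      omega
  · rintro rfl
    obtain ⟨y, y₁, y₂, y₃⟩ := exists_double i x
    exact ⟨y, ⟨fun j hj => (y₁ j (by omega)).symm, (y₁ i (by omega)).trans y₂.symm,
      fun j => (y₃ j).symm⟩, fun j hj => y₁ j (by omega), y₂.trans (y₃ 0).symm, fun j => by
        rw [show i + 1 + 2 + j = i + 2 + (1 + j) by omega, y₃, add_assoc]⟩

theorem hat_cup_succ_comp_hat_cap (i : ℕ) :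
    (hat (i + 1) (⊤ : Setoid (Fin 0 ⊕ Fin 2))).comp (hat i (⊤ : Setoid (Fin 2 ⊕ Fin 0))) =
      LRel.diag := by
  ext ⟨x, z⟩
  simp only [LRel.mem_comp, LRel.mem_diag, mem_hat_cup, mem_hat_cap]
  constructor
  · rintro ⟨y, ⟨h₁, h₂, h₃⟩, h₄, h₅, h₆⟩
    refine lab_ext i 1 (fun j hj => (h₁ j (by omega)).trans (h₄ j hj)) (fun j => ?_) fun j => ?_
    · rw [Fin.val_eq_zero j, ← h₆ 0, h₁ (i + 0) (by omega)]
      exact h₅.trans h₂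
    · rw [h₃, add_assoc i 1 j, ← h₆]
      congr 1
      omega
  · rintro rfl
    obtain ⟨y, y₁, y₂, y₃⟩ := exists_double i x
    exact ⟨y, ⟨fun j hj => (y₁ j (by omega)).symm, y₂.trans (y₃ 0).symm, fun j => by
        rw [show i + 1 + 2 + j = i + 2 + (1 + j) by omega, y₃, add_assoc]⟩,
      fun j hj => y₁ j (by omega), (y₁ i (by omega)).trans y₂.symm, y₃⟩

theorem cocycle_cup_cap_succ (δ : R) (i : ℕ) :
    cocycle δ (hat i (⊤ : Setoid (Fin 0 ⊕ Fin 2))) (hat (i + 1) (⊤ : Setoid (Fin 2 ⊕ Fin 0))) =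
      1 := by
  refine cocycle_eq_one δ fun y h₁ h₂ => ?_
  obtain ⟨h₁, h₂, h₃⟩ := mem_hat_cup.1 h₁
  obtain ⟨h₄, h₅, h₆⟩ := mem_hat_cap.1 ‹_›
  refine lab_ext i 2 (fun j hj => (h₁ j hj).symm) (fun j => ?_) fun j => (h₃ j).symm
  fin_cases j
  · exact h₄ i (by omega)
  · exact h₂.symm.trans (h₄ i (by omega))

theorem cocycle_cup_succ_cap (δ : R) (i : ℕ) :
    cocycle δ (hat (i + 1) (⊤ : Setoid (Fin 0 ⊕ Fin 2))) (hat i (⊤ : Setoid (Fin 2 ⊕ Fin 0))) =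
      1 := by
  refine cocycle_eq_one δ fun y h₁ h₂ => ?_
  obtain ⟨h₁, h₂, h₃⟩ := mem_hat_cup.1 h₁
  obtain ⟨h₄, h₅, h₆⟩ := mem_hat_cap.1 ‹_›
  refine lab_ext i 2 (fun j hj => (h₁ j (by omega)).symm) (fun j => ?_) fun j => h₆ j
  fin_cases j
  · exact (h₁ i (by omega)).symm
  · exact h₅.symm.trans (h₁ i (by omega)).symm

theorem toRel_cup (o : ℕ) : toRel δ o (cup : Hom R 0 2) =
    RelAlg.of δ (hat o (⊤ : Setoid (Fin 0 ⊕ Fin 2))) 1 :=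
  toRel_single o (Diagram.mk ⊤ IsPlanar.cup) 1

theorem toRel_cap (o : ℕ) : toRel δ o (cap : Hom R 2 0) =
    RelAlg.of δ (hat o (⊤ : Setoid (Fin 2 ⊕ Fin 0))) 1 :=
  toRel_single o (Diagram.mk ⊤ IsPlanar.cap) 1

/-- Counting labelings replaces counting components: the middle labelings are determined by the
common label of the two points, so there are 2 = 2 ^ 1 of them. -/
theorem loops_cup_cap : loops (⊤ : Setoid (Fin 0 ⊕ Fin 2)) (⊤ : Setoid (Fin 2 ⊕ Fin 0)) = 1 := by
  have hc := card_mid_hat 0 (⊤ : Setoid (Fin 0 ⊕ Fin 2)) (⊤ : Setoid (Fin 2 ⊕ Fin 0))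
  have h2 : Nat.card (LRel.mid (hat 0 (⊤ : Setoid (Fin 0 ⊕ Fin 2)))
      (hat 0 (⊤ : Setoid (Fin 2 ⊕ Fin 0)))) = 2 := by
    have hmem : ∀ c : ZMod 2, (fun i => if i < 2 then c else 0 : Lab) ∈
        LRel.mid (hat 0 (⊤ : Setoid (Fin 0 ⊕ Fin 2))) (hat 0 (⊤ : Setoid (Fin 2 ⊕ Fin 0))) := by
      intro c
      refine ⟨mem_hat_cup.2 ⟨fun i hi => absurd hi (Nat.not_lt_zero i), rfl, fun i => ?_⟩,
        mem_hat_cap.2 ⟨fun i hi => absurd hi (Nat.not_lt_zero i), rfl, fun i => ?_⟩⟩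
      · simp [show ¬ (0 + 2 + i < 2) by omega]
      · simp [show ¬ (0 + 2 + i < 2) by omega]
    refine (Nat.card_congr (β := ZMod 2) ⟨fun y => y.1 0, fun c => ⟨_, hmem c⟩, ?_,
      fun c => rfl⟩).trans (Nat.card_zmod 2)
    · rintro ⟨y, h₁, h₂⟩
      obtain ⟨-, h₃, h₄⟩ := mem_hat_cup.1 h₁
      refine Subtype.ext (lab_ext 0 2 (by simp) (fun j => ?_) fun j => ?_)
      · fin_cases j
        · simp
        · simpa using h₃
      · have := h₄ j
        simp only [Pi.zero_apply] at this
        simp [← this, show ¬ (0 + 2 + j < 2) by omega]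
  rw [h2] at hc
  exact Nat.pow_right_injective le_rfl (hc.symm.trans (pow_one 2).symm)

/-- The cups and caps of the Temperley-Lieb category. -/
def relSystem (δ : R) : TLSystem δ (RelAlg R δ) where
  cup i := toRel δ i cup
  cap i := toRel δ i cap
  cup_cap_self i := by
    rw [toRel_cup, toRel_cap, RelAlg.of_mul_of, ← hat_stackRel, cocycle, card_mid_hat,
      weight_two_pow, loops_cup_cap]
    have : stackRel (⊤ : Setoid (Fin 0 ⊕ Fin 2)) (⊤ : Setoid (Fin 2 ⊕ Fin 0)) = idRel 0 :=
      Setoid.ext fun a => by rcases a with a | a <;> exact a.elim0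
    rw [this, hat_idRel, RelAlg.one_def, ← map_smul]
    simp
  cup_cap_succ i := by
    rw [toRel_cup, toRel_cap, RelAlg.of_mul_of, hat_cup_comp_hat_cap_succ, cocycle_cup_cap_succ,
      RelAlg.one_def]
    simp
  cup_succ_cap i := by
    rw [toRel_cup, toRel_cap, RelAlg.of_mul_of, hat_cup_succ_comp_hat_cap, cocycle_cup_succ_cap,
      RelAlg.one_def]
    simp
  cup_cap_far i j h := by
    obtain ⟨d, rfl⟩ := Nat.exists_eq_add_of_le h
    rw [show i + d + 2 = i + 2 + d by omega]
    exact toRel_interchange i d cup cap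
  cup_far_cap i j h := by
    obtain ⟨d, rfl⟩ := Nat.exists_eq_add_of_le h
    rw [show i + d + 2 = i + 2 + d by omega]
    exact (toRel_interchange i d cap cup).symm
  cup_cup i j h := by
    obtain ⟨d, rfl⟩ := Nat.exists_eq_add_of_le h
    rw [show i + d + 2 = i + 2 + d by omega]
    exact toRel_interchange i d cup cup
  cap_cap i j h := by
    obtain ⟨d, rfl⟩ := Nat.exists_eq_add_of_le h
    rw [show i + d + 2 = i + 2 + d by omega]
    exact (toRel_interchange i d cap cap).symm

end Instance

namespace TLSystem

section Basic

variable {R : Type*} [CommRing R] {δ : R} {A : Type*} [Ring A] [Algebra R A] (T : TLSystem δ A)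

/-- The generators of the Temperley-Lieb algebras. -/
def u (i : ℕ) : A := T.cap i * T.cup i

theorem u_cap_self (i : ℕ) : T.u i * T.cap i = δ • T.cap i := by
  rw [u, mul_assoc, T.cup_cap_self, mul_smul_comm, mul_one]

theorem u_cap_succ (i : ℕ) : T.u i * T.cap (i + 1) = T.cap i := by
  rw [u, mul_assoc, T.cup_cap_succ, mul_one]

theorem u_succ_cap (i : ℕ) : T.u (i + 1) * T.cap i = T.cap (i + 1) := by
  rw [u, mul_assoc, T.cup_succ_cap, mul_one]

theorem cup_u_succ (i : ℕ) : T.cup i * T.u (i + 1) = T.cup (i + 1) := by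
  rw [u, ← mul_assoc, T.cup_cap_succ, one_mul]

theorem cup_succ_u (i : ℕ) : T.cup (i + 1) * T.u i = T.cup i := by
  rw [u, ← mul_assoc, T.cup_succ_cap, one_mul]

theorem u_mul_self (i : ℕ) : T.u i * T.u i = δ • T.u i := by
  nth_rw 2 [u]
  rw [← mul_assoc, u_cap_self, smul_mul_assoc, u]

theorem u_succ_u (i : ℕ) : T.u i * T.u (i + 1) * T.u i = T.u i := by
  nth_rw 3 [u]
  rw [mul_assoc, ← mul_assoc (T.u (i + 1)), u_succ_cap, ← mul_assoc, u_cap_succ, u]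

theorem u_u_succ (i : ℕ) : T.u (i + 1) * T.u i * T.u (i + 1) = T.u (i + 1) := by
  nth_rw 3 [u]
  rw [mul_assoc, ← mul_assoc (T.u i), u_cap_succ, ← mul_assoc, u_succ_cap, u]

theorem commute_cup_u {i j : ℕ} (h : i + 2 ≤ j) : Commute (T.cup j) (T.u i) := by
  obtain ⟨d, rfl⟩ := Nat.exists_eq_add_of_le' h
  rw [Commute, SemiconjBy, u, ← mul_assoc, ← add_assoc, T.cup_far_cap i (d + i) (by omega),
    mul_assoc, mul_assoc, T.cup_cup i (d + i) (by omega)]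

theorem commute_cap_u {i j : ℕ} (h : i + 2 ≤ j) : Commute (T.cap j) (T.u i) := by
  obtain ⟨d, rfl⟩ := Nat.exists_eq_add_of_le' h
  rw [Commute, SemiconjBy, u, ← mul_assoc, ← add_assoc, T.cap_cap i (d + i) (by omega),
    mul_assoc, mul_assoc, T.cup_cap_far i (d + i) (by omega)]

theorem cup_u_far {i j : ℕ} (h : j ≤ i) : T.cup j * T.u (i + 2) = T.u i * T.cup j := by
  rw [u, ← mul_assoc, T.cup_cap_far j i h, mul_assoc, T.cup_cup j i h, u, mul_assoc]

theorem u_far_cap {i j : ℕ} (h : j ≤ i) : T.u (i + 2) * T.cap j = T.cap j * T.u i := by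
  rw [u, mul_assoc, T.cup_far_cap j i h, ← mul_assoc, T.cap_cap j i h, u, mul_assoc]

theorem commute_u_u {i j : ℕ} (h : i + 2 ≤ j) : Commute (T.u j) (T.u i) :=
  (T.commute_cap_u h).mul_left (T.commute_cup_u h)

/-- Jones-Wenzl elements at position `o`, with coefficients `c` in Wenzl's recursion. -/
def jw (c : ℕ → R) (o : ℕ) : ℕ → A
  | 0 => 1
  | 1 => 1
  | n + 2 => jw c o (n + 1) + c n • (jw c o (n + 1) * T.u (o + n) * jw c o (n + 1))

theorem commute_jw {c : ℕ → R} {o : ℕ} {b : A} :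
    ∀ {n : ℕ}, (∀ i, i + 1 < n → Commute b (T.u (o + i))) → Commute b (T.jw c o n)
  | 0, _ => Commute.one_right b
  | 1, _ => Commute.one_right b
  | n + 2, h => by
    have h' : Commute b (T.jw c o (n + 1)) := commute_jw fun i hi => h i (by omega)
    exact h'.add_right (((h'.mul_right (h n (by omega))).mul_right h').smul_right _)

end Basic

/-- A sequence of nonvanishing quantum integers for the loop value `δ`. -/
structure QInts {K : Type*} [Field K] (δ : K) (d : ℕ → K) : Prop where
  zero : d 0 = 0
  one : d 1 = 1
  recurrence : ∀ n, d (n + 2) = -δ * d (n + 1) - d n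
  ne_zero : ∀ n, d (n + 1) ≠ 0

/-! ### Jones-Wenzl elements and Wenzl's recursion -/

section Wenzl

variable {K : Type*} [Field K] {δ : K} {A : Type*} [Ring A] [Algebra K A] (T : TLSystem δ A)
  {d : ℕ → K} (hd : QInts δ d)

/-- The coefficients in Wenzl's recursion. -/
def wenzl (d : ℕ → K) (n : ℕ) : K := d (n + 1) / d (n + 2)

/-- The properties that determine the Jones-Wenzl elements. -/
structure IsJW (d : ℕ → K) (o n : ℕ) : Prop where
  idem : T.jw (wenzl d) o (n + 1) * T.jw (wenzl d) o (n + 1) = T.jw (wenzl d) o (n + 1)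
  u_mul : ∀ i < n, T.u (o + i) * T.jw (wenzl d) o (n + 1) = 0
  mul_u : ∀ i < n, T.jw (wenzl d) o (n + 1) * T.u (o + i) = 0
  absorb_left : T.jw (wenzl d) o n * T.jw (wenzl d) o (n + 1) = T.jw (wenzl d) o (n + 1)
  absorb_right : T.jw (wenzl d) o (n + 1) * T.jw (wenzl d) o n = T.jw (wenzl d) o (n + 1)
  trace : T.cup (o + n) * T.jw (wenzl d) o (n + 1) * T.cap (o + n) =
    (-(d (n + 2) / d (n + 1))) • T.jw (wenzl d) o n

/-- Since u is cap times cup, the element between the two copies of u is closed up to its partial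
trace, which the trace identity evaluates. -/
theorem u_jw_u {o n : ℕ} (ih : IsJW T d o n) :
    T.u (o + n) * T.jw (wenzl d) o (n + 1) * T.u (o + n) =
      (-(d (n + 2) / d (n + 1))) • (T.jw (wenzl d) o n * T.u (o + n)) := by
  have hcap : Commute (T.cap (o + n)) (T.jw (wenzl d) o n) :=
    T.commute_jw fun i hi => T.commute_cap_u (by omega)
  have : T.u (o + n) * T.jw (wenzl d) o (n + 1) * T.u (o + n) = T.cap (o + n) *
      (T.cup (o + n) * T.jw (wenzl d) o (n + 1) * T.cap (o + n)) * T.cup (o + n) := by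
    simp only [u, mul_assoc]
  rw [this, ih.trace, mul_smul_comm, smul_mul_assoc, hcap.eq, mul_assoc, u]

-- Induction on all properties at once: the partial trace at one stage makes the next element
-- orthogonal to the new generator, and Wenzl's recursion with the zigzag relations then computes
-- the next partial trace.
include hd in
theorem isJW (o : ℕ) : ∀ n, IsJW T d o n
  | 0 => by
    refine ⟨by simp [jw], by simp, by simp, by simp [jw], by simp [jw], ?_⟩
    have : d 2 = -δ := by rw [hd.recurrence 0, hd.zero, hd.one]; ring
    simp [jw, T.cup_cap_self, this, hd.one]
  | n + 1 => by
    have ih := isJW o n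
    have huPu := T.u_jw_u ih
    have hcomm : Commute (T.u (o + n)) (T.jw (wenzl d) o n) :=
      T.commute_jw fun i hi => T.commute_u_u (by omega)
    have hcup : Commute (T.cup (o + (n + 1))) (T.jw (wenzl d) o (n + 1)) :=
      T.commute_jw fun i hi => T.commute_cup_u (by omega)
    have hcap : Commute (T.cap (o + (n + 1))) (T.jw (wenzl d) o (n + 1)) :=
      T.commute_jw fun i hi => T.commute_cap_u (by omega)
    have hN : T.jw (wenzl d) o (n + 2) = T.jw (wenzl d) o (n + 1) + wenzl d n •
      (T.jw (wenzl d) o (n + 1) * T.u (o + n) * T.jw (wenzl d) o (n + 1)) := rfl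
    obtain ⟨h1, h2, h3, h4, h5, h6⟩ := ih
    suffices h : T.jw (wenzl d) o (n + 2) * T.jw (wenzl d) o (n + 2) = T.jw (wenzl d) o (n + 2) ∧
        (∀ i < n + 1, T.u (o + i) * T.jw (wenzl d) o (n + 2) = 0) ∧
        (∀ i < n + 1, T.jw (wenzl d) o (n + 2) * T.u (o + i) = 0) ∧
        T.jw (wenzl d) o (n + 1) * T.jw (wenzl d) o (n + 2) = T.jw (wenzl d) o (n + 2) ∧
        T.jw (wenzl d) o (n + 2) * T.jw (wenzl d) o (n + 1) = T.jw (wenzl d) o (n + 2) ∧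
        T.cup (o + (n + 1)) * T.jw (wenzl d) o (n + 2) * T.cap (o + (n + 1)) =
          (-(d (n + 1 + 2) / d (n + 1 + 1))) • T.jw (wenzl d) o (n + 1) from
      ⟨h.1, h.2.1, h.2.2.1, h.2.2.2.1, h.2.2.2.2.1, h.2.2.2.2.2⟩
    generalize T.jw (wenzl d) o (n + 2) = N at *
    generalize T.jw (wenzl d) o (n + 1) = P at *
    generalize T.jw (wenzl d) o n = Q at *
    -- Wenzl's coefficient is chosen as minus the inverse of the partial-trace scalar, so the two
    -- terms of `u * N` cancel.
    have hc : wenzl d n * -(d (n + 2) / d (n + 1)) = -1 := by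
      have := hd.ne_zero n
      have := hd.ne_zero (n + 1)
      rw [wenzl]
      field_simp
    have hPN : P * N = N := by
      rw [hN, mul_add, mul_smul_comm, ← mul_assoc, ← mul_assoc, h1]
    have hNP : N * P = N := by
      rw [hN, add_mul, smul_mul_assoc, mul_assoc _ P P, h1]
    have huN : T.u (o + n) * N = 0 := by
      rw [hN, mul_add, mul_smul_comm, ← mul_assoc, ← mul_assoc, huPu, smul_mul_assoc, smul_smul,
        hc, ← hcomm.eq, mul_assoc, h4]
      simp
    have hNu : N * T.u (o + n) = 0 := by
      rw [hN, add_mul, smul_mul_assoc, mul_assoc, mul_assoc, ← mul_assoc (T.u (o + n)), huPu,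
        mul_smul_comm, smul_smul, hc, ← mul_assoc, h5]
      simp
    refine ⟨?_, fun i hi => ?_, fun i hi => ?_, hPN, hNP, ?_⟩
    · nth_rw 2 [hN]
      rw [mul_add, hNP, mul_smul_comm, ← mul_assoc, ← mul_assoc, hNP, hNu]
      simp
    · rcases Nat.lt_succ_iff_lt_or_eq.1 hi with h | rfl
      · rw [hN, mul_add, mul_smul_comm, ← mul_assoc, ← mul_assoc, h2 i h]
        simp
      · exact huN
    · rcases Nat.lt_succ_iff_lt_or_eq.1 hi with h | rfl
      · rw [hN, add_mul, smul_mul_assoc, mul_assoc _ P, h3 i h]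
        simp
      · exact hNu
    · have e : T.cup (o + (n + 1)) * (P * T.u (o + n) * P) * T.cap (o + (n + 1)) =
          P * (T.cup (o + n + 1) * T.u (o + n) * T.cap (o + n + 1)) * P := by
        simp only [← mul_assoc]
        rw [hcup.eq, mul_assoc _ P, ← hcap.eq]
        simp only [mul_assoc, add_assoc]
      rw [hN, mul_add, add_mul, mul_smul_comm, smul_mul_assoc, e, T.cup_succ_u, T.cup_cap_succ,
        mul_one, h1, hcup.eq, mul_assoc, T.cup_cap_self, mul_smul_comm, mul_one, ← add_smul]
      congr 1
      have := hd.ne_zero (n + 1)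
      rw [wenzl, hd.recurrence (n + 1)]
      field_simp
      ring

include hd in
/-- A recursion for the Jones-Wenzl elements in steps of two. -/
theorem jw_add_four (o k : ℕ) :
    T.jw (wenzl d) o (k + 4) = T.jw (wenzl d) o (k + 2) +
      (-δ * d (k + 2) / d (k + 4)) •
        (T.jw (wenzl d) o (k + 2) * T.u (o + k + 1) * T.jw (wenzl d) o (k + 2)) +
      (d (k + 3) / d (k + 4)) • (T.jw (wenzl d) o (k + 2) * T.u (o + k + 2)) +
      (d (k + 2) / d (k + 4)) •
        (T.jw (wenzl d) o (k + 2) * T.u (o + k + 1) * T.jw (wenzl d) o (k + 2) * T.u (o + k + 2) +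
          T.jw (wenzl d) o (k + 2) * T.u (o + k + 2) * T.u (o + k + 1) *
            T.jw (wenzl d) o (k + 2)) +
      (d (k + 1) / d (k + 3) * (d (k + 2) / d (k + 4))) •
        (T.jw (wenzl d) o (k + 2) * T.u (o + k + 1) * T.u (o + k) * T.u (o + k + 2) *
          T.u (o + k + 1) * T.jw (wenzl d) o (k + 2)) := by
  have e4 : T.jw (wenzl d) o (k + 4) = T.jw (wenzl d) o (k + 3) + wenzl d (k + 2) •
      (T.jw (wenzl d) o (k + 3) * T.u (o + k + 2) * T.jw (wenzl d) o (k + 3)) := rfl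
  have e3 : T.jw (wenzl d) o (k + 3) = T.jw (wenzl d) o (k + 2) + wenzl d (k + 1) •
      (T.jw (wenzl d) o (k + 2) * T.u (o + k + 1) * T.jw (wenzl d) o (k + 2)) := rfl
  have e2 : T.jw (wenzl d) o (k + 2) = T.jw (wenzl d) o (k + 1) + wenzl d k •
      (T.jw (wenzl d) o (k + 1) * T.u (o + k) * T.jw (wenzl d) o (k + 1)) := rfl
  have hQ := T.isJW hd o (k + 1)
  have hVQ : Commute (T.u (o + k + 2)) (T.jw (wenzl d) o (k + 2)) :=
    T.commute_jw fun i hi => T.commute_u_u (by omega)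
  have hVR : Commute (T.u (o + k + 2)) (T.jw (wenzl d) o (k + 1)) :=
    T.commute_jw fun i hi => T.commute_u_u (by omega)
  have hUR : Commute (T.u (o + k + 1)) (T.jw (wenzl d) o (k + 1)) :=
    T.commute_jw fun i hi => T.commute_u_u (by omega)
  have hUVU := T.u_succ_u (o + k + 1)
  have hidem := hQ.idem
  have hl := hQ.absorb_left
  have hr := hQ.absorb_right
  clear hQ
  rw [e4, e3]
  simp only [add_assoc] at *
  norm_num at *
  generalize T.jw (wenzl d) o (k + 1) = P at *
  generalize T.jw (wenzl d) o (k + 2) = Q at *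
  generalize T.u (o + (k + 2)) = V at *
  generalize T.u (o + (k + 1)) = U at *
  generalize T.u (o + k) = W at *
  -- Expand the middle `Q` by Wenzl's recursion: `P` commutes with `U` and `V`, so its copies move
  -- outwards and are absorbed by the outer `Q`, while `U * V * U = U` shortens the first term.
  have key : Q * U * Q * V * U * Q = Q * U * Q + wenzl d k • (Q * U * W * V * U * Q) := by
    have h1 : U * Q * V * U = P * U + wenzl d k • (P * (U * W * V * U) * P) := by
      rw [e2]
      have a1 : U * P * V * U = P * U := by
        rw [hUR.eq, mul_assoc P, mul_assoc P, hUVU]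
      have a2 : U * (P * W * P) * V * U = P * (U * W * V * U) * P := by
        simp only [← mul_assoc]
        rw [hUR.eq, mul_assoc _ P V, ← hVR.eq, ← mul_assoc, mul_assoc _ P U, ← hUR.eq,
          ← mul_assoc]
      rw [mul_add, add_mul, add_mul, mul_smul_comm, smul_mul_assoc, smul_mul_assoc, a1, a2]
    calc Q * U * Q * V * U * Q = Q * (U * Q * V * U) * Q := by simp only [mul_assoc]
      _ = (Q * P) * U * Q + wenzl d k • ((Q * P) * (U * W * V * U) * (P * Q)) := by
        rw [h1]
        simp only [mul_add, add_mul, mul_smul_comm, smul_mul_assoc, mul_assoc]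
      _ = _ := by
        rw [hl, hr]
        simp only [mul_assoc]
  have expand : (Q + wenzl d (k + 1) • (Q * U * Q)) * V * (Q + wenzl d (k + 1) • (Q * U * Q)) =
      Q * V + wenzl d (k + 1) • (Q * U * Q * V) + wenzl d (k + 1) • (Q * V * U * Q) +
        (wenzl d (k + 1) * wenzl d (k + 1)) • (Q * U * Q * V * U * Q) := by
    have b1 : Q * V * Q = Q * V := by rw [mul_assoc, hVQ.eq, ← mul_assoc, hidem]
    have b2 : Q * U * Q * V * Q = Q * U * Q * V := by
      rw [mul_assoc, hVQ.eq, ← mul_assoc, mul_assoc _ Q Q, hidem]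
    simp only [mul_add, add_mul, mul_smul_comm, smul_mul_assoc, ← mul_assoc, b1, b2, smul_add,
      smul_smul, add_assoc]
  rw [expand, key]
  have n2 := hd.ne_zero (k + 1)
  have n3 := hd.ne_zero (k + 2)
  have n4 := hd.ne_zero (k + 3)
  -- The collected coefficient of `Q * U * Q` is [k+2]/[k+3] · ([k+4]+[k+2])/[k+4]. The recurrence
  -- cancels [k+3], which for odd k would vanish at a primitive fourth root of unity.
  have hδ : -(δ * d (k + 2)) = (d (k + 2) / d (k + 3)) * (d (k + 4) + d (k + 2)) := by
    have := hd.recurrence (k + 2)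
    norm_num [add_assoc] at this
    rw [this]
    norm_num [add_assoc] at n3
    field_simp
    ring
  rw [hδ]
  simp only [wenzl]
  norm_num [add_assoc] at n2 n3 n4 ⊢
  match_scalars <;> field_simp

include hd in
theorem jw_three (o : ℕ) :
    T.jw (wenzl d) o 3 = 1 + (-δ / d 3) • T.u o + (d 2 / d 3) • T.u (o + 1) +
      (d 1 / d 3) • (T.u o * T.u (o + 1) + T.u (o + 1) * T.u o) := by
  have n2 := hd.ne_zero 1
  have n3 := hd.ne_zero 2
  have e : T.jw (wenzl d) o 3 = 1 + wenzl d 0 • T.u o + wenzl d 1 •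
      ((1 + wenzl d 0 • T.u o) * T.u (o + 1) * (1 + wenzl d 0 • T.u o)) := by
    simp [jw]
  have hδ : -δ = (1 / d 2) * (d 3 + 1) := by
    have h3 := hd.recurrence 1
    have h2 := hd.recurrence 0
    norm_num [hd.one] at h3 n2
    rw [h3]
    field_simp
    ring
  rw [e, hδ]
  simp only [mul_add, add_mul, mul_smul_comm, smul_mul_assoc, one_mul, mul_one, smul_add,
    smul_smul, T.u_succ_u]
  simp only [wenzl, hd.one]
  norm_num at n2 n3 ⊢
  match_scalars <;> field_simp

end Wenzl

end TLSystem

namespace TLSystem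

/-! ### Braidings with general crossing coefficients -/

section Braids

variable {R : Type*} [CommRing R] {δ : R} {A : Type*} [Ring A] [Algebra R A] (T : TLSystem δ A)

/-- Crossings with general coefficients. -/
def sig (a b : R) (i : ℕ) : A := a • (1 : A) + b • T.u i

/-- The product `σ (o + m - 1) ⋯ σ o`. -/
def down (σ : ℕ → A) (o : ℕ) : ℕ → A
  | 0 => 1
  | m + 1 => σ (o + m) * down σ o m

/-- The product `σ o ⋯ σ (o + m - 1)`. -/
def up (σ : ℕ → A) (o : ℕ) : ℕ → A
  | 0 => 1
  | m + 1 => up σ o m * σ (o + m)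

/-- The braiding of `m` strands with `n` strands, with crossings `σ`. -/
def braiding (σ : ℕ → A) (m : ℕ) : ℕ → A
  | 0 => 1
  | n + 1 => braiding σ m n * down σ n m

variable {a b : R}

theorem commute_sig {x : A} {i : ℕ} (h : Commute x (T.u i)) : Commute x (T.sig a b i) :=
  ((Commute.one_right x).smul_right a).add_right (h.smul_right b)

theorem commute_down {σ : ℕ → A} {x : A} {o : ℕ} :
    ∀ {m : ℕ}, (∀ i < m, Commute x (σ (o + i))) → Commute x (down σ o m)
  | 0, _ => Commute.one_right x
  | m + 1, h => (h m (by omega)).mul_right (commute_down fun i hi => h i (by omega))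

theorem commute_up {σ : ℕ → A} {x : A} {o : ℕ} :
    ∀ {m : ℕ}, (∀ i < m, Commute x (σ (o + i))) → Commute x (up σ o m)
  | 0, _ => Commute.one_right x
  | m + 1, h => (commute_up fun i hi => h i (by omega)).mul_right (h m (by omega))

theorem commute_braiding {σ : ℕ → A} {x : A} {m : ℕ} :
    ∀ {n : ℕ}, (∀ i, i + 1 < m + n → Commute x (σ i)) → Commute x (braiding σ m n)
  | 0, _ => Commute.one_right x
  | n + 1, h => (commute_braiding fun i hi => h i (by omega)).mul_right
      (commute_down fun i hi => h _ (by omega))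

variable (hab : a * a + a * b * δ + b * b = 0)

include hab

/-- After expansion both sides contain the same term in `T.u i * T.u (i + 1)`, and the remaining
single generators carry the coefficient that `hab` sets to zero. This is the local move behind all
slides below. -/
theorem u_sig_succ_sig (i : ℕ) :
    T.u i * (T.sig a b (i + 1) * T.sig a b i) =
      T.sig a b (i + 1) * T.sig a b i * T.u (i + 1) := by
  have h1 := T.u_mul_self i
  have h2 := T.u_mul_self (i + 1)
  have h3 := T.u_succ_u i
  have h4 := T.u_u_succ i
  have e1 : T.u i * (T.sig a b (i + 1) * T.sig a b i) =
      (a * a + a * b * δ + b * b) • T.u i + (a * b) • (T.u i * T.u (i + 1)) := by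
    simp only [sig, mul_add, add_mul, smul_mul_assoc, mul_smul_comm, one_mul, mul_one,
      ← mul_assoc, h1, h3]
    module
  have e2 : T.sig a b (i + 1) * T.sig a b i * T.u (i + 1) =
      (a * a + a * b * δ + b * b) • T.u (i + 1) + (a * b) • (T.u i * T.u (i + 1)) := by
    simp only [sig, mul_add, add_mul, smul_mul_assoc, mul_smul_comm, one_mul, mul_one, h2, h4]
    module
  rw [e1, e2, hab, zero_smul, zero_smul]

theorem u_succ_sig_sig_succ (i : ℕ) :
    T.u (i + 1) * (T.sig a b i * T.sig a b (i + 1)) =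
      T.sig a b i * T.sig a b (i + 1) * T.u i := by
  have h1 := T.u_mul_self i
  have h2 := T.u_mul_self (i + 1)
  have h3 := T.u_succ_u i
  have h4 := T.u_u_succ i
  have e1 : T.u (i + 1) * (T.sig a b i * T.sig a b (i + 1)) =
      (a * a + a * b * δ + b * b) • T.u (i + 1) + (a * b) • (T.u (i + 1) * T.u i) := by
    simp only [sig, mul_add, add_mul, smul_mul_assoc, mul_smul_comm, one_mul, mul_one,
      ← mul_assoc, h2, h4]
    module
  have e2 : T.sig a b i * T.sig a b (i + 1) * T.u i =
      (a * a + a * b * δ + b * b) • T.u i + (a * b) • (T.u (i + 1) * T.u i) := by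
    simp only [sig, mul_add, add_mul, smul_mul_assoc, mul_smul_comm, one_mul, mul_one, h1, h3]
    module
  rw [e1, e2, hab, zero_smul, zero_smul]

/-- A strand is pulled past a cap. The factor `a * b` measures the normalization: it is 1 for
Kauffman's crossing, but q for the coefficients (q, 1) and r for (1, r). -/
theorem sig_sig_succ_cap (i : ℕ) :
    T.sig a b i * T.sig a b (i + 1) * T.cap i = (a * b) • T.cap (i + 1) := by
  have h1 := T.u_cap_self i
  have h2 := T.u_succ_cap i
  have h3 := T.u_cap_succ i
  have e : T.sig a b i * T.sig a b (i + 1) * T.cap i =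
      (a * a + a * b * δ + b * b) • T.cap i + (a * b) • T.cap (i + 1) := by
    simp only [sig, mul_add, add_mul, smul_mul_assoc, mul_smul_comm, one_mul, mul_one, mul_assoc,
      h1, h2, h3]
    module
  rw [e, hab, zero_smul, zero_add]

theorem sig_succ_sig_cap (i : ℕ) :
    T.sig a b (i + 1) * T.sig a b i * T.cap (i + 1) = (a * b) • T.cap i := by
  have h1 := T.u_cap_self (i + 1)
  have h2 := T.u_succ_cap i
  have h3 := T.u_cap_succ i
  have e : T.sig a b (i + 1) * T.sig a b i * T.cap (i + 1) =
      (a * a + a * b * δ + b * b) • T.cap (i + 1) + (a * b) • T.cap i := by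
    simp only [sig, mul_add, add_mul, smul_mul_assoc, mul_smul_comm, one_mul, mul_one, mul_assoc,
      h1, h2, h3]
    module
  rw [e, hab, zero_smul, zero_add]

theorem u_down (o : ℕ) : ∀ (m i : ℕ), i + 1 < m →
    T.u (o + i) * down (T.sig a b) o m = down (T.sig a b) o m * T.u (o + i + 1)
  | m + 1, i, h => by
    rcases Nat.lt_or_ge (i + 1) m with h' | h'
    · have hc : Commute (T.u (o + i)) (T.sig a b (o + m)) :=
        T.commute_sig (T.commute_u_u (by omega)).symm
      rw [down, ← mul_assoc, hc.eq, mul_assoc, u_down o m i h', mul_assoc]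
    · obtain rfl : m = i + 1 := by omega
      have hc : Commute (T.u (o + i + 1)) (down (T.sig a b) o i) :=
        commute_down fun j hj => T.commute_sig (T.commute_u_u (by omega))
      rw [down, down, ← add_assoc, ← mul_assoc (T.sig a b _), ← mul_assoc (T.u _),
        T.u_sig_succ_sig hab, mul_assoc, hc.eq]
      simp only [mul_assoc]

theorem u_up (o : ℕ) : ∀ (m i : ℕ), i + 1 < m →
    T.u (o + i + 1) * up (T.sig a b) o m = up (T.sig a b) o m * T.u (o + i)
  | m + 1, i, h => by
    rcases Nat.lt_or_ge (i + 1) m with h' | h'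
    · have hc : Commute (T.u (o + i)) (T.sig a b (o + m)) :=
        T.commute_sig (T.commute_u_u (by omega)).symm
      rw [up, ← mul_assoc, u_up o m i h', mul_assoc, hc.eq, mul_assoc]
    · obtain rfl : m = i + 1 := by omega
      have hc : Commute (T.u (o + i + 1)) (up (T.sig a b) o i) :=
        commute_up fun j hj => T.commute_sig (T.commute_u_u (by omega))
      rw [up, up, ← add_assoc, mul_assoc (up _ _ _), ← mul_assoc, hc.eq, mul_assoc,
        T.u_succ_sig_sig_succ hab]
      simp only [mul_assoc]

theorem u_braiding {m i : ℕ} (h : i + 1 < m) : ∀ n : ℕ,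
    T.u i * braiding (T.sig a b) m n = braiding (T.sig a b) m n * T.u (n + i)
  | 0 => by simp [braiding]
  | n + 1 => by
    rw [braiding, ← mul_assoc, u_braiding h n, mul_assoc, T.u_down hab n m i h, mul_assoc,
      show n + 1 + i = n + i + 1 by omega]

theorem u_down_down (i : ℕ) : ∀ m : ℕ,
    T.u (m + i) * (down (T.sig a b) i m * down (T.sig a b) (i + 1) m) =
      down (T.sig a b) i m * down (T.sig a b) (i + 1) m * T.u i
  | 0 => by simp [down]
  | m + 1 => by
    have hc : Commute (T.sig a b (i + 1 + m)) (down (T.sig a b) i m) :=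
      commute_down fun j hj => T.commute_sig (T.commute_sig (T.commute_u_u (by omega)).symm).symm
    have e : down (T.sig a b) i (m + 1) * down (T.sig a b) (i + 1) (m + 1) =
        T.sig a b (i + m) * T.sig a b (i + m + 1) *
          (down (T.sig a b) i m * down (T.sig a b) (i + 1) m) := by
      rw [down, down, mul_assoc, ← mul_assoc (down _ _ _), ← hc.eq, mul_assoc, mul_assoc,
        show i + 1 + m = i + m + 1 by omega]
    rw [e, ← mul_assoc, show m + 1 + i = i + m + 1 by omega, T.u_succ_sig_sig_succ hab, mul_assoc,
      show i + m = m + i by omega, u_down_down i m]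
    simp only [mul_assoc]

theorem u_add_braiding (m : ℕ) : ∀ {n i : ℕ}, i + 1 < n →
    T.u (m + i) * braiding (T.sig a b) m n = braiding (T.sig a b) m n * T.u i
  | n + 1, i, h => by
    rcases Nat.lt_or_ge (i + 1) n with h' | h'
    · have hc : Commute (T.u i) (down (T.sig a b) n m) :=
        commute_down fun j hj => T.commute_sig (T.commute_u_u (by omega)).symm
      rw [braiding, ← mul_assoc, u_add_braiding m h', mul_assoc, hc.eq, mul_assoc]
    · obtain rfl : n = i + 1 := by omega
      have hc : Commute (T.u (m + i)) (braiding (T.sig a b) m i) :=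
        commute_braiding fun j hj => T.commute_sig (T.commute_u_u (by omega))
      rw [braiding, braiding, mul_assoc (braiding _ _ _), ← mul_assoc, hc.eq, mul_assoc,
        T.u_down_down hab]
      simp only [mul_assoc]

theorem down_down_cap (i : ℕ) : ∀ m : ℕ,
    down (T.sig a b) i m * down (T.sig a b) (i + 1) m * T.cap i =
      (a * b) ^ m • T.cap (i + m)
  | 0 => by simp [down]
  | m + 1 => by
    have hc : Commute (T.sig a b (i + 1 + m)) (down (T.sig a b) i m) :=
      commute_down fun j hj => T.commute_sig (T.commute_sig (T.commute_u_u (by omega)).symm).symm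
    have e : down (T.sig a b) i (m + 1) * down (T.sig a b) (i + 1) (m + 1) =
        T.sig a b (i + m) * T.sig a b (i + m + 1) *
          (down (T.sig a b) i m * down (T.sig a b) (i + 1) m) := by
      rw [down, down, mul_assoc, ← mul_assoc (down _ _ _), ← hc.eq, mul_assoc, mul_assoc,
        show i + 1 + m = i + m + 1 by omega]
    rw [e, mul_assoc, down_down_cap i m, mul_smul_comm, T.sig_sig_succ_cap hab, smul_smul,
      ← pow_succ, ← add_assoc]

theorem up_up_cap (i : ℕ) : ∀ m : ℕ,
    up (T.sig a b) (i + 1) m * up (T.sig a b) i m * T.cap (i + m) = (a * b) ^ m • T.cap i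
  | 0 => by simp [up]
  | m + 1 => by
    have hc : Commute (T.sig a b (i + 1 + m)) (up (T.sig a b) i m) :=
      commute_up fun j hj => T.commute_sig (T.commute_sig (T.commute_u_u (by omega)).symm).symm
    have e : up (T.sig a b) (i + 1) (m + 1) * up (T.sig a b) i (m + 1) =
        up (T.sig a b) (i + 1) m * up (T.sig a b) i m *
          (T.sig a b (i + m + 1) * T.sig a b (i + m)) := by
      rw [up, up, mul_assoc, ← mul_assoc (T.sig _ _ _), hc.eq, mul_assoc, mul_assoc,
        show i + 1 + m = i + m + 1 by omega]
    rw [e, mul_assoc, ← add_assoc, T.sig_succ_sig_cap hab, mul_smul_comm, up_up_cap i m, smul_smul,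
      ← pow_succ']

omit hab

/-- The definition peels off strands of the right block; this peels off the last strand of the left
block. Both forms are needed to isolate one strand in a double braiding. -/
theorem braiding_succ_left (n : ℕ) : ∀ m : ℕ,
    braiding (T.sig a b) (n + 1) m = up (T.sig a b) n m * braiding (T.sig a b) n m
  | 0 => by simp [braiding, up]
  | m + 1 => by
    have hc : Commute (T.sig a b (n + m)) (braiding (T.sig a b) n m) :=
      commute_braiding fun j hj => T.commute_sig (T.commute_sig (T.commute_u_u (by omega)).symm).symm
    rw [braiding, braiding_succ_left n m, down, up, braiding, mul_assoc, ← mul_assoc (braiding _ _ _),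
      show m + n = n + m by omega, ← hc.eq]
    simp only [mul_assoc]

/-- The braiding has `m * n` crossings. This allows rescaled crossings, which avoid the square root
of the parameter. -/
theorem braiding_smul (c : R) (σ : ℕ → A) (m : ℕ) : ∀ n : ℕ,
    braiding (fun i => c • σ i) m n = c ^ (m * n) • braiding σ m n
  | 0 => by simp [braiding]
  | n + 1 => by
    have hdown : ∀ o k, down (fun i => c • σ i) o k = c ^ k • down σ o k := by
      intro o k
      induction k with
      | zero => simp [down]
      | succ k ih => rw [down, down, ih, smul_mul_smul_comm, ← pow_succ']
    rw [braiding, braiding, braiding_smul c σ m n, hdown, smul_mul_smul_comm, ← pow_add, mul_add,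
      mul_one]

end Braids

/-! ### Circles around strands and partial traces -/

section Encircle

variable {R : Type*} [CommRing R] {δ : R} {A : Type*} [Ring A] [Algebra R A] (T : TLSystem δ A)
  (q r : R)

/-- The double braiding of `m` strands with `n` strands. -/
def dbl (m n : ℕ) : A := braiding (T.sig q 1) m n * braiding (T.sig 1 r) n m

/-- A strand winding around `m` strands. -/
def wind (o m : ℕ) : A := down (T.sig q 1) o m * up (T.sig 1 r) o m

/-- A circle around `m` strands. -/
def circ (o m : ℕ) : A := T.cup (o + m) * T.wind q r o m * T.cap (o + m)

/-- The nested cups opening a partial trace over `n` strands. -/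
def cups (m : ℕ) : ℕ → A
  | 0 => 1
  | n + 1 => cups m n * T.cup (m + n)

/-- The nested caps closing a partial trace over `n` strands. -/
def caps (m : ℕ) : ℕ → A
  | 0 => 1
  | n + 1 => T.cap (m + n) * caps m n

/-- The partial trace over the strands `m, …, m + n - 1`. -/
def trace (m n : ℕ) (f : A) : A := T.cups m n * f * T.caps m n

variable {q r}

theorem commute_wind {x : A} {o m : ℕ} (h : ∀ i < m, Commute x (T.u (o + i))) :
    Commute x (T.wind q r o m) :=
  (commute_down fun i hi => T.commute_sig (h i hi)).mul_right
    (commute_up fun i hi => T.commute_sig (h i hi))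

theorem commute_dbl {x : A} {m n : ℕ} (h : ∀ i, i + 1 < m + n → Commute x (T.u i)) :
    Commute x (T.dbl q r m n) :=
  (commute_braiding fun i hi => T.commute_sig (h i hi)).mul_right
    (commute_braiding fun i hi => T.commute_sig (h i (by omega)))

theorem trace_succ (m n : ℕ) (f : A) :
    T.trace m (n + 1) f = T.trace m n (T.cup (m + n) * f * T.cap (m + n)) := by
  simp only [trace, cups, caps, mul_assoc]

theorem trace_add (m n : ℕ) (f g : A) : T.trace m n (f + g) = T.trace m n f + T.trace m n g := by
  simp only [trace, mul_add, add_mul]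

theorem trace_smul (m n : ℕ) (c : R) (f : A) : T.trace m n (c • f) = c • T.trace m n f := by
  simp only [trace, mul_smul_comm, smul_mul_assoc]

theorem trace_mul_left {m : ℕ} {x : A} (hx : ∀ j, Commute x (T.cup (m + j))) (n : ℕ) (f : A) :
    T.trace m n (x * f) = x * T.trace m n f := by
  have : Commute x (T.cups m n) := by
    induction n with
    | zero => exact Commute.one_right x
    | succ n ih => exact ih.mul_right (hx n)
  rw [trace, trace, ← mul_assoc, ← this.eq]
  simp only [mul_assoc]

theorem trace_mul_right {m : ℕ} {x : A} (hx : ∀ j, Commute x (T.cap (m + j))) (n : ℕ) (f : A) :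
    T.trace m n (f * x) = T.trace m n f * x := by
  have : Commute x (T.caps m n) := by
    induction n with
    | zero => exact Commute.one_right x
    | succ n ih => exact (hx n).mul_right ih
  rw [trace, trace, mul_assoc, mul_assoc, this.eq]
  simp only [mul_assoc]

/-- A generator slides around the closing strands of a partial trace. -/
theorem cups_u (m i : ℕ) : ∀ k : ℕ,
    T.cups m (i + 2 + k) * T.u (m + i) = T.cups m (i + 2 + k) * T.u (m + i + 2 + 2 * k)
  | 0 => by
    have h : T.cup (m + i) * T.cup (m + i + 2) = T.cup (m + i) * T.cup (m + i) :=
      T.cup_cup _ _ le_rfl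
    change T.cups m i * T.cup (m + i) * T.cup (m + i + 1) * T.u (m + i) =
      T.cups m i * T.cup (m + i) * T.cup (m + i + 1) * T.u (m + i + 1 + 1)
    rw [mul_assoc _ (T.cup (m + i + 1)), mul_assoc _ (T.cup (m + i + 1)), T.cup_succ_u,
      T.cup_u_succ, mul_assoc, mul_assoc, h]
  | k + 1 => by
    have hc : Commute (T.cup (m + (i + 2 + k))) (T.u (m + i)) := T.commute_cup_u (by omega)
    change T.cups m (i + 2 + k) * T.cup (m + (i + 2 + k)) * T.u (m + i) =
      T.cups m (i + 2 + k) * T.cup (m + (i + 2 + k)) * T.u (m + i + 2 + 2 * k + 2)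
    rw [mul_assoc, hc.eq, ← mul_assoc, cups_u m i k, mul_assoc, mul_assoc, T.cup_u_far (by omega)]

theorem u_caps (m i : ℕ) : ∀ k : ℕ,
    T.u (m + i) * T.caps m (i + 2 + k) = T.u (m + i + 2 + 2 * k) * T.caps m (i + 2 + k)
  | 0 => by
    have h : T.cap (m + i + 2) * T.cap (m + i) = T.cap (m + i) * T.cap (m + i) :=
      T.cap_cap _ _ le_rfl
    change T.u (m + i) * (T.cap (m + i + 1) * (T.cap (m + i) * T.caps m i)) =
      T.u (m + i + 1 + 1) * (T.cap (m + i + 1) * (T.cap (m + i) * T.caps m i))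
    rw [← mul_assoc, ← mul_assoc (T.u (m + i + 1 + 1)), T.u_cap_succ, T.u_succ_cap, ← mul_assoc,
      ← mul_assoc, h]
  | k + 1 => by
    have hc : Commute (T.cap (m + (i + 2 + k))) (T.u (m + i)) := T.commute_cap_u (by omega)
    change T.u (m + i) * (T.cap (m + (i + 2 + k)) * T.caps m (i + 2 + k)) =
      T.u (m + i + 2 + 2 * k + 2) * (T.cap (m + (i + 2 + k)) * T.caps m (i + 2 + k))
    rw [← mul_assoc, ← hc.eq, mul_assoc, u_caps m i k, ← mul_assoc, ← mul_assoc,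
      T.u_far_cap (by omega)]

/-- Elements that commute with everything on the strands from `N` on. -/
def IsLocal (N : ℕ) (x : A) : Prop := ∀ j, N ≤ j → Commute (T.u j) x

/-- Cyclicity of the partial trace: the generator slides over the nested cups to the closing
strands, passes `f` there by locality, and returns over the caps. -/
theorem trace_u_comm {m n i : ℕ} (h : i + 1 < n) {f : A} (hf : T.IsLocal (m + n) f) :
    T.trace m n (T.u (m + i) * f) = T.trace m n (f * T.u (m + i)) := by
  obtain ⟨k, rfl⟩ := Nat.exists_eq_add_of_le (show i + 2 ≤ n from h)
  have hc := (hf (m + i + 2 + 2 * k) (by omega)).eq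
  rw [trace, trace, ← mul_assoc, cups_u, mul_assoc _ (T.u _), hc]
  simp only [mul_assoc]
  rw [u_caps]

theorem trace_jw_comm {c : ℕ → R} {m n : ℕ} : ∀ {l : ℕ}, l ≤ n → ∀ {f : A},
    T.IsLocal (m + n) f → T.trace m n (T.jw c m l * f) = T.trace m n (f * T.jw c m l)
  | 0, _, f, _ => by simp [jw]
  | 1, _, f, _ => by simp [jw]
  | l + 2, h, f, hf => by
    have hP : T.IsLocal (m + n) (T.jw c m (l + 1)) := fun j hj =>
      T.commute_jw fun i hi => T.commute_u_u (by omega)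
    have hu : T.IsLocal (m + n) (T.u (m + l)) := fun j hj => T.commute_u_u (by omega)
    have ih := fun {f : A} => trace_jw_comm (c := c) (m := m) (show l + 1 ≤ n by omega) (f := f)
    rw [jw, add_mul, mul_add, trace_add, trace_add, ih hf, smul_mul_assoc, mul_smul_comm,
      trace_smul, trace_smul]
    congr 2
    rw [mul_assoc, mul_assoc,
      ih fun j hj => (hu j hj).mul_right ((hP j hj).mul_right (hf j hj)), mul_assoc,
      T.trace_u_comm (by omega) fun j hj => ((hP j hj).mul_right (hf j hj)).mul_right (hP j hj),
      mul_assoc, mul_assoc,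
      ih fun j hj => (hf j hj).mul_right ((hP j hj).mul_right (hu j hj))]
    simp only [mul_assoc]

theorem circ_zero (o : ℕ) : T.circ q r o 0 = δ • (1 : A) := by
  simp [circ, wind, down, up, T.cup_cap_self]

theorem braiding_zero_left (σ : ℕ → A) : ∀ m, braiding σ 0 m = 1
  | 0 => rfl
  | m + 1 => by rw [braiding, braiding_zero_left σ m, down, mul_one]

theorem dbl_succ (m n : ℕ) : T.dbl q r m (n + 1) =
    braiding (T.sig q 1) m n * T.wind q r n m * braiding (T.sig 1 r) n m := by
  rw [dbl, wind, braiding, T.braiding_succ_left]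
  simp only [mul_assoc]

/-- Only the scalar part of each crossing survives: q for each factor of `down` and 1 for each
factor of `up`. -/
theorem wind_mul {o : ℕ} {J : A} : ∀ {m : ℕ}, (∀ i < m, T.u (o + i) * J = 0) →
    T.wind q r o m * J = q ^ m • J := by
  have hup : ∀ {m : ℕ}, (∀ i < m, T.u (o + i) * J = 0) → up (T.sig 1 r) o m * J = J := by
    intro m h
    induction m with
    | zero => simp [up]
    | succ m ih =>
      rw [up, mul_assoc]
      simp only [sig, add_mul, smul_mul_assoc, h m (by omega), one_mul, one_smul, smul_zero,
        add_zero]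
      exact ih fun i hi => h i (by omega)
  have hdown : ∀ {m : ℕ}, (∀ i < m, T.u (o + i) * J = 0) →
      down (T.sig q 1) o m * J = q ^ m • J := by
    intro m h
    induction m with
    | zero => simp [down]
    | succ m ih =>
      rw [down, mul_assoc, ih fun i hi => h i (by omega), mul_smul_comm]
      simp only [sig, add_mul, smul_mul_assoc, h m (by omega), one_mul, smul_zero, add_zero]
      rw [smul_smul, pow_succ]
  intro m h
  rw [wind, mul_assoc, hup h, hdown h]

theorem mul_wind {o : ℕ} {J : A} : ∀ {m : ℕ}, (∀ i < m, J * T.u (o + i) = 0) →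
    J * T.wind q r o m = q ^ m • J := by
  have hup : ∀ {m : ℕ}, (∀ i < m, J * T.u (o + i) = 0) → J * up (T.sig 1 r) o m = J := by
    intro m h
    induction m with
    | zero => simp [up]
    | succ m ih =>
      rw [up, ← mul_assoc, ih fun i hi => h i (by omega)]
      simp only [sig, mul_add, mul_smul_comm, h m (by omega), mul_one, one_smul, smul_zero,
        add_zero]
  have hdown : ∀ {m : ℕ}, (∀ i < m, J * T.u (o + i) = 0) →
      J * down (T.sig q 1) o m = q ^ m • J := by
    intro m h
    induction m with
    | zero => simp [down]
    | succ m ih =>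
      rw [down, ← mul_assoc]
      simp only [sig, mul_add, mul_smul_comm, h m (by omega), mul_one, smul_zero, add_zero,
        smul_mul_assoc]
      rw [ih fun i hi => h i (by omega), smul_smul, pow_succ']
  intro m h
  rw [wind, ← mul_assoc, hdown h, smul_mul_assoc, hup h]

variable (hqr : q * r = 1) (hδ : δ = -(q + r))

include hqr hδ

theorem sig_left_coeff : q * q + q * 1 * δ + 1 * 1 = 0 := by
  rw [hδ]; linear_combination -hqr

theorem sig_right_coeff : 1 * 1 + 1 * r * δ + r * r = 0 := by
  rw [hδ]; linear_combination -hqr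

-- Expand the two crossings with the last enclosed strand. Three of the four terms straighten to
-- `wind`, with total coefficient qδ + qr + 1 = 1 - q²; the fourth is the smaller circle. Iterated,
-- this writes the circle in the generators on the enclosed strands alone.
omit hqr in
theorem circ_succ (o m : ℕ) : T.circ q r o (m + 1) =
    (1 - q * q) • T.wind q r o m + r • T.circ q r o m := by
  have hcup : Commute (T.cup (o + m + 1)) (T.wind q r o m) :=
    T.commute_wind fun i hi => T.commute_cup_u (by omega)
  have hcap : Commute (T.cap (o + m + 1)) (T.wind q r o m) :=
    T.commute_wind fun i hi => T.commute_cap_u (by omega)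
  have e : T.wind q r o (m + 1) = T.sig q 1 (o + m) * T.wind q r o m * T.sig 1 r (o + m) := by
    simp only [wind, down, up, mul_assoc]
  have h1 : T.cup (o + m + 1) * T.sig q 1 (o + m) = q • T.cup (o + m + 1) + T.cup (o + m) := by
    simp [sig, mul_add, T.cup_succ_u]
  have h2 : T.sig 1 r (o + m) * T.cap (o + m + 1) = T.cap (o + m + 1) + r • T.cap (o + m) := by
    simp [sig, add_mul, T.u_cap_succ]
  have e2 : T.circ q r o (m + 1) = (q • T.cup (o + m + 1) + T.cup (o + m)) * T.wind q r o m *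
      (T.cap (o + m + 1) + r • T.cap (o + m)) := by
    rw [← h1, ← h2, circ, e]
    simp only [mul_assoc, add_assoc]
  have a1 : T.cup (o + m + 1) * T.wind q r o m * T.cap (o + m + 1) = δ • T.wind q r o m := by
    rw [hcup.eq, mul_assoc, T.cup_cap_self, mul_smul_comm, mul_one]
  have a2 : T.cup (o + m + 1) * T.wind q r o m * T.cap (o + m) = T.wind q r o m := by
    rw [hcup.eq, mul_assoc, T.cup_succ_cap, mul_one]
  have a3 : T.cup (o + m) * T.wind q r o m * T.cap (o + m + 1) = T.wind q r o m := by
    rw [mul_assoc, ← hcap.eq, ← mul_assoc, T.cup_cap_succ, one_mul]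
  rw [e2]
  simp only [add_mul, mul_add, smul_mul_assoc, mul_smul_comm, a1, a2, a3]
  rw [← circ]
  match_scalars
  · linear_combination q * hδ
  · ring

omit hqr in
theorem commute_circ {x : A} {o : ℕ} : ∀ {m : ℕ}, (∀ i, i + 1 < m → Commute x (T.u (o + i))) →
    Commute x (T.circ q r o m)
  | 0, _ => by
    rw [T.circ_zero]
    exact (Commute.one_right x).smul_right δ
  | m + 1, h => by
    rw [T.circ_succ hδ]
    exact ((T.commute_wind fun i hi => h i (by omega)).smul_right _).add_right
      ((commute_circ fun i hi => h i (by omega)).smul_right _)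

/-- A generator on the enclosed strands shifts up by one position through `down` and back through
`up`, so the circle is central there. -/
theorem commute_u_circ {o m i : ℕ} (h : i + 1 < m) : Commute (T.u (o + i)) (T.circ q r o m) := by
  have hw : Commute (T.u (o + i)) (T.wind q r o m) := by
    rw [Commute, SemiconjBy, wind, ← mul_assoc, T.u_down (sig_left_coeff hqr hδ) o m i h, mul_assoc,
      T.u_up (sig_right_coeff hqr hδ) o m i h, mul_assoc]
  exact ((T.commute_cup_u (by omega)).symm.mul_right hw).mul_right
    (T.commute_cap_u (by omega)).symm

/-- By `circ_succ` and `wind_mul` the eigenvalue satisfies λ_{m+1} = (1 - q²) q^m + r λ_m, starting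
from the free loop λ_0 = δ = -(q + r). -/
theorem circ_mul {o : ℕ} {J : A} : ∀ {m : ℕ}, (∀ i, i + 1 < m → T.u (o + i) * J = 0) →
    T.circ q r o m * J = (-(q ^ (m + 1) + r ^ (m + 1))) • J
  | 0, _ => by rw [T.circ_zero, smul_mul_assoc, one_mul, zero_add, pow_one, pow_one, ← hδ]
  | m + 1, h => by
    rw [T.circ_succ hδ, add_mul, smul_mul_assoc, smul_mul_assoc,
      T.wind_mul fun i hi => h i (by omega), circ_mul fun i hi => h i (by omega), smul_smul,
      smul_smul, ← add_smul]
    congr 1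
    linear_combination (-q ^ m) * hqr

theorem mul_circ {o : ℕ} {J : A} : ∀ {m : ℕ}, (∀ i, i + 1 < m → J * T.u (o + i) = 0) →
    J * T.circ q r o m = (-(q ^ (m + 1) + r ^ (m + 1))) • J
  | 0, _ => by rw [T.circ_zero, mul_smul_comm, mul_one, zero_add, pow_one, pow_one, ← hδ]
  | m + 1, h => by
    rw [T.circ_succ hδ, mul_add, mul_smul_comm, mul_smul_comm,
      T.mul_wind fun i hi => h i (by omega), mul_circ fun i hi => h i (by omega), smul_smul,
      smul_smul, ← add_smul]
    congr 1
    linear_combination (-q ^ m) * hqr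

/-- The circle around one strand more than the support of a Jones-Wenzl element. -/
theorem mul_circ_mul {m : ℕ} {J : A} (h₁ : ∀ i < m, T.u (0 + i) * J = 0)
    (h₂ : ∀ i < m, J * T.u (0 + i) = 0) (hJ : J * J = J) :
    J * T.circ q r 0 (m + 2) * J =
      ((1 - q * q) * q ^ (m + 1) - r * (q ^ (m + 2) + r ^ (m + 2))) • J +
        ((1 - q * q) * (2 * q ^ m - r * (q ^ (m + 1) + r ^ (m + 1)))) • (J * T.u m * J) := by
  have hcap : Commute (T.cap m) (T.circ q r 0 m) :=
    T.commute_circ hδ fun i hi => T.commute_cap_u (by omega)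
  have e : T.wind q r 0 (m + 1) = T.sig q 1 m * T.wind q r 0 m * T.sig 1 r m := by
    simp only [wind, down, up, mul_assoc, zero_add]
  -- Between two copies of the generator the winding strand is closed into a circle around the first
  -- m strands.
  have huwu : T.u m * T.wind q r 0 m * T.u m = T.circ q r 0 m * T.u m := by
    rw [u, ← mul_assoc (T.circ _ _ _ _), ← hcap.eq, circ]
    simp only [mul_assoc, zero_add]
  have hw : J * T.wind q r 0 (m + 1) * J = q ^ (m + 1) • J +
      (2 * q ^ m - r * (q ^ (m + 1) + r ^ (m + 1))) • (J * T.u m * J) := by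
    have a1 : J * T.wind q r 0 m * J = q ^ m • J := by
      rw [T.mul_wind h₂, smul_mul_assoc, hJ]
    have a2 : J * T.wind q r 0 m * T.u m * J = q ^ m • (J * T.u m * J) := by
      rw [T.mul_wind h₂, smul_mul_assoc, smul_mul_assoc]
    have a3 : J * T.u m * T.wind q r 0 m * J = q ^ m • (J * T.u m * J) := by
      rw [mul_assoc _ _ J, T.wind_mul h₁, mul_smul_comm]
    have a4 : J * T.u m * T.wind q r 0 m * T.u m * J =
        (-(q ^ (m + 1) + r ^ (m + 1))) • (J * T.u m * J) := by
      rw [mul_assoc J, mul_assoc J, huwu, ← mul_assoc J,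
        T.mul_circ hqr hδ fun i hi => h₂ i (by omega), smul_mul_assoc, smul_mul_assoc]
    rw [e]
    simp only [sig, add_mul, mul_add, smul_mul_assoc, mul_smul_comm, one_mul, mul_one, one_smul,
      ← mul_assoc, a1, a2, a3, a4]
    match_scalars
    · ring
    · linear_combination q ^ m * hqr
  rw [T.circ_succ hδ, mul_add, add_mul, mul_smul_comm, mul_smul_comm, smul_mul_assoc,
    smul_mul_assoc, hw, T.mul_circ hqr hδ fun i hi => h₂ i (by omega), smul_mul_assoc, hJ]
  module

/-- The circle's own cup and cap lie outside the enclosed strands and have no direct slide through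
the braiding. By `circ_succ`, however, only generators on the m strands are involved, and these do
slide. -/
theorem semiconj_circ (m n : ℕ) : ∀ {j : ℕ}, j ≤ m →
    SemiconjBy (braiding (T.sig q 1) m n) (T.circ q r n j) (T.circ q r 0 j) := by
  have hu : ∀ i, i + 1 < m → SemiconjBy (braiding (T.sig q 1) m n) (T.u (n + i)) (T.u (0 + i)) := by
    intro i hi
    rw [zero_add]
    exact (T.u_braiding (sig_left_coeff hqr hδ) hi n).symm
  have hs : ∀ (a b : R) (i : ℕ), i + 1 < m →
      SemiconjBy (braiding (T.sig q 1) m n) (T.sig a b (n + i)) (T.sig a b (0 + i)) := by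
    intro a b i hi
    have h1 : SemiconjBy (braiding (T.sig q 1) m n) (a • (1 : A)) (a • (1 : A)) :=
      (Commute.one_right _).smul_right a
    refine h1.add_right ?_
    rw [SemiconjBy, mul_smul_comm, (hu i hi).eq, smul_mul_assoc]
  have hdown : ∀ j, j < m → SemiconjBy (braiding (T.sig q 1) m n) (down (T.sig q 1) n j)
      (down (T.sig q 1) 0 j) := by
    intro j hj
    induction j with
    | zero => exact SemiconjBy.one_right _
    | succ j ih => exact (hs _ _ j hj).mul_right (ih (by omega))
  have hup : ∀ j, j < m → SemiconjBy (braiding (T.sig q 1) m n) (up (T.sig 1 r) n j)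
      (up (T.sig 1 r) 0 j) := by
    intro j hj
    induction j with
    | zero => exact SemiconjBy.one_right _
    | succ j ih => exact (ih (by omega)).mul_right (hs _ _ j hj)
  intro j hj
  induction j with
  | zero =>
    rw [T.circ_zero, T.circ_zero]
    exact (Commute.one_right _).smul_right δ
  | succ j ih =>
    have h1 := (hdown j hj).mul_right (hup j hj)
    have h2 := ih (by omega)
    rw [T.circ_succ hδ, T.circ_succ hδ]
    refine SemiconjBy.add_right ?_ ?_
    · rw [SemiconjBy, mul_smul_comm, wind, h1.eq, smul_mul_assoc, wind]
    · rw [SemiconjBy, mul_smul_comm, h2.eq, smul_mul_assoc]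

theorem commute_u_dbl {m n i : ℕ} (h : i + 1 < n) : Commute (T.u (m + i)) (T.dbl q r m n) := by
  rw [Commute, SemiconjBy, dbl, ← mul_assoc, T.u_add_braiding (sig_left_coeff hqr hδ) m h,
    mul_assoc, T.u_braiding (sig_right_coeff hqr hδ) h, mul_assoc]

/-- Pulling the cap through the two braidings produces the factors r ^ m and q ^ m, which cancel. -/
theorem dbl_cap (m n : ℕ) :
    T.dbl q r m (n + 2) * T.cap (m + n) = T.cap (m + n) * T.dbl q r m n := by
  have h1 : Commute (T.cap (m + n)) (braiding (T.sig 1 r) n m) :=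
    commute_braiding fun i hi => T.commute_sig (T.commute_cap_u (by omega))
  have h2 : Commute (T.cap (m + n)) (braiding (T.sig q 1) m n) :=
    commute_braiding fun i hi => T.commute_sig (T.commute_cap_u (by omega))
  have e1 : braiding (T.sig 1 r) (n + 2) m * T.cap (m + n) =
      r ^ m • (T.cap n * braiding (T.sig 1 r) n m) := by
    rw [T.braiding_succ_left, T.braiding_succ_left, mul_assoc, mul_assoc, ← h1.eq, ← mul_assoc,
      ← mul_assoc, add_comm m n, T.up_up_cap (sig_right_coeff hqr hδ), one_mul, smul_mul_assoc]
  have e2 : braiding (T.sig q 1) m (n + 2) * T.cap n =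
      q ^ m • (T.cap (m + n) * braiding (T.sig q 1) m n) := by
    rw [braiding, braiding, mul_assoc, mul_assoc, ← mul_assoc (down _ _ _),
      T.down_down_cap (sig_left_coeff hqr hδ), mul_one, mul_smul_comm, add_comm n m, h2.eq]
  rw [dbl, mul_assoc, e1, mul_smul_comm, ← mul_assoc, e2, smul_mul_assoc, smul_smul, ← mul_pow,
    mul_comm r q, hqr, one_pow, one_smul, dbl, mul_assoc]

/-- By `dbl_succ` the last strand winds around the m strands between the braidings of the others.
Closing it creates a circle at position n; the braiding carries this circle to position 0, where it
leaves the remaining partial trace. -/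
theorem trace_dbl_succ {m n : ℕ} {f : A} (hf : Commute f (T.cap (m + n))) :
    T.trace m (n + 1) (T.dbl q r m (n + 1) * f) =
      T.circ q r 0 m * T.trace m n (T.dbl q r m n * f) := by
  have h1 : Commute (T.cap (m + n)) (braiding (T.sig 1 r) n m) :=
    commute_braiding fun i hi => T.commute_sig (T.commute_cap_u (by omega))
  have h2 : Commute (T.cup (m + n)) (braiding (T.sig q 1) m n) :=
    commute_braiding fun i hi => T.commute_sig (T.commute_cup_u (by omega))
  have e : T.cup (m + n) * (T.dbl q r m (n + 1) * f) * T.cap (m + n) =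
      T.circ q r 0 m * (T.dbl q r m n * f) := by
    have e1 : T.cup (m + n) * (T.dbl q r m (n + 1) * f) * T.cap (m + n) =
        braiding (T.sig q 1) m n * T.circ q r n m * braiding (T.sig 1 r) n m * f := by
      rw [dbl_succ, mul_assoc, mul_assoc, hf.eq, ← mul_assoc _ (T.cap (m + n)),
        mul_assoc _ _ (T.cap (m + n)), ← h1.eq, ← mul_assoc, ← mul_assoc, ← mul_assoc, ← mul_assoc,
        h2.eq, circ, add_comm n m]
      simp only [mul_assoc]
    rw [e1, (T.semiconj_circ hqr hδ m n le_rfl).eq, dbl]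
    simp only [mul_assoc]
  rw [trace_succ, e, trace_mul_left]
  exact fun j => (T.commute_circ hδ fun i hi => T.commute_cup_u (by omega)).symm

end Encircle

/-- The Chebyshev recursion, with values in a ring. -/
def cheb {B : Type*} [Ring B] (x : B) : ℕ → B
  | 0 => 1
  | 1 => x
  | n + 2 => x * cheb x (n + 1) - cheb x n

theorem map_cheb {B C : Type*} [Ring B] [Ring C] (φ : B →+* C) (x : B) :
    ∀ n, φ (cheb x n) = cheb (φ x) n
  | 0 => map_one φ
  | 1 => rfl
  | n + 2 => by rw [cheb, cheb, map_sub, map_mul, map_cheb φ x (n + 1), map_cheb φ x n]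

/-! ### Circles labeled by Jones-Wenzl elements -/

section Recursion

variable {K : Type*} [Field K] {δ : K} {A : Type*} [Ring A] [Algebra K A] (T : TLSystem δ A)
  {d : ℕ → K} (hd : QInts δ d) {q r : K} (hqr : q * r = 1) (hδ : δ = -(q + r))

include hqr hδ

theorem commute_dbl_jw (m n l : ℕ) (h : l ≤ n) :
    Commute (T.dbl q r m n) (T.jw (wenzl d) m l) :=
  T.commute_jw fun i hi => (T.commute_u_dbl hqr hδ (by omega)).symm

include hd

/-- The cap in u passes through the double braiding and removes two of its strands. Closing one
strand straightens a zigzag; closing the next takes the partial trace of the (n+1)-strand element.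
-/
theorem trace_dbl_jw_u (m n : ℕ) :
    T.trace m (n + 2) (T.dbl q r m (n + 2) * (T.jw (wenzl d) m (n + 1) * T.u (m + n))) =
      (-(d (n + 2) / d (n + 1))) • T.trace m n (T.dbl q r m n * T.jw (wenzl d) m n) := by
  have hcup : Commute (T.cup (m + n + 1)) (T.jw (wenzl d) m (n + 1)) :=
    T.commute_jw fun i hi => T.commute_cup_u (by omega)
  have hcap : Commute (T.cap (m + n)) (T.dbl q r m n) :=
    T.commute_dbl fun i hi => T.commute_cap_u (by omega)
  have e : T.cup (m + n + 1) *
      (T.dbl q r m (n + 2) * (T.jw (wenzl d) m (n + 1) * T.u (m + n))) * T.cap (m + n + 1) =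
      T.jw (wenzl d) m (n + 1) * T.dbl q r m n := by
    rw [← mul_assoc (T.dbl _ _ _ _), (T.commute_dbl_jw hqr hδ m (n + 2) (n + 1) (by omega)).eq,
      mul_assoc _ _ (T.cap (m + n + 1)), mul_assoc _ (T.u _), T.u_cap_succ, mul_assoc, T.dbl_cap hqr hδ,
      ← mul_assoc, hcup.eq, mul_assoc, ← mul_assoc (T.cup _), T.cup_succ_cap, one_mul]
  rw [trace_succ, ← add_assoc, e, trace_succ, mul_assoc, mul_assoc, ← hcap.eq, ← mul_assoc,
    ← mul_assoc, (T.isJW hd m n).trace, smul_mul_assoc, trace_smul,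
    (T.commute_dbl_jw hqr hδ m n n le_rfl).eq]

/-- A circle labeled by a Jones-Wenzl element is a Chebyshev polynomial in the plain circle. -/
theorem trace_dbl_jw (m : ℕ) : ∀ n : ℕ,
    T.trace m n (T.dbl q r m n * T.jw (wenzl d) m n) = cheb (T.circ q r 0 m) n
  | 0 => by simp [trace, cups, caps, dbl, braiding, braiding_zero_left, jw, cheb]
  | 1 => by
    rw [T.trace_dbl_succ hqr hδ (by rw [jw]; exact Commute.one_left _)]
    simp [trace, cups, caps, dbl, braiding, braiding_zero_left, jw, cheb]
  | n + 2 => by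
    have hP : T.IsLocal (m + (n + 2)) (T.jw (wenzl d) m (n + 1)) := fun j hj =>
      T.commute_jw fun i hi => T.commute_u_u (by omega)
    have hu : T.IsLocal (m + (n + 2)) (T.u (m + n)) := fun j hj => T.commute_u_u (by omega)
    have hD : T.IsLocal (m + (n + 2)) (T.dbl q r m (n + 2)) := fun j hj =>
      T.commute_dbl fun i hi => T.commute_u_u (by omega)
    have hcap : Commute (T.jw (wenzl d) m (n + 1)) (T.cap (m + (n + 1))) :=
      (T.commute_jw fun i hi => T.commute_cap_u (by omega)).symm
    have hDP := T.commute_dbl_jw (d := d) hqr hδ m (n + 2) (n + 1) (by omega)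
    -- Cyclicity moves the last projector to the front; it then commutes past the double braiding
    -- and is absorbed by the first one.
    have e : T.trace m (n + 2) (T.dbl q r m (n + 2) * (T.jw (wenzl d) m (n + 1) * T.u (m + n) *
        T.jw (wenzl d) m (n + 1))) = T.trace m (n + 2)
          (T.dbl q r m (n + 2) * (T.jw (wenzl d) m (n + 1) * T.u (m + n))) := by
      rw [← mul_assoc, ← T.trace_jw_comm (by omega) fun j hj =>
        (hD j hj).mul_right ((hP j hj).mul_right (hu j hj)), ← mul_assoc, ← mul_assoc, ← hDP.eq,
        mul_assoc _ _ (T.jw (wenzl d) m (n + 1)), (T.isJW hd m n).idem, mul_assoc]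
    -- Wenzl's coefficient times the partial-trace scalar gives the minus sign of the Chebyshev
    -- recursion.
    have hc : wenzl d n * -(d (n + 2) / d (n + 1)) = -1 := by
      have := hd.ne_zero n
      have := hd.ne_zero (n + 1)
      rw [wenzl]
      field_simp
    rw [jw, mul_add, trace_add, mul_smul_comm, trace_smul, e, T.trace_dbl_jw_u hd hqr hδ,
      T.trace_dbl_succ hqr hδ hcap, trace_dbl_jw m (n + 1), trace_dbl_jw m n, smul_smul, hc, cheb]
    simp [sub_eq_add_neg]

end Recursion

end TLSystem

/-! ### Change of coefficients -/

namespace TLSystem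

section Map

variable {R S : Type*} [CommRing R] [CommRing S] (φ : R →+* S) {δ : R} {δ' : S} (h : φ δ = δ')

theorem map_cup (i : ℕ) : RelAlg.map φ h ((relSystem δ).cup i) = (relSystem δ').cup i := by
  change RelAlg.map φ h (toRel δ i TemperleyLieb.cup) = toRel δ' i TemperleyLieb.cup
  rw [toRel_cup, toRel_cup, RelAlg.map_of, map_one]

theorem map_cap (i : ℕ) : RelAlg.map φ h ((relSystem δ).cap i) = (relSystem δ').cap i := by
  change RelAlg.map φ h (toRel δ i TemperleyLieb.cap) = toRel δ' i TemperleyLieb.cap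
  rw [toRel_cap, toRel_cap, RelAlg.map_of, map_one]

theorem map_u (i : ℕ) : RelAlg.map φ h ((relSystem δ).u i) = (relSystem δ').u i := by
  rw [u, map_mul, map_cup, map_cap, u]

theorem map_sig (a b : R) (i : ℕ) :
    RelAlg.map φ h ((relSystem δ).sig a b i) = (relSystem δ').sig (φ a) (φ b) i := by
  rw [sig, map_add, RelAlg.map_smul, RelAlg.map_smul, map_u, map_one, sig]

theorem map_down {B C : Type*} [Ring B] [Ring C] (F : B →+* C) (σ : ℕ → B) (o : ℕ) :
    ∀ m, F (down σ o m) = down (fun i => F (σ i)) o m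
  | 0 => map_one F
  | m + 1 => by rw [down, map_mul, map_down F σ o m, down]

theorem map_up {B C : Type*} [Ring B] [Ring C] (F : B →+* C) (σ : ℕ → B) (o : ℕ) :
    ∀ m, F (up σ o m) = up (fun i => F (σ i)) o m
  | 0 => map_one F
  | m + 1 => by rw [up, map_mul, map_up F σ o m, up]

theorem map_braiding {B C : Type*} [Ring B] [Ring C] (F : B →+* C) (σ : ℕ → B) (m : ℕ) :
    ∀ n, F (braiding σ m n) = braiding (fun i => F (σ i)) m n
  | 0 => map_one F
  | n + 1 => by rw [braiding, map_mul, map_braiding F σ m n, map_down, braiding]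

theorem map_circ (q r : R) (o m : ℕ) : RelAlg.map φ h ((relSystem δ).circ q r o m) =
    (relSystem δ').circ (φ q) (φ r) o m := by
  simp only [circ, wind, map_mul, map_cup, map_cap, map_down, map_up, map_sig, map_one]

theorem map_dbl (q r : R) (m n : ℕ) : RelAlg.map φ h ((relSystem δ).dbl q r m n) =
    (relSystem δ').dbl (φ q) (φ r) m n := by
  simp only [dbl, map_mul, map_braiding, map_sig, map_one]

theorem map_trace (m : ℕ) : ∀ (n : ℕ) (f : RelAlg R δ),
    RelAlg.map φ h ((relSystem δ).trace m n f) = (relSystem δ').trace m n (RelAlg.map φ h f)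
  | 0, f => by simp [trace, cups, caps]
  | n + 1, f => by rw [trace_succ, map_trace m n, trace_succ, map_mul, map_mul, map_cup, map_cap]

end Map

end TLSystem

/-! ### Morphisms of the Temperley-Lieb category in the algebra of relations -/

section Translate

variable {R : Type*} [CommRing R] {δ : R}

theorem toRel_capCup (o : ℕ) : toRel δ o (capCup δ) = (relSystem δ).u o := by
  rw [capCup, toRel_comp]
  rfl

theorem toRel_pTrOne {m : ℕ} (f : Hom R (m + 1) (m + 1)) :
    toRel δ 0 (pTrOne δ f) =
      (relSystem δ).cup m * toRel δ 0 f * (relSystem δ).cap m := by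
  have e₁ : toRel δ 0 (tensor (idHom m) cup : Hom R m (m + 2)) = (relSystem δ).cup m := by
    refine (toRel_idHom_tensor 0 m cup).trans ?_
    rw [zero_add]
    rfl
  have e₂ : toRel δ 0 (tensor (idHom m) cap : Hom R (m + 2) m) = (relSystem δ).cap m := by
    refine (toRel_idHom_tensor 0 m cap).trans ?_
    rw [zero_add]
    rfl
  have e₃ : toRel δ 0 (tensor f (idHom 1)) = toRel δ 0 f := toRel_tensor_idHom 0 1 f
  rw [pTrOne, toRel_comp, toRel_comp, e₁, e₂, e₃]

theorem toRel_pTr {m : ℕ} : ∀ (n : ℕ) (f : Hom R (m + n) (m + n)),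
    toRel δ 0 (pTr δ n f) = (relSystem δ).trace m n (toRel δ 0 f)
  | 0, f => by simp [pTr, TLSystem.trace, TLSystem.cups, TLSystem.caps]
  | n + 1, f => by
    rw [pTr, toRel_pTr n, toRel_pTrOne, TLSystem.trace_succ]

end Translate

section TranslateBraid

variable {k : Type*} [Field k] (s : k)

theorem toRel_crossing (o : ℕ) : toRel (loopValue (s ^ 2)) o (crossing s) =
    (relSystem (loopValue (s ^ 2))).sig s s⁻¹ o := by
  rw [crossing, map_add, map_smul, map_smul, toRel_capCup, toRel_idHom, TLSystem.sig]

theorem toRel_braidOne (o : ℕ) : ∀ m : ℕ, toRel (loopValue (s ^ 2)) o (braidOne s m) =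
    TLSystem.down ((relSystem (loopValue (s ^ 2))).sig s s⁻¹) o m
  | 0 => toRel_eqHom _ _
  | m + 1 => by
    have e₁ : toRel (loopValue (s ^ 2)) o
        (tensor (idHom m) (crossing s) : Hom k (m + 2) (m + 2)) =
        (relSystem (loopValue (s ^ 2))).sig s s⁻¹ (o + m) :=
      (toRel_idHom_tensor o m (crossing s)).trans (toRel_crossing s (o + m))
    have e₂ : toRel (loopValue (s ^ 2)) o (tensor (braidOne s m) (idHom 1)) =
        toRel (loopValue (s ^ 2)) o (braidOne s m) := toRel_tensor_idHom o 1 _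
    have e₃ : toRel (loopValue (s ^ 2)) o (braidOne s (m + 1)) = _ := toRel_comp o _ _
    rw [e₃, e₁, e₂, toRel_braidOne o m, TLSystem.down]

theorem toRel_braid (m : ℕ) : ∀ n : ℕ, toRel (loopValue (s ^ 2)) 0 (braid s m n) =
    TLSystem.braiding ((relSystem (loopValue (s ^ 2))).sig s s⁻¹) m n
  | 0 => toRel_eqHom _ _
  | n + 1 => by
    have e₁ : toRel (loopValue (s ^ 2)) 0 (tensor (braid s m n) (idHom 1)) =
        toRel (loopValue (s ^ 2)) 0 (braid s m n) := toRel_tensor_idHom 0 1 _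
    have e₂ : toRel (loopValue (s ^ 2)) 0 (tensor (idHom n) (braidOne s m)) =
        toRel (loopValue (s ^ 2)) n (braidOne s m) := by
      rw [toRel_idHom_tensor, zero_add]
    have e₃ : toRel (loopValue (s ^ 2)) 0 (braid s m (n + 1)) = _ := toRel_comp 0 _ _
    rw [e₃, toRel_comp, toRel_eqHom, mul_one, e₁, e₂, toRel_braid m n, toRel_braidOne,
      TLSystem.braiding]

variable {s}

/-- The crossing is s⁻¹ (q + u) and also s (1 + r u), with q = s² and r = q⁻¹. Using one form in
each braiding, the powers of s cancel, so the generic computation needs no square root of X. -/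
theorem toRel_braid_braid (hs : s ≠ 0) (m n : ℕ) :
    toRel (loopValue (s ^ 2)) 0 (comp (loopValue (s ^ 2)) (braid s m n) (braid s n m)) =
      (relSystem (loopValue (s ^ 2))).dbl (s ^ 2) (s ^ 2)⁻¹ m n := by
  have h₁ : (relSystem (loopValue (s ^ 2))).sig s s⁻¹ =
      fun i => s⁻¹ • (relSystem (loopValue (s ^ 2))).sig (s ^ 2) 1 i := by
    funext i
    rw [TLSystem.sig, TLSystem.sig, smul_add, smul_smul, smul_smul, mul_one]
    congr 2
    field_simp
  have h₂ : (relSystem (loopValue (s ^ 2))).sig s s⁻¹ =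
      fun i => s • (relSystem (loopValue (s ^ 2))).sig 1 (s ^ 2)⁻¹ i := by
    funext i
    rw [TLSystem.sig, TLSystem.sig, smul_add, smul_smul, smul_smul, mul_one]
    congr 2
    field_simp
  rw [toRel_comp, toRel_braid, toRel_braid]
  nth_rw 1 [h₁]
  rw [h₂, TLSystem.braiding_smul, TLSystem.braiding_smul, smul_mul_smul_comm, mul_comm n m,
    ← mul_pow, inv_mul_cancel₀ hs, one_pow, one_smul, TLSystem.dbl]

end TranslateBraid

/-! ### The generic Jones-Wenzl projectors -/

section Generic

variable (k : Type*) [Field k]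

theorem ratFunc_X_pow_ne_one {n : ℕ} (hn : n ≠ 0) : (RatFunc.X : RatFunc k) ^ n ≠ 1 := by
  intro h
  have h' : algebraMap (Polynomial k) (RatFunc k) (Polynomial.X ^ n) =
      algebraMap (Polynomial k) (RatFunc k) 1 := by
    rw [map_pow, RatFunc.algebraMap_X, h, map_one]
  have := congrArg Polynomial.natDegree (RatFunc.algebraMap_injective k h')
  simp at this
  exact hn this

theorem X_pow_sub_ne_zero {n : ℕ} (hn : n ≠ 0) :
    (RatFunc.X : RatFunc k) ^ n - RatFunc.X⁻¹ ^ n ≠ 0 := by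
  intro h
  have hX : (RatFunc.X : RatFunc k) ≠ 0 := RatFunc.X_ne_zero
  refine ratFunc_X_pow_ne_one k (n := n + n) (by omega) ?_
  rw [pow_add]
  nth_rw 2 [sub_eq_zero.1 h]
  rw [← mul_pow, mul_inv_cancel₀ hX, one_pow]

theorem qInts_qInt : TLSystem.QInts (loopValue (RatFunc.X : RatFunc k)) (qInt k) := by
  have hX : (RatFunc.X : RatFunc k) ≠ 0 := RatFunc.X_ne_zero
  have h1 := X_pow_sub_ne_zero k one_ne_zero
  rw [pow_one, pow_one] at h1
  refine ⟨by simp [qInt], by simp [qInt, h1], fun n => ?_, fun n => ?_⟩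
  · rw [qInt, qInt, qInt, loopValue, mul_div_assoc', ← sub_div]
    congr 1
    have : (RatFunc.X : RatFunc k) * RatFunc.X⁻¹ = 1 := mul_inv_cancel₀ hX
    linear_combination -(RatFunc.X ^ n - RatFunc.X⁻¹ ^ n) * this
  · exact div_ne_zero (X_pow_sub_ne_zero k (by omega)) h1

/-- The generic Jones-Wenzl elements. -/
abbrev genJW (o n : ℕ) : RelAlg (RatFunc k) (loopValue RatFunc.X) :=
  (relSystem (loopValue (RatFunc.X : RatFunc k))).jw (TLSystem.wenzl (qInt k)) o n

theorem toRel_jonesWenzl (o : ℕ) : ∀ n : ℕ,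
    toRel (loopValue RatFunc.X) o (jonesWenzl k n) = genJW k o n
  | 0 => toRel_idHom o 0
  | 1 => toRel_idHom o 1
  | n + 2 => by
    have e₁ : toRel (loopValue RatFunc.X) o (tensor (jonesWenzl k (n + 1)) (idHom 1)) =
        toRel (loopValue RatFunc.X) o (jonesWenzl k (n + 1)) := toRel_tensor_idHom o 1 _
    have e₂ : toRel (loopValue RatFunc.X) o
        (tensor (idHom n) (capCup (loopValue (RatFunc.X : RatFunc k)))) =
        (relSystem (loopValue (RatFunc.X : RatFunc k))).u (o + n) := by
      rw [toRel_idHom_tensor, toRel_capCup]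
    have e₃ : toRel (loopValue RatFunc.X) o (jonesWenzl k (n + 2)) =
        genJW k o (n + 1) + (qInt k (n + 1) / qInt k (n + 2)) • (genJW k o (n + 1) *
          (relSystem (loopValue (RatFunc.X : RatFunc k))).u (o + n) * genJW k o (n + 1)) := by
      rw [jonesWenzl, map_add, map_smul, toRel_comp, toRel_comp, e₁, e₂,
        toRel_jonesWenzl o (n + 1)]
    rw [e₃, genJW, genJW, TLSystem.jw, TLSystem.wenzl]

theorem toRel_genericE_odd (o a : ℕ) :
    toRel (loopValue RatFunc.X) o (genericE k (2 * a + 1)) = genJW k o (2 * a + 1) := by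
  rw [← toRel_jonesWenzl]
  congr 1
  rcases a with - | a
  · rfl
  · have : ¬ Even (2 * a + 1 + 2) := by simp [parity_simps]
    rw [show 2 * (a + 1) + 1 = 2 * a + 1 + 2 by omega, genericE, if_neg this]

/-- The middle projector is absorbed by its larger neighbour, so the subtracted term is exactly
Wenzl's correction. What remains is the projector on one strand fewer next to a vertical strand, and
no projector on an even number of strands has to be specialized. -/
theorem toRel_genericE_even (o b : ℕ) :
    toRel (loopValue RatFunc.X) o (genericE k (2 * b + 2)) = genJW k o (2 * b + 1) := by
  have hE : Even (2 * b + 2) := by simp [parity_simps]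
  have e₁ : toRel (loopValue RatFunc.X) o (tensor (jonesWenzl k (2 * b + 1)) (idHom 1)) =
      genJW k o (2 * b + 1) := (toRel_tensor_idHom o 1 _).trans (toRel_jonesWenzl k o _)
  have e₂ : toRel (loopValue RatFunc.X) o
      (tensor (idHom (2 * b)) cap : Hom (RatFunc k) (2 * b + 2) (2 * b + 0)) =
      (relSystem (loopValue (RatFunc.X : RatFunc k))).cap (o + 2 * b) := toRel_idHom_tensor o _ cap
  have e₃ : toRel (loopValue RatFunc.X) o
      (tensor (idHom (2 * b)) cup : Hom (RatFunc k) (2 * b + 0) (2 * b + 2)) =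
      (relSystem (loopValue (RatFunc.X : RatFunc k))).cup (o + 2 * b) := toRel_idHom_tensor o _ cup
  have hcap : Commute ((relSystem (loopValue (RatFunc.X : RatFunc k))).cap (o + 2 * b))
      (genJW k o (2 * b)) :=
    TLSystem.commute_jw _ fun i hi => TLSystem.commute_cap_u _ (by omega)
  have hJ := (relSystem (loopValue (RatFunc.X : RatFunc k))).isJW (qInts_qInt k) o (2 * b)
  rw [genericE, if_pos hE, map_sub, map_smul, toRel_comp, toRel_comp, toRel_comp, toRel_comp, e₁]
  rw [e₂, e₃, toRel_jonesWenzl, toRel_jonesWenzl, mul_assoc (genJW k o (2 * b + 1)), hcap.eq,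
    ← mul_assoc (genJW k o (2 * b + 1)), hJ.absorb_right]
  rw [genJW, TLSystem.jw, TLSystem.u, TLSystem.wenzl]
  simp only [mul_assoc, add_sub_cancel_right]

end Generic

/-! ### Specialization -/

section Regular

variable {k : Type*} [Field k]

/-- The rational functions that are regular at `ζ`. -/
def regular (ζ : k) : Subring (RatFunc k) where
  carrier := {f | f.denom.eval₂ (RingHom.id k) ζ ≠ 0}
  one_mem' := by simp
  zero_mem' := by simp
  mul_mem' := fun {f g} hf hg h => by
    have := Polynomial.eval₂_eq_zero_of_dvd_of_eval₂_eq_zero (RingHom.id k) ζ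
      (RatFunc.denom_mul_dvd f g) h
    rw [Polynomial.eval₂_mul] at this
    exact (mul_ne_zero hf hg) this
  add_mem' := fun {f g} hf hg h => by
    have := Polynomial.eval₂_eq_zero_of_dvd_of_eval₂_eq_zero (RingHom.id k) ζ
      (RatFunc.denom_add_dvd f g) h
    rw [Polynomial.eval₂_mul] at this
    exact (mul_ne_zero hf hg) this
  neg_mem' := fun {f} hf h => by
    have hd : (-f).denom ∣ f.denom := by
      rw [RatFunc.denom_dvd (RatFunc.denom_ne_zero f)]
      exact ⟨-f.num, by rw [map_neg, neg_div, RatFunc.num_div_denom]⟩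
    exact hf (Polynomial.eval₂_eq_zero_of_dvd_of_eval₂_eq_zero (RingHom.id k) ζ hd h)

/-- Evaluation of regular functions. -/
def evalReg (ζ : k) : regular ζ →+* k where
  toFun f := f.1.eval (RingHom.id k) ζ
  map_one' := RatFunc.eval_one _ _
  map_zero' := RatFunc.eval_zero _ _
  map_mul' f g := RatFunc.eval_mul _ _ f.2 g.2
  map_add' f g := RatFunc.eval_add _ _ f.2 g.2

theorem evalReg_apply {ζ : k} (f : regular ζ) : evalReg ζ f = f.1.eval (RingHom.id k) ζ := rfl

theorem inv_mem_regular {ζ : k} {f : RatFunc k} (h : f.eval (RingHom.id k) ζ ≠ 0) :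
    f⁻¹ ∈ regular ζ := by
  intro h0
  have hf : f ≠ 0 := by
    rintro rfl
    exact h (RatFunc.eval_zero _ _)
  have hd : (f⁻¹).denom ∣ f.num := by
    rw [RatFunc.denom_dvd (RatFunc.num_ne_zero hf)]
    exact ⟨f.denom, by rw [← inv_div, RatFunc.num_div_denom]⟩
  refine h ?_
  rw [RatFunc.eval,
    Polynomial.eval₂_eq_zero_of_dvd_of_eval₂_eq_zero (RingHom.id k) ζ hd h0, zero_div]

theorem X_mem_regular (ζ : k) : (RatFunc.X : RatFunc k) ∈ regular ζ := by
  change RatFunc.X.denom.eval₂ (RingHom.id k) ζ ≠ 0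
  simp

theorem X_inv_mem_regular {ζ : k} (hζ : ζ ≠ 0) : (RatFunc.X : RatFunc k)⁻¹ ∈ regular ζ :=
  inv_mem_regular (by rwa [RatFunc.eval_X])

theorem evalReg_X_inv {ζ : k} (hζ : ζ ≠ 0) :
    evalReg ζ ⟨(RatFunc.X : RatFunc k)⁻¹, X_inv_mem_regular hζ⟩ = ζ⁻¹ := by
  refine eq_inv_of_mul_eq_one_left ?_
  have h : (⟨(RatFunc.X : RatFunc k)⁻¹, X_inv_mem_regular hζ⟩ : regular ζ) *
      ⟨RatFunc.X, X_mem_regular ζ⟩ = 1 := Subtype.ext (inv_mul_cancel₀ RatFunc.X_ne_zero)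
  have := congrArg (evalReg ζ) h
  rwa [map_mul, map_one, evalReg_apply ⟨RatFunc.X, _⟩, RatFunc.eval_X] at this

/-- The generic loop value as a regular function. -/
def regLoop {ζ : k} (hζ : ζ ≠ 0) : regular ζ :=
  -(⟨RatFunc.X, X_mem_regular ζ⟩ + ⟨RatFunc.X⁻¹, X_inv_mem_regular hζ⟩)

theorem subtype_regLoop {ζ : k} (hζ : ζ ≠ 0) :
    (regular ζ).subtype (regLoop hζ) = loopValue RatFunc.X := rfl

theorem evalReg_regLoop {ζ : k} (hζ : ζ ≠ 0) : evalReg ζ (regLoop hζ) = loopValue ζ := by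
  rw [regLoop, map_neg, map_add, evalReg_X_inv hζ, evalReg_apply, RatFunc.eval_X, loopValue]

/-- Regular elements of the generic algebra of relations, as generic elements. -/
abbrev incl {ζ : k} (hζ : ζ ≠ 0) :
    RelAlg (regular ζ) (regLoop hζ) →+* RelAlg (RatFunc k) (loopValue RatFunc.X) :=
  RelAlg.map (regular ζ).subtype (subtype_regLoop hζ)

/-- Specialization of regular elements of the generic algebra of relations. -/
abbrev spec {ζ : k} (hζ : ζ ≠ 0) :
    RelAlg (regular ζ) (regLoop hζ) →+* RelAlg k (loopValue ζ) :=
  RelAlg.map (evalReg ζ) (evalReg_regLoop hζ)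

/-- The transfer principle: an identity between regular elements need only be checked over `k(X)`,
and `spec` then carries it to ζ. -/
theorem incl_injective {ζ : k} (hζ : ζ ≠ 0) : Function.Injective (incl hζ) :=
  RelAlg.map_injective _ _ Subtype.val_injective

theorem smul_mem_range_incl {ζ : k} (hζ : ζ ≠ 0) {c : RatFunc k} (hc : c ∈ regular ζ)
    {x : RelAlg (RatFunc k) (loopValue RatFunc.X)} (hx : x ∈ (incl hζ).range) :
    c • x ∈ (incl hζ).range := by
  obtain ⟨y, rfl⟩ := hx
  exact ⟨(⟨c, hc⟩ : regular ζ) • y, RelAlg.map_smul _ _ _ _⟩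

theorem u_mem_range_incl {ζ : k} (hζ : ζ ≠ 0) (i : ℕ) :
    (relSystem (loopValue (RatFunc.X : RatFunc k))).u i ∈ (incl hζ).range :=
  ⟨(relSystem (regLoop hζ)).u i, TLSystem.map_u _ _ i⟩

/-- Distinct diagrams give distinct relations, so the coefficients of a regular lift `y` are those
of `f`, and coefficientwise evaluation agrees with the ring homomorphism `spec`. -/
theorem toRel_specialize {ζ : k} (hζ : ζ ≠ 0) {o m n : ℕ} {f : Hom (RatFunc k) m n}
    {y : RelAlg (regular ζ) (regLoop hζ)} (h : incl hζ y = toRel (loopValue RatFunc.X) o f) :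
    toRel (loopValue ζ) o (specialize ζ f) = spec hζ y := by
  have hinj : Function.Injective fun D : Diagram m n => hat o D.rel :=
    fun _ _ h => Subtype.ext (hat_injective o h)
  have hy : ∀ r : LRel, ((show LRel →₀ regular ζ from y) r : RatFunc k) =
      (Finsupp.mapDomain (fun D : Diagram m n => hat o D.rel) f) r :=
    fun r => DFunLike.congr_fun (F := LRel →₀ RatFunc k) h r
  refine Finsupp.ext fun r => ?_
  change (Finsupp.mapDomain (fun D : Diagram m n => hat o D.rel) (specialize ζ f)) r =
    evalReg ζ ((show LRel →₀ regular ζ from y) r)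
  rw [evalReg_apply, hy]
  by_cases hr : r ∈ Set.range fun D : Diagram m n => hat o D.rel
  · obtain ⟨D, rfl⟩ := hr
    rw [Finsupp.mapDomain_apply hinj, Finsupp.mapDomain_apply hinj]
    rfl
  · rw [Finsupp.mapDomain_of_notMem_range _ _ hr, Finsupp.mapDomain_of_notMem_range _ _ hr,
      RatFunc.eval_zero]

end Regular

/-! ### Quantum integers and regularity at a primitive fourth root of unity -/

section FourthRoot

variable {k : Type*} [Field k] {ζ : k}

theorem qInt_add_two (n : ℕ) :
    qInt k (n + 2) = -loopValue RatFunc.X * qInt k (n + 1) - qInt k n :=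
  (qInts_qInt k).recurrence n

/-- The quotients `[2 j] / [2]`. -/
def qHalf (k : Type*) [Field k] : ℕ → RatFunc k
  | 0 => 0
  | 1 => 1
  | j + 2 => (loopValue RatFunc.X ^ 2 - 2) * qHalf k (j + 1) - qHalf k j

theorem qInt_two_mul : ∀ j : ℕ, qInt k (2 * j) = qInt k 2 * qHalf k j
  | 0 => by rw [mul_zero, (qInts_qInt k).zero, qHalf, mul_zero]
  | 1 => by rw [qHalf, mul_one, mul_one]
  | j + 2 => by
    have h4 := qInt_add_two (k := k) (2 * j + 2)
    have h3 := qInt_add_two (k := k) (2 * j + 1)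
    have h2 := qInt_add_two (k := k) (2 * j)
    have ih1 := qInt_two_mul (j + 1)
    have ih0 := qInt_two_mul j
    rw [show 2 * (j + 1) = 2 * j + 2 by ring] at ih1
    rw [show 2 * (j + 2) = 2 * j + 2 + 2 by ring, qHalf]
    linear_combination h4 - loopValue RatFunc.X * h3 + h2 +
      (loopValue RatFunc.X ^ 2 - 2) * ih1 - ih0

variable (hζ : ζ ^ 2 = -1)

include hζ

theorem ne_zero_of_sq_eq : ζ ≠ 0 := by
  rintro rfl
  simp at hζ

theorem inv_eq_neg_of_sq_eq : ζ⁻¹ = -ζ :=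
  inv_eq_of_mul_eq_one_right (by linear_combination -hζ)

theorem evalReg_regLoop_eq_zero : evalReg ζ (regLoop (ne_zero_of_sq_eq hζ)) = 0 := by
  rw [evalReg_regLoop, loopValue, inv_eq_neg_of_sq_eq hζ, add_neg_cancel, neg_zero]

theorem exists_qInt : ∀ n : ℕ,
    (∃ c : regular ζ, (c : RatFunc k) = qInt k (2 * n) ∧ evalReg ζ c = 0) ∧
      ∃ c : regular ζ, (c : RatFunc k) = qInt k (2 * n + 1) ∧ evalReg ζ c = (-1) ^ n
  | 0 => ⟨⟨0, by rw [mul_zero, (qInts_qInt k).zero]; rfl, map_zero _⟩,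
      ⟨1, by rw [mul_zero, zero_add, (qInts_qInt k).one]; rfl, by rw [map_one, pow_zero]⟩⟩
  | n + 1 => by
    obtain ⟨⟨a, ha, ha'⟩, ⟨b, hb, hb'⟩⟩ := exists_qInt n
    have h1 : ((-regLoop (ne_zero_of_sq_eq hζ) * b - a : regular ζ) : RatFunc k) =
        qInt k (2 * n + 2) := by
      rw [qInt_add_two, ← ha, ← hb]
      rfl
    have h1' : evalReg ζ (-regLoop (ne_zero_of_sq_eq hζ) * b - a) = 0 := by
      rw [map_sub, map_mul, map_neg, evalReg_regLoop_eq_zero hζ, ha']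
      ring
    refine ⟨⟨_, h1, h1'⟩, -regLoop (ne_zero_of_sq_eq hζ) *
      (-regLoop (ne_zero_of_sq_eq hζ) * b - a) - b, ?_, ?_⟩
    · rw [show 2 * (n + 1) + 1 = 2 * n + 1 + 2 by ring, qInt_add_two, ← h1, ← hb]
      rfl
    · rw [map_sub, map_mul, h1', hb']
      ring

/-- At δ = 0 the recursion reads c_{j+2} = -2 c_{j+1} - c_j, with solution (-1)^{j+1} j. These
ordinary integers are how the characteristic enters. -/
theorem exists_qHalf : ∀ j : ℕ, ∃ c : regular ζ, (c : RatFunc k) = qHalf k j ∧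
    evalReg ζ c = (-1) ^ (j + 1) * j
  | 0 => ⟨0, rfl, by simp⟩
  | 1 => ⟨1, rfl, by simp⟩
  | j + 2 => by
    obtain ⟨a, ha, ha'⟩ := exists_qHalf j
    obtain ⟨b, hb, hb'⟩ := exists_qHalf (j + 1)
    refine ⟨(regLoop (ne_zero_of_sq_eq hζ) ^ 2 - 2) * b - a, ?_, ?_⟩
    · rw [qHalf, ← ha, ← hb]
      rfl
    · have h2 : evalReg ζ 2 = 2 := map_ofNat _ 2
      rw [map_sub, map_mul, map_sub, map_pow, evalReg_regLoop_eq_zero hζ, ha', hb', h2]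
      push_cast
      ring

theorem qInt_mem_regular (n : ℕ) : qInt k n ∈ regular ζ := by
  rcases Nat.even_or_odd' n with ⟨j, rfl | rfl⟩
  · obtain ⟨⟨c, hc, -⟩, -⟩ := exists_qInt hζ j
    exact hc ▸ c.2
  · obtain ⟨-, ⟨c, hc, -⟩⟩ := exists_qInt hζ j
    exact hc ▸ c.2

theorem div_qInt_odd_mem {f : RatFunc k} (hf : f ∈ regular ζ) (n : ℕ) :
    f / qInt k (2 * n + 1) ∈ regular ζ := by
  rw [div_eq_mul_inv]
  refine (regular ζ).mul_mem hf (inv_mem_regular ?_)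
  obtain ⟨-, ⟨c, hc, hc'⟩⟩ := exists_qInt hζ n
  rw [← hc, ← evalReg_apply, hc']
  exact pow_ne_zero _ (neg_ne_zero.2 one_ne_zero)

/-- Numerator and denominator both vanish at ζ, but through a common factor [2]; after cancelling
it, the denominator takes the value ±(j + 1). -/
theorem qInt_div_qInt_mem {j : ℕ} (hj : ((j + 1 : ℕ) : k) ≠ 0) :
    qInt k (2 * j) / qInt k (2 * (j + 1)) ∈ regular ζ := by
  have h2 : qInt k 2 ≠ 0 := (qInts_qInt k).ne_zero 1
  rw [qInt_two_mul, qInt_two_mul, mul_div_mul_left _ _ h2, div_eq_mul_inv]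
  obtain ⟨a, ha, -⟩ := exists_qHalf hζ j
  obtain ⟨b, hb, hb'⟩ := exists_qHalf hζ (j + 1)
  refine (regular ζ).mul_mem (ha ▸ a.2) (inv_mem_regular ?_)
  rw [← hb, ← evalReg_apply, hb']
  exact mul_ne_zero (pow_ne_zero _ (neg_ne_zero.2 one_ne_zero)) hj

/-- Jones-Wenzl projectors on an odd number of strands are regular at a primitive fourth root of
unity, as long as the characteristic is large. -/
theorem genJW_mem_range (o : ℕ) : ∀ a : ℕ, (∀ j, 1 ≤ j → j ≤ a → ((j : ℕ) : k) ≠ 0) →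
    genJW k o (2 * a + 1) ∈ (incl (ne_zero_of_sq_eq hζ)).range
  | 0, _ => Subring.one_mem _
  -- The two-step recursion with odd index starts from three strands, so this case is expanded by
  -- hand.
  | 1, _ => by
    have hu := u_mem_range_incl (ne_zero_of_sq_eq hζ)
    have hδ := (regLoop (ne_zero_of_sq_eq hζ)).2
    have e : genJW k o (2 * 1 + 1) = _ := TLSystem.jw_three _ (qInts_qInt k) o
    rw [e]
    refine add_mem (add_mem (add_mem (one_mem _) ?_) ?_) ?_
    · exact smul_mem_range_incl _ (div_qInt_odd_mem hζ (neg_mem hδ) 1) (hu o)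
    · exact smul_mem_range_incl _ (div_qInt_odd_mem hζ (qInt_mem_regular hζ 2) 1) (hu (o + 1))
    · exact smul_mem_range_incl _ (div_qInt_odd_mem hζ (qInt_mem_regular hζ 1) 1)
        (add_mem (mul_mem (hu o) (hu (o + 1))) (mul_mem (hu (o + 1)) (hu o)))
  | a + 2, h => by
    have hu := u_mem_range_incl (ne_zero_of_sq_eq hζ)
    have hδ := (regLoop (ne_zero_of_sq_eq hζ)).2
    have ih := genJW_mem_range o (a + 1) fun j h1 h2 => h j h1 (by omega)
    have e : genJW k o (2 * (a + 2) + 1) = _ :=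
      TLSystem.jw_add_four _ (qInts_qInt k) o (2 * a + 1)
    rw [e]
    change genJW k o (2 * a + 1 + 2) ∈ _ at ih
    refine add_mem (add_mem (add_mem (add_mem ih ?_) ?_) ?_) ?_
    · exact smul_mem_range_incl _ (div_qInt_odd_mem hζ
        (mul_mem (neg_mem hδ) (qInt_mem_regular hζ _)) (a + 2)) (mul_mem (mul_mem ih (hu _)) ih)
    · exact smul_mem_range_incl _ (div_qInt_odd_mem hζ (qInt_mem_regular hζ _) (a + 2))
        (mul_mem ih (hu _))
    · exact smul_mem_range_incl _ (div_qInt_odd_mem hζ (qInt_mem_regular hζ _) (a + 2))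
        (add_mem (mul_mem (mul_mem (mul_mem ih (hu _)) ih) (hu _))
          (mul_mem (mul_mem (mul_mem ih (hu _)) (hu _)) ih))
    -- The only even denominator: with k = 2a + 1 the factor [k+1]/[k+3] is [2(a+1)]/[2(a+2)],
    -- regular because a + 2 is nonzero in the field.
    · exact smul_mem_range_incl _ (mul_mem
        (qInt_div_qInt_mem hζ (j := a + 1) (h (a + 2) (by omega) le_rfl))
        (div_qInt_odd_mem hζ (qInt_mem_regular hζ _) (a + 2)))
        (mul_mem (mul_mem (mul_mem (mul_mem (mul_mem ih (hu _)) (hu _)) (hu _)) (hu _)) ih)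

end FourthRoot

/-! ### The encircled idempotents -/

section Chebyshev

variable {k : Type*} [Field k] {B : Type*} [Ring B] [Algebra k B]

/-- At 2ε with ε² = 1 the characteristic polynomial t² - 2εt + 1 has the double root ε, whence the
linear factor n + 1. -/
theorem cheb_mul_of_eigen {x e : B} {ε : k} (hε : ε * ε = 1) (h : x * e = (2 * ε) • e) :
    ∀ n : ℕ, TLSystem.cheb x n * e = ((n + 1) * ε ^ n : k) • e
  | 0 => by simp [TLSystem.cheb]
  | 1 => by
    rw [TLSystem.cheb, h]
    congr 1
    push_cast
    ring
  | n + 2 => by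
    rw [TLSystem.cheb, sub_mul, mul_assoc, cheb_mul_of_eigen hε h (n + 1),
      cheb_mul_of_eigen hε h n, mul_smul_comm, h, smul_smul, ← sub_smul]
    congr 1
    push_cast
    linear_combination (n + 1) * ε ^ n * hε

/-- As x² kills e, only the constant and linear coefficients of the Chebyshev polynomial act: (-1)^a
in degree 2a and (-1)^a (a + 1) in degree 2a + 1. -/
theorem cheb_mul_of_nilpotent {x e l : B} {d : k} (h : x * e = d • l) (hl : x * l = 0) :
    ∀ a : ℕ, TLSystem.cheb x (2 * a) * e = ((-1) ^ a : k) • e ∧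
      TLSystem.cheb x (2 * a + 1) * e = ((-1) ^ a * (a + 1) * d : k) • l
  | 0 => by simp [TLSystem.cheb, h]
  | a + 1 => by
    obtain ⟨h0, h1⟩ := cheb_mul_of_nilpotent h hl a
    have h2 : TLSystem.cheb x (2 * a + 2) * e = ((-1) ^ (a + 1) : k) • e := by
      rw [TLSystem.cheb, sub_mul, mul_assoc, h1, h0, mul_smul_comm, hl, smul_zero, zero_sub,
        ← neg_smul]
      congr 1
      ring
    refine ⟨h2, ?_⟩
    rw [show 2 * (a + 1) + 1 = 2 * a + 1 + 2 by ring, TLSystem.cheb, sub_mul, mul_assoc, h2, h1,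
      mul_smul_comm, h, smul_smul, ← sub_smul]
    congr 1
    push_cast
    ring

end Chebyshev

/-! ### Properties of the specialized projectors -/

section Specialized

variable {k : Type*} [Field k] {ζ : k} (hζ : ζ ^ 2 = -1)

include hζ

/-- The specialized Jones-Wenzl element on an odd number of strands, and a regular generic element
that it comes from. -/
theorem exists_regular_jw {a : ℕ} (ha : ∀ j, 1 ≤ j → j ≤ a → ((j : ℕ) : k) ≠ 0) (o : ℕ) :
    ∃ y, incl (ne_zero_of_sq_eq hζ) y = genJW k o (2 * a + 1) ∧
      toRel (loopValue ζ) o (E ζ (2 * a + 1)) = spec (ne_zero_of_sq_eq hζ) y ∧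
      toRel (loopValue ζ) o (E ζ (2 * a + 2)) = spec (ne_zero_of_sq_eq hζ) y := by
  obtain ⟨y, hy⟩ := genJW_mem_range hζ o a ha
  exact ⟨y, hy, toRel_specialize _ (hy.trans (toRel_genericE_odd k o a).symm),
    toRel_specialize _ (hy.trans (toRel_genericE_even k o a).symm)⟩

variable {a : ℕ} {o : ℕ} {y : RelAlg (regular ζ) (regLoop (ne_zero_of_sq_eq hζ))}
  (hy : incl (ne_zero_of_sq_eq hζ) y = genJW k o (2 * a + 1))

include hy

theorem spec_jw_idem :
    spec (ne_zero_of_sq_eq hζ) y * spec (ne_zero_of_sq_eq hζ) y =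
      spec (ne_zero_of_sq_eq hζ) y := by
  rw [← map_mul]
  congr 1
  apply incl_injective
  rw [map_mul, hy, (TLSystem.isJW _ (qInts_qInt k) o (2 * a)).idem]

theorem u_mul_spec_jw {i : ℕ} (hi : i < 2 * a) :
    (relSystem (loopValue ζ)).u (o + i) * spec (ne_zero_of_sq_eq hζ) y = 0 := by
  rw [← TLSystem.map_u (evalReg ζ) (evalReg_regLoop (ne_zero_of_sq_eq hζ)), ← map_mul]
  refine (congrArg _ ?_).trans (map_zero (spec (ne_zero_of_sq_eq hζ)))
  apply incl_injective
  rw [map_mul, hy, TLSystem.map_u, map_zero,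
    (TLSystem.isJW _ (qInts_qInt k) o (2 * a)).u_mul i hi]

theorem spec_jw_mul_u {i : ℕ} (hi : i < 2 * a) :
    spec (ne_zero_of_sq_eq hζ) y * (relSystem (loopValue ζ)).u (o + i) = 0 := by
  rw [← TLSystem.map_u (evalReg ζ) (evalReg_regLoop (ne_zero_of_sq_eq hζ)), ← map_mul]
  refine (congrArg _ ?_).trans (map_zero (spec (ne_zero_of_sq_eq hζ)))
  apply incl_injective
  rw [map_mul, hy, TLSystem.map_u, map_zero,
    (TLSystem.isJW _ (qInts_qInt k) o (2 * a)).mul_u i hi]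

/-- Generically JuJuJ = -([2a+2]/[2a+1]) JuJ. After clearing the denominator this is an identity of
regular elements, and at ζ one has [2a+2] = 0 while [2a+1] = ±1. -/
theorem spec_jw_nilpotent :
    spec (ne_zero_of_sq_eq hζ) y * (relSystem (loopValue ζ)).u (o + 2 * a) *
      spec (ne_zero_of_sq_eq hζ) y * (relSystem (loopValue ζ)).u (o + 2 * a) *
      spec (ne_zero_of_sq_eq hζ) y = 0 := by
  obtain ⟨⟨c, hc, hc'⟩, -⟩ := exists_qInt hζ (a + 1)
  obtain ⟨-, ⟨d, hd, hd'⟩⟩ := exists_qInt hζ a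
  have hJ := TLSystem.isJW (relSystem (loopValue (RatFunc.X : RatFunc k))) (qInts_qInt k) o (2 * a)
  have hgen : d • (y * (relSystem (regLoop (ne_zero_of_sq_eq hζ))).u (o + 2 * a) * y *
      (relSystem (regLoop (ne_zero_of_sq_eq hζ))).u (o + 2 * a) * y) =
      (-c) • (y * (relSystem (regLoop (ne_zero_of_sq_eq hζ))).u (o + 2 * a) * y) := by
    apply incl_injective
    rw [RelAlg.map_smul, RelAlg.map_smul]
    simp only [map_mul, hy, TLSystem.map_u]
    have hne : qInt k (2 * a + 1) ≠ 0 := (qInts_qInt k).ne_zero (2 * a)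
    have := TLSystem.u_jw_u _ hJ
    rw [mul_assoc (genJW k o (2 * a + 1)), mul_assoc (genJW k o (2 * a + 1)), this, mul_smul_comm,
      smul_mul_assoc, ← mul_assoc, hJ.absorb_right, smul_smul]
    congr 1
    · change (d : RatFunc k) * _ = -(c : RatFunc k)
      rw [hc, hd, show 2 * (a + 1) = 2 * a + 2 by ring]
      field_simp
    · exact mul_assoc _ _ _
  have := congrArg (spec (ne_zero_of_sq_eq hζ)) hgen
  rw [RelAlg.map_smul, RelAlg.map_smul, map_neg, hc', neg_zero, zero_smul, hd'] at this
  simp only [map_mul, TLSystem.map_u] at this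
  exact (smul_eq_zero_iff_right (pow_ne_zero _ (neg_ne_zero.2 one_ne_zero))).1 this

end Specialized

/-! ### Evaluation of the encircled idempotents -/

section Main

variable {k : Type*} [Field k] {s : k} (hs : (s ^ 2) ^ 2 = -1)

include hs

theorem commute_circ_spec_jw {b : ℕ} {y : RelAlg (regular (s ^ 2)) (regLoop (ne_zero_of_sq_eq hs))}
    (hy : incl (ne_zero_of_sq_eq hs) y = genJW k 0 (2 * b + 1)) {m : ℕ} (hm : 2 * b + 1 ≤ m) :
    Commute ((relSystem (loopValue (s ^ 2))).circ (s ^ 2) (s ^ 2)⁻¹ 0 m)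
      (spec (ne_zero_of_sq_eq hs) y) := by
  have hζ := ne_zero_of_sq_eq hs
  have e : (relSystem (loopValue (s ^ 2))).circ (s ^ 2) (s ^ 2)⁻¹ 0 m =
      spec hζ ((relSystem (regLoop hζ)).circ ⟨RatFunc.X, X_mem_regular _⟩
        ⟨RatFunc.X⁻¹, X_inv_mem_regular hζ⟩ 0 m) := by
    rw [TLSystem.map_circ, evalReg_X_inv hζ, evalReg_apply, RatFunc.eval_X]
  rw [e, Commute, SemiconjBy, ← map_mul, ← map_mul]
  congr 1
  apply incl_injective
  rw [map_mul, map_mul, hy, TLSystem.map_circ]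
  exact TLSystem.commute_jw _ fun i hi => (TLSystem.commute_u_circ _
    (mul_inv_cancel₀ RatFunc.X_ne_zero) rfl (by omega)).symm

/-- The induction behind the Chebyshev formula passes through projectors that may have poles at ζ,
so it is run over `k(X)`. Its end result involves only regular elements and can be specialized. -/
theorem trace_spec_jw {a : ℕ} {m : ℕ}
    {y : RelAlg (regular (s ^ 2)) (regLoop (ne_zero_of_sq_eq hs))}
    (hy : incl (ne_zero_of_sq_eq hs) y = genJW k m (2 * a + 1)) :
    (relSystem (loopValue (s ^ 2))).trace m (2 * a + 1) (spec (ne_zero_of_sq_eq hs) y *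
      (relSystem (loopValue (s ^ 2))).dbl (s ^ 2) (s ^ 2)⁻¹ m (2 * a + 1) *
      spec (ne_zero_of_sq_eq hs) y) =
      TLSystem.cheb ((relSystem (loopValue (s ^ 2))).circ (s ^ 2) (s ^ 2)⁻¹ 0 m) (2 * a + 1) := by
  have hζ := ne_zero_of_sq_eq hs
  have e₁ : (relSystem (loopValue (s ^ 2))).circ (s ^ 2) (s ^ 2)⁻¹ 0 m =
      spec hζ ((relSystem (regLoop hζ)).circ ⟨RatFunc.X, X_mem_regular _⟩
        ⟨RatFunc.X⁻¹, X_inv_mem_regular hζ⟩ 0 m) := by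
    rw [TLSystem.map_circ, evalReg_X_inv hζ, evalReg_apply, RatFunc.eval_X]
  have e₂ : (relSystem (loopValue (s ^ 2))).dbl (s ^ 2) (s ^ 2)⁻¹ m (2 * a + 1) =
      spec hζ ((relSystem (regLoop hζ)).dbl ⟨RatFunc.X, X_mem_regular _⟩
        ⟨RatFunc.X⁻¹, X_inv_mem_regular hζ⟩ m (2 * a + 1)) := by
    rw [TLSystem.map_dbl, evalReg_X_inv hζ, evalReg_apply, RatFunc.eval_X]
  rw [e₁, e₂, ← map_mul, ← map_mul, ← TLSystem.map_trace, ← TLSystem.map_cheb]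
  congr 1
  apply incl_injective
  rw [TLSystem.map_trace, TLSystem.map_cheb, map_mul, map_mul, hy, TLSystem.map_circ,
    TLSystem.map_dbl]
  have hqr : (RatFunc.X : RatFunc k) * RatFunc.X⁻¹ = 1 := mul_inv_cancel₀ RatFunc.X_ne_zero
  refine Eq.trans ?_ (TLSystem.trace_dbl_jw (relSystem (loopValue (RatFunc.X : RatFunc k)))
    (qInts_qInt k) hqr rfl m (2 * a + 1))
  congr 1
  have hc := TLSystem.commute_dbl_jw (d := qInt k) (relSystem (loopValue (RatFunc.X : RatFunc k)))
    hqr rfl m (2 * a + 1) (2 * a + 1) le_rfl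
  refine (congrArg (· * genJW k m (2 * a + 1)) hc.eq.symm).trans ?_
  rw [mul_assoc, (TLSystem.isJW _ (qInts_qInt k) m (2 * a)).idem]

theorem toRel_encircle {a : ℕ} (ha : ∀ j, 1 ≤ j → j ≤ a → ((j : ℕ) : k) ≠ 0) (m : ℕ) :
    toRel (loopValue (s ^ 2)) 0 (encircle s m (2 * a + 1)) =
      toRel (loopValue (s ^ 2)) 0 (E (s ^ 2) m) *
        TLSystem.cheb ((relSystem (loopValue (s ^ 2))).circ (s ^ 2) (s ^ 2)⁻¹ 0 m) (2 * a + 1) *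
        toRel (loopValue (s ^ 2)) 0 (E (s ^ 2) m) := by
  have hs0 : s ≠ 0 := fun h => ne_zero_of_sq_eq hs (by rw [h]; ring)
  obtain ⟨y, hy, hE, -⟩ := exists_regular_jw hs ha m
  have hcomm : Commute (toRel (loopValue (s ^ 2)) 0 (E (s ^ 2) m))
      (toRel (loopValue (s ^ 2)) m (E (s ^ 2) (2 * a + 1))) := by
    have h := toRel_interchange (δ := loopValue (s ^ 2)) 0 0 (E (s ^ 2) m) (E (s ^ 2) (2 * a + 1))
    rw [zero_add, add_zero] at h
    exact h
  have hcup : ∀ j, Commute (toRel (loopValue (s ^ 2)) 0 (E (s ^ 2) m))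
      ((relSystem (loopValue (s ^ 2))).cup (m + j)) := fun j => by
    have h := toRel_interchange (δ := loopValue (s ^ 2)) 0 j (E (s ^ 2) m) cup
    rw [zero_add] at h
    exact h
  have hcap : ∀ j, Commute (toRel (loopValue (s ^ 2)) 0 (E (s ^ 2) m))
      ((relSystem (loopValue (s ^ 2))).cap (m + j)) := fun j => by
    have h := toRel_interchange (δ := loopValue (s ^ 2)) 0 j (E (s ^ 2) m) cap
    rw [zero_add] at h
    exact h
  rw [encircle, toRel_pTr, doubleBraid, toRel_comp, toRel_comp, toRel_braid_braid hs0, toRel_tensor,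
    zero_add]
  -- Writing the second tensor product in the opposite order puts both copies of `E_m` outermost,
  -- where they leave the partial trace.
  nth_rw 2 [hcomm.eq]
  rw [← mul_assoc, TLSystem.trace_mul_right _ hcap, mul_assoc, mul_assoc,
    TLSystem.trace_mul_left _ hcup, hE, ← mul_assoc (spec _ y),
    trace_spec_jw hs hy]

/-- The image of the idempotent on `2 * b + 1` strands. -/
theorem exists_jw {b : ℕ} (hb : ∀ j, 1 ≤ j → j ≤ b → ((j : ℕ) : k) ≠ 0) :
    ∃ J : RelAlg k (loopValue (s ^ 2)),
      toRel (loopValue (s ^ 2)) 0 (E (s ^ 2) (2 * b + 1)) = J ∧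
      toRel (loopValue (s ^ 2)) 0 (E (s ^ 2) (2 * b + 2)) = J ∧
      J * J = J ∧
      (∀ i < 2 * b, (relSystem (loopValue (s ^ 2))).u (0 + i) * J = 0) ∧
      (∀ i < 2 * b, J * (relSystem (loopValue (s ^ 2))).u (0 + i) = 0) ∧
      J * (relSystem (loopValue (s ^ 2))).u (2 * b) * J *
        (relSystem (loopValue (s ^ 2))).u (2 * b) * J = 0 ∧
      Commute ((relSystem (loopValue (s ^ 2))).circ (s ^ 2) (s ^ 2)⁻¹ 0 (2 * b + 2)) J := by
  obtain ⟨y, hy, hE1, hE2⟩ := exists_regular_jw hs hb 0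
  have hnil := spec_jw_nilpotent hs hy
  rw [zero_add] at hnil
  exact ⟨spec (ne_zero_of_sq_eq hs) y, hE1, hE2, spec_jw_idem hs hy,
    fun i hi => u_mul_spec_jw hs hy hi, fun i hi => spec_jw_mul_u hs hy hi, hnil,
    commute_circ_spec_jw hs hy (by omega)⟩

theorem encircle_odd {a b : ℕ} (ha : ∀ j, 1 ≤ j → j ≤ a → ((j : ℕ) : k) ≠ 0)
    (hb : ∀ j, 1 ≤ j → j ≤ b → ((j : ℕ) : k) ≠ 0) :
    encircle s (2 * b + 1) (2 * a + 1) =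
      ((2 * (a + 1 : ℕ) : ℕ) * (-1) ^ b : k) • E (s ^ 2) (2 * b + 1) := by
  obtain ⟨J, hE, -, hidem, hu, -, -, -⟩ := exists_jw hs hb
  have hqr : s ^ 2 * (s ^ 2)⁻¹ = 1 := mul_inv_cancel₀ (ne_zero_of_sq_eq hs)
  have hq : ∀ j : ℕ, (s ^ 2) ^ (2 * j) = (-1 : k) ^ j := fun j => by rw [pow_mul, hs]
  have hrq : ∀ j : ℕ, ((s ^ 2)⁻¹) ^ (2 * j) = (-1 : k) ^ j := fun j => by
    rw [inv_eq_neg_of_sq_eq hs, (even_two_mul j).neg_pow, hq]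
  apply toRel_injective (δ := loopValue (s ^ 2)) 0
  rw [toRel_encircle hs ha, map_smul, hE, mul_assoc]
  -- The eigenvalue -(q^{2b+2} + r^{2b+2}) equals -2 (-1)^{b+1}.
  have hx : (relSystem (loopValue (s ^ 2))).circ (s ^ 2) (s ^ 2)⁻¹ 0 (2 * b + 1) * J =
      (2 * (-1) ^ b : k) • J := by
    refine (TLSystem.circ_mul (relSystem (loopValue (s ^ 2))) hqr rfl (o := 0) (m := 2 * b + 1)
      fun i hi => hu i (by omega)).trans ?_
    congr 1
    rw [show 2 * b + 1 + 1 = 2 * (b + 1) by ring, hq, hrq]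
    ring
  have hε : ((-1) ^ b * (-1) ^ b : k) = 1 := by
    rw [← mul_pow]; simp
  rw [cheb_mul_of_eigen hε hx, mul_smul_comm, hidem]
  congr 1
  rw [pow_succ, pow_mul, sq, hε, one_pow]
  push_cast
  ring

theorem encircle_even {a b : ℕ} (ha : ∀ j, 1 ≤ j → j ≤ a → ((j : ℕ) : k) ≠ 0)
    (hb : ∀ j, 1 ≤ j → j ≤ b → ((j : ℕ) : k) ≠ 0) :
    encircle s (2 * b + 2) (2 * a + 1) =
      (2 * (2 * (a + 1 : ℕ) : ℕ) * (-1) ^ (a + b) : k) • L (s ^ 2) (2 * b + 2) := by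
  obtain ⟨J, -, hE, hidem, hu, hu', hnil, hcomm⟩ := exists_jw hs hb
  have hr := inv_eq_neg_of_sq_eq hs
  have hqr : s ^ 2 * (s ^ 2)⁻¹ = 1 := mul_inv_cancel₀ (ne_zero_of_sq_eq hs)
  have hq : ∀ j : ℕ, (s ^ 2) ^ (2 * j) = (-1 : k) ^ j := fun j => by rw [pow_mul, hs]
  have hrq : ∀ j : ℕ, ((s ^ 2)⁻¹) ^ (2 * j) = (-1 : k) ^ j := fun j => by
    rw [hr, (even_two_mul j).neg_pow, hq]
  apply toRel_injective (δ := loopValue (s ^ 2)) 0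
  rw [toRel_encircle hs ha, map_smul, hE, mul_assoc]
  have hL : toRel (loopValue (s ^ 2)) 0 (L (s ^ 2) (2 * b + 2)) =
      J * (relSystem (loopValue (s ^ 2))).u (2 * b) * J := by
    rw [L, toRel_comp, toRel_comp, hE, toRel_idHom_tensor, toRel_capCup, zero_add]
  have hx : (relSystem (loopValue (s ^ 2))).circ (s ^ 2) (s ^ 2)⁻¹ 0 (2 * b + 2) * J =
      (4 * (-1) ^ b : k) • (J * (relSystem (loopValue (s ^ 2))).u (2 * b) * J) := by
    -- Centrality of the circle and idempotency of J turn the sandwich JxJ into xJ. Of the two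
    -- coefficients, that of J vanishes at q² = -1 and the other becomes 4 (-1)^b.
    have h := TLSystem.mul_circ_mul (relSystem (loopValue (s ^ 2))) hqr rfl hu hu' hidem
    rw [← hcomm.eq, mul_assoc, hidem] at h
    rw [h]
    have c1 : (1 - s ^ 2 * s ^ 2) * (s ^ 2) ^ (2 * b + 1) -
        (s ^ 2)⁻¹ * ((s ^ 2) ^ (2 * b + 2) + (s ^ 2)⁻¹ ^ (2 * b + 2)) = 0 := by
      rw [pow_succ (s ^ 2), show 2 * b + 2 = 2 * (b + 1) by ring, hq, hq, hrq, hr]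
      linear_combination (-(s ^ 2) * (-1) ^ b) * hs
    have c2 : (1 - s ^ 2 * s ^ 2) * (2 * (s ^ 2) ^ (2 * b) -
        (s ^ 2)⁻¹ * ((s ^ 2) ^ (2 * b + 1) + (s ^ 2)⁻¹ ^ (2 * b + 1))) = 4 * (-1) ^ b := by
      rw [pow_succ (s ^ 2), pow_succ (s ^ 2)⁻¹, hq, hrq, hr]
      linear_combination (-2 * (-1) ^ b) * hs
    rw [c1, c2, zero_smul, zero_add]
  -- Applying the formula for xJ once more produces JuJuJ, which is zero.
  have hxl : (relSystem (loopValue (s ^ 2))).circ (s ^ 2) (s ^ 2)⁻¹ 0 (2 * b + 2) *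
      (J * (relSystem (loopValue (s ^ 2))).u (2 * b) * J) = 0 := by
    rw [mul_assoc J, ← mul_assoc, hx, smul_mul_assoc, ← mul_assoc, hnil, smul_zero]
  rw [(cheb_mul_of_nilpotent hx hxl a).2, hL, mul_smul_comm, ← mul_assoc J, ← mul_assoc J, hidem]
  congr 1
  push_cast
  ring

end Main

end

end TemperleyLieb

theorem mainTheorem12 {k : Type*} [Field k] [IsAlgClosed k] (p : ℕ) [Fact p.Prime] [CharP k p]
    (ζ s : k) (hζ : IsPrimitiveRoot ζ 4) (hs : s ^ 2 = ζ)
    (a₁ b₁ b₀ v w : ℕ) (ha : 1 ≤ a₁) (hap : a₁ ≤ p - 1) (hb : 1 ≤ b₁) (hbp : b₁ ≤ p - 1)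
    (hv : v = 2 * a₁) (hw : w = 2 * b₁ + b₀) :
    (b₀ = 0 → TemperleyLieb.encircle s (w - 1) (v - 1) =
      ((v : k) * (-1) ^ (b₁ - 1)) • TemperleyLieb.E ζ (w - 1)) ∧
    (b₀ = 1 → TemperleyLieb.encircle s (w - 1) (v - 1) =
      (2 * (v : k) * (-1) ^ ((a₁ - 1) + (b₁ - 1))) • TemperleyLieb.L ζ (w - 1)) := by
  subst hs hv
  obtain ⟨a, rfl⟩ : ∃ a, a₁ = a + 1 := ⟨a₁ - 1, by omega⟩
  obtain ⟨b, rfl⟩ : ∃ b, b₁ = b + 1 := ⟨b₁ - 1, by omega⟩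
  -- The bounds a₁, b₁ ≤ p - 1 enter only here: they keep every integer occurring in a denominator
  -- invertible.
  have hne : ∀ j, 1 ≤ j → j < p → ((j : ℕ) : k) ≠ 0 := fun j h1 h2 h => by
    rw [CharP.cast_eq_zero_iff k p] at h
    exact absurd (Nat.le_of_dvd h1 h) (by omega)
  have hs : (s ^ 2) ^ 2 = -1 := by
    have h1 : (s ^ 2) ^ 4 = 1 := hζ.pow_eq_one
    have h2 : (s ^ 2) ^ 2 ≠ 1 := hζ.pow_ne_one_of_pos_of_lt (by norm_num) (by norm_num)
    have h3 : ((s ^ 2) ^ 2 - 1) * ((s ^ 2) ^ 2 + 1) = 0 := by linear_combination h1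
    exact eq_neg_of_add_eq_zero_left ((mul_eq_zero.1 h3).resolve_left (sub_ne_zero.2 h2))
  have ha' : ∀ j, 1 ≤ j → j ≤ a → ((j : ℕ) : k) ≠ 0 := fun j h1 h2 => hne j h1 (by omega)
  have hb' : ∀ j, 1 ≤ j → j ≤ b → ((j : ℕ) : k) ≠ 0 := fun j h1 h2 => hne j h1 (by omega)
  refine ⟨?_, ?_⟩
  · rintro rfl
    obtain rfl : w = 2 * b + 2 := by omega
    exact TemperleyLieb.encircle_odd hs ha' hb'
  · rintro rfl
    obtain rfl : w = 2 * b + 3 := by omega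
    exact TemperleyLieb.encircle_even hs ha' hb'
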